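/- **Setting.** Let $D\ge 2$, let $M$ be a finite set of momenta (e.g. $\{1,\dots,N\}$), and consider the quartic melonic theory with action $S[\phi,\bar\phi]=\sum_{\mathbf x\in M^D}\bar\phi_{\mathbf x}E_{\mathbf x}\phi_{\mathbf x}+\lambda\sum_{a=1}^D \mathrm{Tr}_{V_a}(\phi,\bar\phi)$, where in the pillow $\mathrm{Tr}_{V_a}=\sum\phi\bar\phi\phi\bar\phi$ the two fields of each of two pairs $(\phi,\bar\phi)$ share all indices except that of colour $a$, and the colour-$a$ index of each $\phi$ is contracted with the $\bar\phi$ of the other pair. Here $E:M^D\to\mathbb R_{>0}$ is such that, for each colour $c$, $E(t_c,s_c):=E_{p_1\ldots t_c\ldots p_D}-E_{p_1\ldots s_c\ldots p_D}$ does not depend on the momenta $p$ of the other colours, and $E(t_c,s_c)\neq 0$ for $t_c\ne s_c$. A *$D$-coloured graph* $g$ is a finite bipartite graph, possibly disconnected, with black and white vertices and one edge of each colour $1,\dots,D$ at each vertex; $\mathrm{Aut}_{\rm c}(g)$ is the group of its automorphisms that preserve the colours of the edges and of the vertices, and graphs are compared by isomorphisms of this kind. Entering momenta $\mathbf X=(\mathbf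 x^w)_w$, $\mathbf x^w\in M^D$, sit at the white vertices; the outgoing momentum of a black vertex $b$ is $\mathbf y^b$ with $y^b_c=x^w_c$ when a $c$-coloured edge joins $w$ and $b$. Automorphisms act on functions of $\mathbf X$ by permuting its columns, $(\sigma\cdot F)(\mathbf X)=F((\mathbf x^{\sigma^{-1}w})_w)$. The swap $\varsigma_c(g;\beta,\rho)$ exchanges the black ends of the $c$-coloured edges at the black vertices $\beta$ and $\rho$. The connected correlation function $G_g(\mathbf X)\in\mathbb R[[\lambda]]$ is the sum of the amplitudes of all connected Feynman graphs of the theory with boundary graph $g$ (with labelled external vertices): at order $n$, $\frac{(-1)^n}{n!}$ times the sum over the colours of $n$ labelled pillows and over all Wick contractions of the $n$ pillows and the external legs that are connected and have boundary $g$, of the product of the propagators $1/E$ summed over the momenta in $M$ of all internal faces. It is defined for all $\mathbf X$, and $W=\sum_g|\mathrm{Aut}_{\rm c}(g)|^{-1}G_g\star\mathbb J(g)$ (over isomorphism classes) is the free energy. For a functional with coefficient functions $u_g$, $\frac{\partial U}{\partial g}(\mathbf X):=\sum_{\sigma\in\mathrm{Aut}_{\rm c}(g)}(\sigma\cdot u_g)(\mathbf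 X)$; thus $\partial W/\partial g=G_g$. The $Y$-term coefficient is $$\mathfrak f^{(c)}_{g,s}(\mathbf X)=\frac1{|\mathrm{Aut}_{\rm c}(g)|}\sum_{\iota}\ \sum_{\mathbf z}G_{g_\iota}(\mathbf X,\mathbf z),$$ where $g_\iota$ is $g$ with a new white and a new black vertex that are joined by a $c$-coloured edge and, for each colour $d\neq c$, are either joined by a $d$-coloured edge or inserted into a $d$-coloured edge of $g$ (all choices $\iota$); $\mathbf z\in M^D$, the momentum of the new white vertex, has $z_c=s$, $z_d=x^w_d$ if the insertion of colour $d$ is into the edge at the white vertex $w$, and is summed over its other components. In particular $\mathfrak f^{(c)}_{\varnothing,s_c}=\sum_{\mathbf q_{\hat c}}G_{\mathrm m}(s_c,\mathbf q_{\hat c})$, $\mathrm m$ being the connected graph with two vertices. **Theorem.** Let $\mathcal D$ be a disconnected $D$-coloured graph and $\mathbf X$ entering momenta for it with $x^w_c\ne x^{w'}_c$ for all $c$ and $w\ne w'$. Choose any black vertex $\beta$ of $\mathcal D$ and let $\mathbf s=\mathbf y^\beta$. Let $\mathcal R$ be the component of $\mathcal D$ containing $\beta$, and let $\mathcal Q$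 consist of all other components, $\mathcal D=\mathcal R\amalg\mathcal Q$; let $X_0$ and $\mathbb X$ be the momenta of $\mathcal R$ and $\mathcal Q$. For a colour $c$ let $\mathbf X|_{s_c\to t}$ be $\mathbf X$ with the (unique) colour-$c$ entry $s_c$ replaced by $t$, and let $\mathrm{Br}^{(2)}(\mathcal R;\beta,c)$ be the set of black vertices $\tau$ of $\mathcal R$ for which $\varsigma_c(\mathcal R;\beta,\tau)$ is disconnected; then it is $\mathcal R'\amalg\mathcal R''$ with $\beta\in\mathcal R'$, $\tau\in\mathcal R''$, and $X_0=(X_0',X_0'')$ accordingly. For coloured graphs $\mathcal C,\mathcal B$ with $\mathcal C\amalg\mathcal B\sim\mathcal Q$ (isomorphic) put $$H^{c,\tau}_{\mathcal C,\mathcal B}=\frac{1}{|\mathrm{Aut}_{\rm c}(\mathcal C)|\,|\mathrm{Aut}_{\rm c}(\mathcal B)|}\big\langle G_{\mathcal R'|\mathcal C}(X_0';\,\cdot\,)\,G_{\mathcal R''|\mathcal B}(X_0'';\,\cdot\,)\big\rangle_{\mathcal Q},\qquad I^{c}_{\mathcal C,\mathcal B}=\frac{1}{|\mathrm{Aut}_{\rm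 c}(\mathcal B)|}\big\langle \mathfrak f^{(c)}_{\mathcal C,s_c}\,G_{\mathcal R|\mathcal B}(X_0;\,\cdot\,)\big\rangle_{\mathcal Q},$$ where $\mathcal A|\mathcal B:=\mathcal A\amalg\mathcal B$ and $\langle\cdot\rangle_{\mathcal Q}$ means that the components of $\mathcal C$ and $\mathcal B$ are placed at those of $\mathcal Q$, in any fixed way. Then, as formal power series in $\lambda$, $$\begin{aligned}G_{\mathcal D}(\mathbf X)=\frac{-2\lambda}{E_{\mathbf s}}\sum_{c=1}^D\Bigg\{&\sum_{\sigma\in\mathrm{Aut}_{\rm c}(\mathcal D)}(\sigma\cdot\mathfrak f^{(c)}_{\mathcal D,s_c})(\mathbf X)+\sum_{\rho\ne\beta}\frac{1}{E(y^\rho_c,s_c)}\bigg[\frac{\partial W}{\partial\varsigma_c(\mathcal D;\beta,\rho)}(\mathbf X)-\frac{\partial W}{\partial\varsigma_c(\mathcal D;\beta,\rho)}(\mathbf X|_{s_c\to y^\rho_c})\bigg]\\&-\sum_{b_c\in M}\frac{1}{E(s_c,b_c)}\big[G_{\mathcal D}(\mathbf X)-G_{\mathcal D}(\mathbf X|_{s_c\to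 b_c})\big]\\&+\sum_{\tau\in\mathrm{Br}^{(2)}(\mathcal R;\beta,c)}\ \sum_{(\mathcal C,\mathcal B):\,\mathcal C\amalg\mathcal B\sim\mathcal Q}\ \sum_{\Omega\in\mathrm{Aut}_{\rm c}(\mathcal Q)}\frac{(\Omega\cdot H^{c,\tau}_{\mathcal C,\mathcal B})(\mathbb X)-(\Omega\cdot H^{c,\tau}_{\mathcal C,\mathcal B})(\mathbb X)\big|_{s_c\to y^\tau_c}}{E(y^\tau_c,s_c)}\\&+\sum_{(\mathcal C,\mathcal B):\,\mathcal C\amalg\mathcal B\sim\mathcal Q}\ \sum_{\Omega\in\mathrm{Aut}_{\rm c}(\mathcal Q)}(\Omega\cdot I^{c}_{\mathcal C,\mathcal B})(\mathbb X)\Bigg\}.\end{aligned}$$ Here $\rho$ runs over all black vertices of $\mathcal D$ other than $\beta$, $(\mathcal C,\mathcal B)$ runs over pairs of (possibly empty) coloured graphs up to isomorphism, and the summand $b_c=s_c$ of the sum over $b_c$, formally $0/0$, is understood as the limit of the difference quotient: it is the derivative of $G_{\mathcal D}(\mathbf X)$ (order by order in $\lambda$) at $t=0$ when $t$ is added to the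 energy $E$ of all propagators traversed by the external colour-$c$ strand of momentum $s_c$. -/

import Mathlib

open scoped Nat

namespace TFT

/-! ### Coloured graphs -/

/-- A (possibly disconnected, possibly empty) closed, vertex-bipartite, regularly
edge-`D`-coloured graph with white vertices `W` and black vertices `B`: for every colour `c` the
`c`-coloured edges are a bijection, `g c w` being the black end of the `c`-edge at the white
vertex `w`. -/
abbrev ColouredGraph (D : ℕ) (W B : Type*) := Fin D → W ≃ B

/-- The underlying simple graph on the set of all vertices. -/
def toSimpleGraph {D : ℕ} {W B : Type*} (g : ColouredGraph D W B) : SimpleGraph (W ⊕ B) :=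
  SimpleGraph.fromRel fun u v => ∃ c w, u = Sum.inl w ∧ v = Sum.inr (g c w)

/-- The graph is connected (in particular not empty). -/
def IsConnected {D : ℕ} {W B : Type*} (g : ColouredGraph D W B) : Prop :=
  (toSimpleGraph g).Connected

/-- The (vertices of the) connected component of the black vertex `β`. -/
def component {D : ℕ} {W B : Type*} (g : ColouredGraph D W B) (β : B) : Set (W ⊕ B) :=
  {u | (toSimpleGraph g).Reachable (Sum.inr β) u}

/-- `S` is the vertex set of a union of connected components of `g`. -/
def IsUnion {D : ℕ} {W B : Type*} (g : ColouredGraph D W B) (S : Set (W ⊕ B)) : Prop :=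
  ∀ c w, Sum.inl w ∈ S ↔ Sum.inr (g c w) ∈ S

theorem adj_edge {D : ℕ} {W B : Type*} (g : ColouredGraph D W B) (c : Fin D) (w : W) :
    (toSimpleGraph g).Adj (Sum.inl w) (Sum.inr (g c w)) := by
  simp only [toSimpleGraph, SimpleGraph.fromRel_adj]
  exact ⟨by simp, Or.inl ⟨c, w, rfl, rfl⟩⟩

theorem isUnion_component {D : ℕ} {W B : Type*} (g : ColouredGraph D W B) (β : B) :
    IsUnion g (component g β) := fun c w =>
  ⟨fun h => SimpleGraph.Reachable.trans h (adj_edge g c w).reachable,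
   fun h => SimpleGraph.Reachable.trans h (adj_edge g c w).symm.reachable⟩

theorem mem_component {D : ℕ} {W B : Type*} (g : ColouredGraph D W B) (β : B) :
    (Sum.inr β : W ⊕ B) ∈ component g β := SimpleGraph.Reachable.refl _

/-- The subgraph of `g` formed by the components in `S`. -/
def restrict {D : ℕ} {W B : Type*} (g : ColouredGraph D W B) (S : Set (W ⊕ B))
    (h : IsUnion g S) :
    ColouredGraph D {w : W // Sum.inl w ∈ S} {b : B // Sum.inr b ∈ S} :=
  fun c => (g c).subtypeEquiv (h c)

/-- Isomorphism of coloured graphs: it respects colours and the types of the vertices. -/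
def Iso {D : ℕ} {W B W' B' : Type*} (g : ColouredGraph D W B) (g' : ColouredGraph D W' B') :
    Prop :=
  ∃ (σ : W ≃ W') (π : B ≃ B'), ∀ c w, g' c (σ w) = π (g c w)

theorem Iso.refl {D : ℕ} {W B : Type*} (g : ColouredGraph D W B) : Iso g g :=
  ⟨Equiv.refl _, Equiv.refl _, fun _ _ => rfl⟩

theorem Iso.symm {D : ℕ} {W B W' B' : Type*} {g : ColouredGraph D W B}
    {g' : ColouredGraph D W' B'} (h : Iso g g') : Iso g' g := by
  obtain ⟨σ, π, h⟩ := h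
  refine ⟨σ.symm, π.symm, fun c w => ?_⟩
  rw [Equiv.eq_symm_apply, ← h, Equiv.apply_symm_apply]

theorem Iso.trans {D : ℕ} {W B W' B' W'' B'' : Type*} {g : ColouredGraph D W B}
    {g' : ColouredGraph D W' B'} {g'' : ColouredGraph D W'' B''}
    (h : Iso g g') (h' : Iso g' g'') : Iso g g'' := by
  obtain ⟨σ, π, h⟩ := h
  obtain ⟨σ', π', h'⟩ := h'
  exact ⟨σ.trans σ', π.trans π', fun c w => by simp [h, h']⟩

/-- The group `Aut_c(g)` of coloured automorphisms, as pairs of permutations of the white and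
of the black vertices. -/
def Aut {D : ℕ} {W B : Type*} (g : ColouredGraph D W B) :
    Subgroup (Equiv.Perm W × Equiv.Perm B) where
  carrier := {Ω | ∀ c w, g c (Ω.1 w) = Ω.2 (g c w)}
  mul_mem' := fun {a b} ha hb c w => (ha c (b.1 w)).trans (congrArg a.2 (hb c w))
  one_mem' := fun _ _ => rfl
  inv_mem' := by
    intro a ha c w
    have h := ha c (a.1⁻¹ w)
    rw [show a.1 (a.1⁻¹ w) = w from Equiv.apply_symm_apply a.1 w] at h
    rw [h]
    exact (Equiv.symm_apply_apply a.2 _).symm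

/-- The coloured automorphisms of `g` that fix every vertex outside `S`. When `S` is a union of
components of `g` this is the group `Aut_c` of the subgraph formed by these components, its
elements being extended by the identity. -/
def AutOn {D : ℕ} {W B : Type*} (g : ColouredGraph D W B) (S : Set (W ⊕ B)) :
    Subgroup (Equiv.Perm W × Equiv.Perm B) where
  carrier := {Ω | Ω ∈ Aut g ∧ (∀ w, Sum.inl w ∉ S → Ω.1 w = w) ∧
    ∀ b, Sum.inr b ∉ S → Ω.2 b = b}
  mul_mem' := by
    rintro a b ⟨ha, ha1, ha2⟩ ⟨hb, hb1, hb2⟩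
    refine ⟨mul_mem ha hb, fun w hw => ?_, fun v hv => ?_⟩
    · simp [hb1 w hw, ha1 w hw]
    · simp [hb2 v hv, ha2 v hv]
  one_mem' := ⟨one_mem _, by simp, by simp⟩
  inv_mem' := by
    rintro a ⟨ha, ha1, ha2⟩
    refine ⟨inv_mem ha, fun w hw => ?_, fun v hv => ?_⟩
    · have := ha1 w hw
      simp only [Prod.fst_inv]
      rw [Equiv.Perm.inv_eq_iff_eq]; exact this.symm
    · have := ha2 v hv
      simp only [Prod.snd_inv]
      rw [Equiv.Perm.inv_eq_iff_eq]; exact this.symm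

open Classical in
/-- The edge swap `ς_c(g; β, ρ)`: the `c`-coloured edges at the black vertices `β` and `ρ`
exchange their black ends. -/
noncomputable def edgeSwap {D : ℕ} {W B : Type*} (g : ColouredGraph D W B) (c : Fin D)
    (β ρ : B) : ColouredGraph D W B :=
  Function.update g c ((g c).trans (Equiv.swap β ρ))

open Classical in
/-- `Br⁽²⁾(R; β, c)`, where `R` is the component of `g` containing the black vertex `β`: the black
vertices `τ` of `R` such that the swap `ς_c(R; β, τ)` is disconnected. -/
noncomputable def bridges {D : ℕ} {W B : Type*} [Fintype B] (g : ColouredGraph D W B)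
    (β : B) (c : Fin D) : Finset B :=
  Finset.univ.filter fun τ => ∃ hτ : Sum.inr τ ∈ component g β,
    ¬ IsConnected (edgeSwap (restrict g (component g β) (isUnion_component g β)) c
      ⟨β, mem_component g β⟩ ⟨τ, hτ⟩)

/-- The ways `Q = C ⨿ 𝓑` of distributing the components of `g` inside `Q` over two graphs. -/
structure Splitting {D : ℕ} {W B : Type*} (g : ColouredGraph D W B) (Q : Set (W ⊕ B)) where
  /-- the components that form the first graph -/
  left : Set (W ⊕ B)
  /-- the components that form the second graph -/
  right : Set (W ⊕ B)
  isUnion_left : IsUnion g left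
  isUnion_right : IsUnion g right
  disjoint : Disjoint left right
  union_eq : left ∪ right = Q

/-- Two splittings are identified when they give, up to coloured isomorphism, the same pair of
graphs. -/
instance splittingSetoid {D : ℕ} {W B : Type*} (g : ColouredGraph D W B) (Q : Set (W ⊕ B)) :
    Setoid (Splitting g Q) where
  r P P' := Iso (restrict g P.left P.isUnion_left) (restrict g P'.left P'.isUnion_left) ∧
    Iso (restrict g P.right P.isUnion_right) (restrict g P'.right P'.isUnion_right)
  iseqv :=
    { refl := fun _ => ⟨Iso.refl _, Iso.refl _⟩
      symm := fun h => ⟨h.1.symm, h.2.symm⟩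
      trans := fun h h' => ⟨h.1.trans h'.1, h.2.trans h'.2⟩ }

/-- The pairs `(C, 𝓑)` of coloured graphs, up to isomorphism, with `C ⨿ 𝓑 ∼ Q`. -/
def FactorPairs {D : ℕ} {W B : Type*} (g : ColouredGraph D W B) (Q : Set (W ⊕ B)) :=
  Quotient (splittingSetoid g Q)

theorem finite_factorPairs {D : ℕ} {W B : Type*} [Finite W] [Finite B]
    (g : ColouredGraph D W B) (Q : Set (W ⊕ B)) : Finite (FactorPairs g Q) := by
  have : Finite (Splitting g Q) :=
    Finite.of_injective (fun P : Splitting g Q => (P.left, P.right)) (by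
      rintro ⟨a, b, _, _, _, _⟩ ⟨a', b', _, _, _, _⟩ h
      simp only [Prod.mk.injEq] at h
      obtain ⟨rfl, rfl⟩ := h
      rfl)
  exact Quotient.finite _

noncomputable instance {D : ℕ} {W B : Type*} [Finite W] [Finite B]
    (g : ColouredGraph D W B) (Q : Set (W ⊕ B)) : Fintype (FactorPairs g Q) :=
  @Fintype.ofFinite _ (finite_factorPairs g Q)

/-- The components of `Q` at which a pair `(C, 𝓑)` with `C ⨿ 𝓑 ∼ Q` is placed. This choice is the
reordering `⟨·⟩_Q` of the momenta of `C` and `𝓑` into those of `Q`. -/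
noncomputable def FactorPairs.place {D : ℕ} {W B : Type*} {g : ColouredGraph D W B}
    {Q : Set (W ⊕ B)} (q : FactorPairs g Q) : Splitting g Q := Quotient.out q

/-! ### Momenta and the action of automorphisms -/

/-- The domain `𝓕` of momenta outside all coloured diagonals. -/
def OffDiagonal {D : ℕ} {W M : Type*} (X : W → Fin D → M) : Prop :=
  ∀ c w w', w ≠ w' → X w c ≠ X w' c

/-- The outgoing momenta `y = g_*(X)`: `y^b_c = x^w_c` if a `c`-edge joins `w` and `b`. -/
def outMomenta {D : ℕ} {W B M : Type*} (g : ColouredGraph D W B) (X : W → Fin D → M) :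
    B → Fin D → M :=
  fun b c => X ((g c).symm b) c

open Classical in
/-- `X|_{s_c → t}` for `s = y^β`: the entry `s_c` of `X`, which sits at the white vertex joined to
`β` by a `c`-edge, is replaced by `t`. -/
noncomputable def substMomentum {D : ℕ} {W B M : Type*} (g : ColouredGraph D W B)
    (X : W → Fin D → M) (β : B) (c : Fin D) (t : M) : W → Fin D → M :=
  Function.update X ((g c).symm β) (Function.update (X ((g c).symm β)) c t)

/-- The action of automorphisms on functions of the momenta,
`(Ω · F)(x^w)_w = F(x^{Ω⁻¹ w})_w`. -/
def act {W B N R : Type*} (Ω : Equiv.Perm W × Equiv.Perm B) (F : (W → N) → R) : (W → N) → R :=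
  fun X => F fun w => X (Ω.1⁻¹ w)

open Classical in
/-- `∑_{Ω ∈ Aut_c(S)} (Ω · F)(X)`, for the automorphisms of the components in `S`. -/
noncomputable def autSum {D : ℕ} {W B N R : Type*} [Fintype W] [Fintype B] [AddCommMonoid R]
    (g : ColouredGraph D W B) (S : Set (W ⊕ B)) (F : (W → N) → R) (X : W → N) : R :=
  ∑ Ω : AutOn g S, act (Ω : Equiv.Perm W × Equiv.Perm B) F X

/-- The graph derivative `∂U/∂g` of a functional `U` in which the graph `g` has the coefficient
function `u`: the sum of `σ · u` over all `σ ∈ Aut_c(g)`. -/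
noncomputable def graphDeriv {D : ℕ} {W B N R : Type*} [Fintype W] [Fintype B] [AddCommMonoid R]
    (g : ColouredGraph D W B) (u : (W → N) → R) (X : W → N) : R :=
  autSum g Set.univ u X

/-! ### Feynman graphs of the quartic melonic theory

The action is `∑_x φ̄_x E_x φ_x + λ ∑_a Tr_{V_a}(φ, φ̄)`. The `i`-th interaction vertex, a pillow
`V_{a i}`, has two fields `φ` and two fields `φ̄`, labelled by `(i, false)` and `(i, true)`. The
source `J` at a white vertex couples to `φ̄`, the source `J̄` at a black vertex couples to `φ`. A Wick
contraction is a bijection `τ` from the fields `φ̄` to the fields `φ`; propagators are labelled by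
their field `φ̄`. -/

/-- The fields (of one of the two types) of a Feynman graph with external vertices `V` and with
`n` pillows. -/
abbrev Slot (V : Type*) (n : ℕ) := V ⊕ (Fin n × Bool)

/-- The index of colour `c` of the field `φ` labelled by `v` is contracted in its pillow with the
index of the field `φ̄` labelled by `pillow a c v`: with the parallel one, if `c` is not
the colour of the pillow, and with the opposite one otherwise. -/
def pillow {D n : ℕ} (a : Fin n → Fin D) (c : Fin D) (v : Fin n × Bool) : Fin n × Bool :=
  (v.1, if a v.1 = c then !v.2 else v.2)

/-- The `c`-coloured strand that enters through the propagator `p` leaves the Feynman graph at the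
external black vertex `b`. -/
inductive StrandEnds {D n : ℕ} {W B : Type*} (a : Fin n → Fin D) (τ : Slot W n ≃ Slot B n)
    (c : Fin D) : Slot W n → B → Prop
  | leave (p : Slot W n) (b : B) (h : τ p = Sum.inl b) : StrandEnds a τ c p b
  | step (p : Slot W n) (v : Fin n × Bool) (b : B) (h : τ p = Sum.inr v)
      (h' : StrandEnds a τ c (Sum.inr (pillow a c v)) b) : StrandEnds a τ c p b

/-- The external `c`-coloured strand that starts at the white vertex `w` runs through the
propagator `p`. -/
inductive OnStrand {D n : ℕ} {W B : Type*} (a : Fin n → Fin D) (τ : Slot W n ≃ Slot B n)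
    (c : Fin D) (w : W) : Slot W n → Prop
  | start : OnStrand a τ c w (Sum.inl w)
  | step (p : Slot W n) (v : Fin n × Bool) (h : OnStrand a τ c w p) (h' : τ p = Sum.inr v) :
      OnStrand a τ c w (Sum.inr (pillow a c v))

/-- The Feynman graph as a graph whose vertices are the external vertices and the pillows, with
the propagators as edges. -/
def feynmanGraph {n : ℕ} {W B : Type*} (τ : Slot W n ≃ Slot B n) :
    SimpleGraph ((W ⊕ B) ⊕ Fin n) :=
  SimpleGraph.fromRel fun u v => ∃ p : Slot W n,
    u = Sum.elim (fun w => Sum.inl (Sum.inl w)) (fun f => Sum.inr f.1) p ∧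
    v = Sum.elim (fun b => Sum.inl (Sum.inr b)) (fun f => Sum.inr f.1) (τ p)

open Classical in
/-- The contractions of pillows of colours `a` that give a connected Feynman graph (not a vacuum
graph) with boundary graph `g`. -/
noncomputable def contractions {D n : ℕ} {W B : Type*} [Fintype W] [Fintype B]
    (g : ColouredGraph D W B) (a : Fin n → Fin D) : Finset (Slot W n ≃ Slot B n) :=
  Finset.univ.filter fun τ => Nonempty W ∧ (feynmanGraph τ).Connected ∧
    ∀ c w, StrandEnds a τ c (Sum.inl w) (g c w)

open Classical in
/-- The assignments of a momentum to each propagator that obey the entering momenta `X` and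
conserve each component of the momentum along the strands of its colour. -/
noncomputable def routings {D n : ℕ} {W B M : Type*} [Fintype W] [Fintype M]
    (a : Fin n → Fin D) (τ : Slot W n ≃ Slot B n) (X : W → Fin D → M) :
    Finset (Slot W n → Fin D → M) :=
  Finset.univ.filter fun m => (∀ w, m (Sum.inl w) = X w) ∧
    ∀ p v c, τ p = Sum.inr v → m (Sum.inr (pillow a c v)) c = m p c

open Classical in
/-- The product of the propagators `1/E`, summed over the momenta of the internal strands. For
`h = 0` this is the Feynman amplitude; in general the energy carried by the external `c`-strand
that starts at `w` is shifted by `h w c`. -/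
noncomputable def amplitude {D n : ℕ} {W B M : Type*} [Fintype W] [Fintype M]
    (E : (Fin D → M) → ℝ) (a : Fin n → Fin D) (τ : Slot W n ≃ Slot B n)
    (X : W → Fin D → M) (h : W → Fin D → ℝ) : ℝ :=
  ∑ m ∈ routings a τ X, ∏ p,
    (E (m p) + ∑ w, ∑ c, if OnStrand a τ c w p then h w c else 0)⁻¹

/-- The correlation function with boundary graph `g` at energies shifted by `h`, as a formal power
series in the coupling `λ`. -/
noncomputable def corrShift {D : ℕ} {W B M : Type*} [Fintype W] [Fintype B] [Fintype M]
    (E : (Fin D → M) → ℝ) (g : ColouredGraph D W B) (X : W → Fin D → M)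
    (h : W → Fin D → ℝ) : PowerSeries ℝ :=
  PowerSeries.mk fun n => (-1 : ℝ) ^ n / (n ! : ℝ) *
    ∑ a : Fin n → Fin D, ∑ τ ∈ contractions g a, amplitude E a τ X h

/-- The connected correlation function `G_g(X)`, a formal power series in the coupling `λ`: the sum
of the amplitudes of all connected Feynman graphs with boundary graph `g`. It is defined at
all momenta, also on the coloured diagonals, and it satisfies `W = ∑_g |Aut_c(g)|⁻¹ G_g ⋆ 𝕁(g)`. -/
noncomputable def corr {D : ℕ} {W B M : Type*} [Fintype W] [Fintype B] [Fintype M]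
    (E : (Fin D → M) → ℝ) (g : ColouredGraph D W B) (X : W → Fin D → M) : PowerSeries ℝ :=
  corrShift E g X 0

open Classical in
/-- The correlation function of the subgraph of `g` formed by the union of components `S`. -/
noncomputable def corrOn {D : ℕ} {W B M : Type*} [Fintype W] [Fintype B] [Fintype M]
    (E : (Fin D → M) → ℝ) (g : ColouredGraph D W B) (S : Set (W ⊕ B))
    (X : W → Fin D → M) : PowerSeries ℝ :=
  if h : IsUnion g S then corr E (restrict g S h) (fun w => X w.1) else 0

/-- The coefficient `|Aut_c(g)|⁻¹ G_g` of the graph `g` in the free energy `W`. -/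
noncomputable def freeEnergyCoeff {D : ℕ} {W B M : Type*} [Fintype W] [Fintype B] [Fintype M]
    (E : (Fin D → M) → ℝ) (g : ColouredGraph D W B) (X : W → Fin D → M) : PowerSeries ℝ :=
  (1 / (Nat.card (Aut g) : ℝ)) • corr E g X

/-! ### The `Y`-term -/

open Classical in
/-- The graph with one more edge `e` (of any colour `c` with `ι c = none`) joining a new white
vertex `none` and a new black vertex `none`: in a colour `c` with `ι c = none` the new vertices are
joined to each other, and if `ι c = some w`, then they are inserted into the `c`-edge at `w`. These
are the graphs from which one recovers `g` by removing `e` and its two ends, and rejoining the open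
edges of equal colour. -/
noncomputable def insertEdge {D : ℕ} {W B : Type*} (g : ColouredGraph D W B)
    (ι : Fin D → Option W) : ColouredGraph D (Option W) (Option B) :=
  fun c => match ι c with
    | none => Equiv.optionCongr (g c)
    | some w => (Equiv.optionCongr (g c)).trans (Equiv.swap none (some (g c w)))

open Classical in
/-- The coefficient `𝔣^{(c)}_{g,s}` of the graph `g` in the `Y`-term
`Y^{(c)}_s = ∑_g 𝔣^{(c)}_{g,s} ⋆ 𝕁(g)`. The `Y`-term is obtained from `W` by
removing, from all graphs and in all possible ways, the two ends of a `c`-coloured edge, the momentum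
`z` of the removed vertices having the component `z_c = s` and being summed over the
components not fixed by the rejoined edges. -/
noncomputable def yCoeff {D : ℕ} {W B M : Type*} [Fintype W] [Fintype B] [Fintype M]
    (E : (Fin D → M) → ℝ) (g : ColouredGraph D W B) (c : Fin D) (s : M)
    (X : W → Fin D → M) : PowerSeries ℝ :=
  (1 / (Nat.card (Aut g) : ℝ)) •
    ∑ ι : Fin D → Option W, if ι c = none then
      ∑ z : Fin D → M, if z c = s ∧ ∀ d w, ι d = some w → z d = X w d then
        corr E (insertEdge g ι) (fun w => w.elim z X) else 0
    else 0

open Classical in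
/-- The coefficient of the `Y`-term at the subgraph formed by the union of components `S`. -/
noncomputable def yCoeffOn {D : ℕ} {W B M : Type*} [Fintype W] [Fintype B] [Fintype M]
    (E : (Fin D → M) → ℝ) (g : ColouredGraph D W B) (S : Set (W ⊕ B)) (c : Fin D) (s : M)
    (X : W → Fin D → M) : PowerSeries ℝ :=
  if h : IsUnion g S then yCoeff E (restrict g S h) c s (fun w => X w.1) else 0

/-! ### The ingredients of the Schwinger-Dyson equation -/

/-- The difference `E(t_c, s_c)` of the kinetic term in colour `c`, the momenta of the other
colours being those of `p`. -/
def kineticDiff {D : ℕ} {M : Type*} (E : (Fin D → M) → ℝ) (p : Fin D → M) (c : Fin D)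
    (t s : M) : ℝ :=
  E (Function.update p c t) - E (Function.update p c s)

open Classical in
/-- `[G_g(X) - G_g(X|_{s_c → b})] / E(s_c, b)`, where `s = y^β`. For `b = s_c` this quotient is
understood as its limit, that is, as the derivative of `G_g(X)`, at each order in `λ`, with
respect to the energy carried by the external `c`-strand of momentum `s_c`. -/
noncomputable def diffQuotient {D : ℕ} {W B M : Type*} [Fintype W] [Fintype B] [Fintype M]
    (E : (Fin D → M) → ℝ) (g : ColouredGraph D W B) (X : W → Fin D → M) (β : B) (c : Fin D)
    (b : M) : PowerSeries ℝ :=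
  if b = outMomenta g X β c then
    PowerSeries.mk fun n => deriv (fun t : ℝ => PowerSeries.coeff n
      (corrShift E g X (Pi.single ((g c).symm β) (Pi.single c t)))) 0
  else
    (1 / kineticDiff E (outMomenta g X β) c (outMomenta g X β c) b) •
      (corr E g X - corr E g (substMomentum g X β c b))

/-- `H^{c,τ}_{C,𝓑} = |Aut_c(C)|⁻¹ |Aut_c(𝓑)|⁻¹ ⟨G_{R'|C}(X₀'; ·) × G_{R''|𝓑}(X₀''; ·)⟩_Q`, where
`R'` and `R''` are the components of the black vertices `β` and `τ` in the graph obtained by the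
swap of colour `c` at `β` and `τ`. -/
noncomputable def bridgeH {D : ℕ} {W B M : Type*} [Fintype W] [Fintype B] [Fintype M]
    (E : (Fin D → M) → ℝ) (g : ColouredGraph D W B) (β : B) (c : Fin D) (τ : B)
    {Q : Set (W ⊕ B)} (q : FactorPairs g Q) (X : W → Fin D → M) : PowerSeries ℝ :=
  (1 / ((Nat.card (AutOn g q.place.left) : ℝ) * (Nat.card (AutOn g q.place.right) : ℝ))) •
    (corrOn E (edgeSwap g c β τ) (component (edgeSwap g c β τ) β ∪ q.place.left) X *
     corrOn E (edgeSwap g c β τ) (component (edgeSwap g c β τ) τ ∪ q.place.right) X)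

/-- `I^{c}_{C,𝓑} = |Aut_c(𝓑)|⁻¹ ⟨𝔣^{(c)}_{C,s} × G_{R|𝓑}(X₀; ·)⟩_Q`, where `R` is the component
of the black vertex `β`. -/
noncomputable def insertionI {D : ℕ} {W B M : Type*} [Fintype W] [Fintype B] [Fintype M]
    (E : (Fin D → M) → ℝ) (g : ColouredGraph D W B) (β : B) (c : Fin D) (s : M)
    {Q : Set (W ⊕ B)} (q : FactorPairs g Q) (X : W → Fin D → M) : PowerSeries ℝ :=
  (1 / (Nat.card (AutOn g q.place.right) : ℝ)) •
    (yCoeffOn E g q.place.left c s X * corrOn E g (component g β ∪ q.place.right) X)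

end TFT

open TFT

open scoped Nat

namespace TFT

open Equiv (Perm swap)

/-! ### Cycles of permutations -/

section Cycles

variable {P P' W : Type*}

/-! The proof is an equation of motion for Wick contractions, written in terms of permutations. If
the strands of colour `c` are closed by the `c`-edges of the boundary graph, they form a permutation
`closing g a τ c` of the propagators. The boundary graph is `g` exactly when no cycle contains two
of the propagators that start at white vertices (`Separates`, `forall_strandEnds_iff`). The Feynman
graph is connected exactly when the permutations of all colours together act transitively (`Linked`,
`feynmanGraph_connected_iff`). The momentum routings are the functions whose `c`-component is
constant on the `c`-cycles (`mem_routings_iff`). Cutting, swapping and inserting edges then become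
multiplication by transpositions, which split or join cycles.

Follow the propagator that ends at `β` backwards. Since the boundary graph is disconnected, it
cannot start at a white vertex, so it starts at one of the `2n` fields `φ̄` of the pillows. Its
momentum is `s`, which gives `1/E_s`, and removing the pillow turns `(-1)^n/n!` into `-2` times
`(-1)^(n-1)/(n-1)!`; this is the prefactor `-2λ/E_s` (`wickSum_succ`, `corr_eq_peeledSeries`). What
remains is a contraction with two open fields, both called `none`. In the colour `c` of the removed
pillow, the strand through them is crossed with the strand at `β`.

These contractions are sorted by the external `c`-strand that contains the open field
(`peeledSum_eq`). If it is the strand of the white vertex joined to `β`, uncrossing turns the open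
fields into the ends of a new `c`-edge, and the `Y`-term results. If it is the strand of another
black vertex `ρ`, or an internal face, the open fields interrupt a propagator on the `c`-strand of
momentum `s_c` in a Feynman graph with boundary `ς_c(𝒟; β, ρ)`, respectively `𝒟`. Behind the
interruption this strand carries `t = y^ρ_c`, respectively a summed momentum `t = b_c`. The sum over
the place of the interruption telescopes, because `1/(E_t E_s) = (1/E_s - 1/E_t)/(E_t - E_s)`. This
is the Ward identity `sum_cutWeight_of_ne`; for `t = s_c` it degenerates to a derivative
(`sum_cutWeight_self`).

The removed pillow may have been the only link between two parts. By `linkedCorr_eq_add` the result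
is the connected function plus all products over a union of components and its complement. The
connected functions give the first three terms of the equation, the products the last two. For a
swap, a count of vertices shows that products occur only if `ρ` belongs to the component of `β` and
the swap disconnects that component (`mem_component_of_isUnion_edgeSwap`); the other components are
distributed arbitrarily over the factors. Finally, a sum over all such distributions is the sum over
pairs `(C, 𝓑)` and over `Aut_c(Q)` with weight `1/(|Aut_c(C)| |Aut_c(𝓑)|)`, by counting the
automorphisms that carry one distribution to another (`sum_factorPairs`). -/

theorem sameCycle_rel {σ : Perm P} {r : P → P → Prop} (hr : Equivalence r)
    (h : ∀ p, r p (σ p)) {p q : P} (hpq : σ.SameCycle p q) : r p q := by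
  obtain ⟨n, rfl⟩ := hpq
  induction n using Int.induction_on with
  | zero => exact hr.refl p
  | succ n ih =>
    rw [zpow_add_one, ← (Commute.self_zpow σ (n : ℤ)).eq, Equiv.Perm.mul_apply]
    exact hr.trans ih (h _)
  | pred n ih =>
    refine hr.trans ih (hr.symm ?_)
    have := h ((σ ^ (-(n : ℤ) - 1)) p)
    rwa [← Equiv.Perm.mul_apply, ← zpow_one_add, add_sub_cancel] at this

theorem sameCycle_eq_of_invariant {N : Type*} {σ : Perm P} {f : P → N}
    (h : ∀ p, f (σ p) = f p) {p q : P} (hpq : σ.SameCycle p q) : f p = f q :=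
  sameCycle_rel (r := fun p q => f p = f q) ⟨fun _ => rfl, fun h => h.symm, fun h h' => h.trans h'⟩
    (fun p => (h p).symm) hpq

theorem sameCycle_iff_of_invariant {σ : Perm P} {f : P → Prop}
    (h : ∀ p, f (σ p) ↔ f p) {p q : P} (hpq : σ.SameCycle p q) : f p ↔ f q :=
  Iff.of_eq (sameCycle_eq_of_invariant (fun p => propext (h p)) hpq)

theorem sameCycle_self_apply (σ : Perm P) (p : P) : σ.SameCycle p (σ p) :=
  Equiv.Perm.sameCycle_apply_right.2 (Equiv.Perm.SameCycle.refl _ _)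

theorem sameCycle_map {σ : Perm P} {σ' : Perm P'} {r : P → P'}
    (h : ∀ p, σ'.SameCycle (r p) (r (σ p))) {p q : P} (hpq : σ.SameCycle p q) :
    σ'.SameCycle (r p) (r q) :=
  sameCycle_rel (r := fun p q => σ'.SameCycle (r p) (r q))
    ⟨fun _ => .refl _ _, fun h => h.symm, fun h h' => h.trans h'⟩ h hpq

theorem sameCycle_congr {σ : Perm P} {σ' : Perm P'} (e : P ≃ P')
    (h : ∀ p, σ' (e p) = e (σ p)) {p q : P} :
    σ'.SameCycle (e p) (e q) ↔ σ.SameCycle p q := by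
  constructor
  · intro H
    have := sameCycle_map (σ' := σ) (r := e.symm) (fun p => by
      obtain ⟨p, rfl⟩ := e.surjective p
      rw [h, e.symm_apply_apply, e.symm_apply_apply]
      exact sameCycle_self_apply _ _) H
    simpa using this
  · exact sameCycle_map fun p => by rw [← h]; exact sameCycle_self_apply _ _

/-- Multiplication by a transposition joins two different cycles. -/
theorem sameCycle_swap_mul_of_not [DecidableEq P] [Finite P] {σ : Perm P} {x y : P} (h : ¬ σ.SameCycle x y) :
    (swap x y * σ).SameCycle x y := by
  -- The cycle of `y` never meets `x`, so the transposition acts on it only when it returns to `y`;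
  -- until then both permutations take the same steps.
  have key : ∀ i : ℕ, (swap x y * σ).SameCycle y ((σ ^ i) y) := by
    intro i
    induction i with
    | zero => exact .refl _ _
    | succ i ih =>
      by_cases hy : (σ ^ (i + 1)) y = y
      · rw [hy]
      · have hx : (σ ^ (i + 1)) y ≠ x := fun hx =>
          h (Equiv.Perm.SameCycle.symm ⟨(i + 1 : ℕ), by rw [zpow_natCast]; exact hx⟩)
        rw [pow_succ', Equiv.Perm.mul_apply] at hx hy ⊢
        have := sameCycle_self_apply (swap x y * σ) ((σ ^ i) y)
        rw [Equiv.Perm.mul_apply, Equiv.swap_apply_of_ne_of_ne hx hy] at this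
        exact ih.trans this
  have h1 : 0 < orderOf σ := orderOf_pos σ
  have h2 := key (orderOf σ - 1)
  refine Equiv.Perm.SameCycle.symm (h2.trans ?_)
  -- At the predecessor of `y` the step back to `y` is redirected to `x`.
  have := sameCycle_self_apply (swap x y * σ) ((σ ^ (orderOf σ - 1)) y)
  rwa [Equiv.Perm.mul_apply, ← Equiv.Perm.mul_apply σ, ← pow_succ', Nat.sub_add_cancel h1,
    pow_orderOf_eq_one, Equiv.Perm.one_apply, Equiv.swap_apply_right] at this

/-- Multiplication by a transposition cuts a cycle. -/
theorem not_sameCycle_swap_mul [DecidableEq P] [Finite P] {σ : Perm P} {x y : P} (hxy : x ≠ y)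
    (h : σ.SameCycle x y) : ¬ (swap x y * σ).SameCycle x y := by
  classical
  obtain ⟨n, hn⟩ := h.exists_nat_pow_eq
  have hex : ∃ n : ℕ, (σ ^ n) x = y := ⟨n, hn⟩
  -- `k` is the first time at which the orbit of `x` meets `y`. The points `x, …, σ^(k-1) x` are
  -- closed under the product, because the step to `y` is redirected to `x`; `y` is not among them.
  set k := Nat.find hex
  have hk : (σ ^ k) x = y := Nat.find_spec hex
  have hmin : ∀ i < k, (σ ^ i) x ≠ y := fun i hi => Nat.find_min hex hi
  have hstep : ∀ p, (∃ i < k, (σ ^ i) x = p) → ∃ i < k, (σ ^ i) x = (swap x y * σ) p := by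
    rintro _ ⟨i, hi, rfl⟩
    rw [Equiv.Perm.mul_apply, ← Equiv.Perm.mul_apply σ, ← pow_succ']
    rcases Nat.lt_or_ge (i + 1) k with h1 | h1
    · have hy := hmin _ h1
      have hx : (σ ^ (i + 1)) x ≠ x := by
        intro hx
        refine hmin (k - (i + 1)) (by omega) ?_
        rw [← hk]
        conv_rhs => rw [← Nat.sub_add_cancel h1.le, pow_add, Equiv.Perm.mul_apply, hx]
      exact ⟨i + 1, h1, (Equiv.swap_apply_of_ne_of_ne hx hy).symm⟩
    · have : i + 1 = k := by omega
      rw [this, hk, Equiv.swap_apply_right]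
      exact ⟨0, by omega, rfl⟩
  intro H
  obtain ⟨n, hn⟩ := H.exists_nat_pow_eq
  have hall : ∀ n : ℕ, ∃ i < k, (σ ^ i) x = ((swap x y * σ) ^ n) x := by
    intro n
    induction n with
    | zero =>
      refine ⟨0, Nat.pos_of_ne_zero fun h0 => hxy ?_, rfl⟩
      rw [h0] at hk; exact hk
    | succ n ih =>
      rw [pow_succ', Equiv.Perm.mul_apply]
      exact hstep _ ih
  obtain ⟨i, hi, hi'⟩ := hall n
  exact hmin i hi (hi'.trans hn)

theorem sameCycle_of_swap_mul [DecidableEq P] {σ : Perm P} {x y p q : P} (h : σ.SameCycle x y)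
    (hpq : (swap x y * σ).SameCycle p q) : σ.SameCycle p q := by
  refine sameCycle_map (r := id) (fun p => ?_) hpq
  simp only [id, Equiv.Perm.mul_apply]
  by_cases hx : σ p = x
  · rw [hx, Equiv.swap_apply_left]
    exact (hx ▸ sameCycle_self_apply σ p : σ.SameCycle p x).trans h
  by_cases hy : σ p = y
  · rw [hy, Equiv.swap_apply_right]
    exact (hy ▸ sameCycle_self_apply σ p : σ.SameCycle p y).trans h.symm
  rw [Equiv.swap_apply_of_ne_of_ne hx hy]
  exact sameCycle_self_apply _ _

/-- In `swap x y * σ` the cycles of `x` and `y` are joined, all others are unchanged. -/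
theorem sameCycle_swap_mul_cases [DecidableEq P] {σ : Perm P} {x y p q : P}
    (hpq : (swap x y * σ).SameCycle p q) :
    σ.SameCycle p q ∨ ((σ.SameCycle p x ∨ σ.SameCycle p y) ∧
      (σ.SameCycle q x ∨ σ.SameCycle q y)) := by
  refine sameCycle_rel (r := fun p q => σ.SameCycle p q ∨ ((σ.SameCycle p x ∨ σ.SameCycle p y) ∧
      (σ.SameCycle q x ∨ σ.SameCycle q y))) ⟨fun _ => .inl (.refl _ _), ?_, ?_⟩ (fun p => ?_) hpq
  · rintro p q (h | h)
    · exact .inl h.symm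
    · exact .inr h.symm
  · rintro p q r (h | h) (h' | h')
    · exact .inl (h.trans h')
    · exact .inr ⟨h'.1.imp h.trans h.trans, h'.2⟩
    · exact .inr ⟨h.1, h.2.imp h'.symm.trans h'.symm.trans⟩
    · exact .inr ⟨h.1, h'.2⟩
  · rw [Equiv.Perm.mul_apply]
    by_cases hx : σ p = x
    · rw [hx, Equiv.swap_apply_left]
      exact .inr ⟨.inl (hx ▸ sameCycle_self_apply _ _), .inr (.refl _ _)⟩
    by_cases hy : σ p = y
    · rw [hy, Equiv.swap_apply_right]
      exact .inr ⟨.inr (hy ▸ sameCycle_self_apply _ _), .inl (.refl _ _)⟩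
    rw [Equiv.swap_apply_of_ne_of_ne hx hy]
    exact .inl (sameCycle_self_apply _ _)

/-! ### Marked points, and cutting one more point off from them. -/

/-- Every cycle of `σ` contains at most one of the points marked by `j`. -/
def Separates (j : W → P) (σ : Perm P) : Prop := ∀ w w', σ.SameCycle (j w) (j w') → w = w'

theorem separates_congr {W' : Type*} {j : W → P} {j' : W' → P'} {σ : Perm P} {σ' : Perm P'}
    (e : P ≃ P') (f : W ≃ W') (hj : ∀ w, j' (f w) = e (j w)) (h : ∀ p, σ' (e p) = e (σ p)) :
    Separates j' σ' ↔ Separates j σ := by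
  constructor
  · intro H w w' hw
    refine f.injective (H _ _ ?_)
    rwa [hj, hj, sameCycle_congr e h]
  · intro H w w' hw
    obtain ⟨w, rfl⟩ := f.surjective w
    obtain ⟨w', rfl⟩ := f.surjective w'
    rw [hj, hj, sameCycle_congr e h] at hw
    rw [H _ _ hw]

/-- Marked points `j` and one more marked point `x`. -/
def addMark (j : W → P) (x : P) : Option W → P := fun o => o.elim x j

@[simp] theorem addMark_none (j : W → P) (x : P) : addMark j x none = x := rfl

@[simp] theorem addMark_some (j : W → P) (x : P) (w : W) : addMark j x (some w) = j w := rfl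

open Classical in
/-- `σ` followed by the transposition of `x` and `y`. -/
noncomputable def mulSwap (x y : P) (σ : Perm P) : Perm P := swap x y * σ

theorem mulSwap_eq [DecidableEq P] (x y : P) (σ : Perm P) : mulSwap x y σ = swap x y * σ := by
  unfold mulSwap; congr!

/-- The permutation that cuts the cycle of `x` between `x` and the marked point `o`. -/
noncomputable def cut (j : W → P) (x : P) (o : Option W) (σ : Perm P) : Perm P :=
  mulSwap x (addMark j x o) σ

@[simp] theorem cut_none (j : W → P) (x : P) (σ : Perm P) : cut j x none σ = σ := by
  classical rw [cut, addMark_none, mulSwap, Equiv.swap_self]; rfl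

@[simp] theorem cut_some (j : W → P) (x : P) (w : W) (σ : Perm P) :
    cut j x (some w) σ = mulSwap x (j w) σ := rfl

theorem separates_addMark {j : W → P} {x : P} {σ : Perm P} :
    Separates (addMark j x) σ ↔ Separates j σ ∧ ∀ w, ¬ σ.SameCycle x (j w) := by
  constructor
  · intro h
    refine ⟨fun w w' hw => Option.some_injective _ (h (some w) (some w') hw), fun w hw => ?_⟩
    have := h none (some w) hw
    simp at this
  · rintro ⟨h, h'⟩ (_ | w) (_ | w') hw
    · rfl
    · exact absurd hw (h' _)
    · exact absurd hw.symm (h' _)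
    · rw [h _ _ hw]

/-- A transposition splits a cycle that contains both points and joins two cycles that contain one
each. So the cut leaves `x` without company exactly when `j w` was the marked point on its cycle;
`hx` excludes the trivial transposition. -/
theorem separates_addMark_cut_some [Finite P] {j : W → P} {x : P} {σ : Perm P} {w : W}
    (hx : ∀ w, x ≠ j w) :
    Separates (addMark j x) (cut j x (some w) σ) ↔ Separates j σ ∧ σ.SameCycle x (j w) := by
  classical
  rw [separates_addMark, cut_some, mulSwap_eq]
  constructor
  · rintro ⟨h, h'⟩
    -- The transposition is an involution, so `σ` arises from the cut permutation by joining the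
    -- cycles of `x` and `j w` again.
    have hσ : σ = swap x (j w) * (swap x (j w) * σ) := by
      rw [← mul_assoc, Equiv.swap_mul_self, one_mul]
    refine ⟨fun w1 w2 h12 => ?_, ?_⟩
    · rw [hσ] at h12
      rcases sameCycle_swap_mul_cases h12 with h12 | ⟨h1, h2⟩
      · exact h _ _ h12
      · rcases h1 with h1 | h1
        · exact absurd h1.symm (h' _)
        rcases h2 with h2 | h2
        · exact absurd h2.symm (h' _)
        rw [h _ _ h1, h _ _ h2]
    · rw [hσ]
      exact sameCycle_swap_mul_of_not (h' w)
  · rintro ⟨h, h'⟩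
    refine ⟨fun w1 w2 h12 => h _ _ (sameCycle_of_swap_mul h' h12), fun w1 h1 => ?_⟩
    have h2 := sameCycle_of_swap_mul h' h1
    have : w1 = w := h _ _ (h2.symm.trans h')
    subst this
    exact not_sameCycle_swap_mul (hx _) h' h1

/-- If `σ` separates the marked points, there is exactly one way of cutting off `x`. -/
theorem separates_iff_existsUnique_cut [Finite P] {j : W → P} {x : P} {σ : Perm P}
    (hx : ∀ w, x ≠ j w) :
    Separates j σ ↔ ∃ o, Separates (addMark j x) (cut j x o σ) := by
  constructor
  · intro h
    by_cases hw : ∃ w, σ.SameCycle x (j w)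
    · obtain ⟨w, hw⟩ := hw
      exact ⟨some w, (separates_addMark_cut_some hx).2 ⟨h, hw⟩⟩
    · exact ⟨none, by rw [cut_none, separates_addMark]; exact ⟨h, not_exists.1 hw⟩⟩
  · rintro ⟨_ | w, h⟩
    · rw [cut_none, separates_addMark] at h
      exact h.1
    · exact ((separates_addMark_cut_some hx).1 h).1

/-- At most one marked point lies on the cycle of `x`, and only a cut at that point, or no cut if
there is none, isolates `x`. -/
theorem cut_unique [Finite P] {j : W → P} {x : P} {σ : Perm P}
    (hx : ∀ w, x ≠ j w) {o o' : Option W} (h : Separates (addMark j x) (cut j x o σ))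
    (h' : Separates (addMark j x) (cut j x o' σ)) : o = o' := by
  rcases o with _ | w <;> rcases o' with _ | w'
  · rfl
  · rw [cut_none, separates_addMark] at h
    exact absurd ((separates_addMark_cut_some hx).1 h').2 (h.2 _)
  · rw [cut_none, separates_addMark] at h'
    exact absurd ((separates_addMark_cut_some hx).1 h).2 (h'.2 _)
  · have h1 := (separates_addMark_cut_some hx).1 h
    have h2 := (separates_addMark_cut_some hx).1 h'
    rw [h1.1 _ _ (h1.2.symm.trans h2.2)]

open Classical in
-- Exactly one cut isolates `x`, so exactly one summand survives. This sorts the contractions by the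
-- strand on which an open field lies.
theorem sum_separates_cut [Fintype W] [Finite P] {R : Type*} [AddCommMonoid R] {j : W → P} {x : P}
    {σ : Perm P} (hx : ∀ w, x ≠ j w) (r : R) :
    (if Separates j σ then r else 0) =
      ∑ o, if Separates (addMark j x) (cut j x o σ) then r else 0 := by
  by_cases h : Separates j σ
  · obtain ⟨o, ho⟩ := (separates_iff_existsUnique_cut hx).1 h
    rw [if_pos h, Finset.sum_eq_single o, if_pos ho]
    · intro o' _ hne
      rw [if_neg]
      exact fun ho' => hne (cut_unique hx ho' ho)
    · simp
  · rw [if_neg h, Finset.sum_eq_zero]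
    intro o _
    rw [if_neg]
    exact fun ho => h ((separates_iff_existsUnique_cut hx).2 ⟨o, ho⟩)

/-! ### Insertion of a point into a permutation. -/

open Classical in
/-- The permutation of `Option P` in which `none` is inserted in front of `x`. -/
noncomputable def insertBefore (x : P) (σ : Perm P) : Perm (Option P) :=
  (Equiv.optionCongr σ).trans (swap none (some x))

theorem insertBefore_none (x : P) (σ : Perm P) : insertBefore x σ none = some x := by
  simp [insertBefore]

theorem insertBefore_of_eq {x p : P} {σ : Perm P} (h : σ p = x) :
    insertBefore x σ (some p) = none := by
  simp [insertBefore, h]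

theorem insertBefore_of_ne {x p : P} {σ : Perm P} (h : σ p ≠ x) :
    insertBefore x σ (some p) = some (σ p) := by
  simp only [insertBefore, Equiv.trans_apply, Equiv.optionCongr_apply, Option.map_some]
  classical exact Equiv.swap_apply_of_ne_of_ne (by simp) (by simpa using h)

/-- The inserted point only repeats the value at `x` and hands it on, so the condition on the old
points is the old one. It is applied to momenta and, with values in `Prop`, to invariant sets. -/
theorem forall_insertBefore {x : P} {σ : Perm P} {N : Type*} (f : Option P → N) :
    (∀ p, f (insertBefore x σ p) = f p) ↔
      f none = f (some x) ∧ ∀ p, f (some (σ p)) = f (some p) := by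
  constructor
  · intro h
    have h0 : f none = f (some x) := by rw [← h none, insertBefore_none]
    refine ⟨h0, fun p => ?_⟩
    by_cases hp : σ p = x
    · rw [← h (some p), insertBefore_of_eq hp, hp, h0]
    · rw [← h (some p), insertBefore_of_ne hp]
  · rintro ⟨h0, h⟩ (_ | p)
    · rw [insertBefore_none, h0]
    · by_cases hp : σ p = x
      · rw [insertBefore_of_eq hp, h0, ← h p, hp]
      · rw [insertBefore_of_ne hp, h]

theorem sameCycle_insertBefore {x : P} {σ : Perm P} {p q : P} :
    (insertBefore x σ).SameCycle (some p) (some q) ↔ σ.SameCycle p q := by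
  constructor
  -- Contracting `none` onto `x` turns each step of the larger permutation into one step of `σ` or
  -- into none.
  · refine sameCycle_map (r := fun o : Option P => o.getD x) fun p => ?_
    rcases p with _ | p
    · simp only [insertBefore_none, Option.getD]; exact .refl _ _
    · by_cases hp : σ p = x
      · rw [insertBefore_of_eq hp]
        simp only [Option.getD]
        exact hp ▸ sameCycle_self_apply _ _
      · rw [insertBefore_of_ne hp]
        exact sameCycle_self_apply _ _
  · refine sameCycle_map fun p => ?_
    have h := sameCycle_self_apply (insertBefore x σ) (some p)
    by_cases hp : σ p = x
    · rw [insertBefore_of_eq hp] at h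
      rw [hp]
      refine h.trans ?_
      have := sameCycle_self_apply (insertBefore x σ) none
      rwa [insertBefore_none] at this
    · rwa [insertBefore_of_ne hp] at h

theorem separates_insertBefore {x : P} {σ : Perm P} {j : W → P} :
    Separates (fun w => some (j w)) (insertBefore x σ) ↔ Separates j σ := by
  simp only [Separates, sameCycle_insertBefore]

end Cycles

/-! ### Families of permutations with marked points -/

section Families

variable {D : ℕ} {P P' W W' M : Type*}

/-- A function that takes the same value at `x` and `y` does not see the transposition. Hence
cutting changes neither the conserved momenta nor the invariant sets, as long as these do not
distinguish the two points. -/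
theorem forall_mulSwap {x y : P} {σ : Perm P} {N : Type*} {f : P → N} (h : f x = f y) :
    (∀ p, f (mulSwap x y σ p) = f p) ↔ ∀ p, f (σ p) = f p := by
  classical
  refine forall_congr' fun p => ?_
  rw [mulSwap_eq, Equiv.Perm.mul_apply]
  by_cases hx : σ p = x
  · rw [hx, Equiv.swap_apply_left, h]
  by_cases hy : σ p = y
  · rw [hy, Equiv.swap_apply_right, h]
  rw [Equiv.swap_apply_of_ne_of_ne hx hy]

theorem forall_mulSwap_iff {x y : P} {σ : Perm P} {U : Set P} (h : x ∈ U ↔ y ∈ U) :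
    (∀ p, mulSwap x y σ p ∈ U ↔ p ∈ U) ↔ ∀ p, σ p ∈ U ↔ p ∈ U := by
  have := forall_mulSwap (σ := σ) (f := fun p => p ∈ U) (propext h)
  simpa only [eq_iff_iff] using this

/-- `U` is a union of orbits. -/
def Invariant (σ : Fin D → Perm P) (U : Set P) : Prop := ∀ c p, σ c p ∈ U ↔ p ∈ U

theorem Invariant.compl {σ : Fin D → Perm P} {U : Set P} (h : Invariant σ U) :
    Invariant σ Uᶜ := fun c p => not_congr (h c p)

theorem Invariant.inter {σ : Fin D → Perm P} {U V : Set P} (h : Invariant σ U)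
    (h' : Invariant σ V) : Invariant σ (U ∩ V) := fun c p => and_congr (h c p) (h' c p)

theorem Invariant.mem_iff_of_sameCycle {σ : Fin D → Perm P} {U : Set P} (h : Invariant σ U)
    {c : Fin D} {p q : P} (hpq : (σ c).SameCycle p q) : p ∈ U ↔ q ∈ U :=
  sameCycle_iff_of_invariant (f := (· ∈ U)) (h c) hpq

/-- The action of `σ` becomes transitive when the orbits of `x` and `y` are joined. -/
def Linked (σ : Fin D → Perm P) (x y : P) : Prop :=
  ∀ U, Invariant σ U → (x ∈ U ↔ y ∈ U) → U.Nonempty → ∀ p, p ∈ U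

theorem linked_self_iff {σ : Fin D → Perm P} {x : P} :
    Linked σ x x ↔ ∀ U, Invariant σ U → U.Nonempty → ∀ p, p ∈ U := by
  simp [Linked]

theorem Linked.of_self {σ : Fin D → Perm P} {x : P} (h : Linked σ x x) (y z : P) :
    Linked σ y z := fun U hU _ => h U hU Iff.rfl

theorem invariant_preimage {σ : Fin D → Perm P} {σ' : Fin D → Perm P'} (e : P ≃ P')
    (h : ∀ c p, σ' c (e p) = e (σ c p)) {U : Set P'} :
    Invariant σ (e ⁻¹' U) ↔ Invariant σ' U := by
  constructor
  · intro H c p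
    obtain ⟨p, rfl⟩ := e.surjective p
    rw [h]; exact H c p
  · intro H c p
    rw [Set.mem_preimage, ← h, H, Set.mem_preimage]

theorem linked_congr {σ : Fin D → Perm P} {σ' : Fin D → Perm P'} (e : P ≃ P')
    (h : ∀ c p, σ' c (e p) = e (σ c p)) {x y : P} :
    Linked σ' (e x) (e y) ↔ Linked σ x y := by
  constructor
  · intro H U hU hxy hne p
    have := H (e.symm ⁻¹' U) ?_ (by simpa using hxy) ?_ (e p)
    · simpa using this
    · rw [← invariant_preimage e h]
      simpa [← Set.preimage_comp] using hU
    · obtain ⟨q, hq⟩ := hne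
      exact ⟨e q, by simpa using hq⟩
  · intro H U hU hxy hne p
    have := H (e ⁻¹' U) ((invariant_preimage e h).2 hU) hxy ?_ (e.symm p)
    · simpa using this
    · obtain ⟨q, hq⟩ := hne
      exact ⟨e.symm q, by simpa using hq⟩

/-- An assignment of momenta to the points that takes the values `X` at the marked points, and
whose `c`-component is constant on the cycles of `σ c`. -/
def IsRouting (j : W → P) (X : W → Fin D → M) (σ : Fin D → Perm P) (m : P → Fin D → M) : Prop :=
  (∀ w, m (j w) = X w) ∧ ∀ c p, m (σ c p) c = m p c

theorem IsRouting.apply_eq_of_sameCycle {j : W → P} {X : W → Fin D → M} {σ : Fin D → Perm P}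
    {m : P → Fin D → M} (h : IsRouting j X σ m) {c : Fin D} {p q : P}
    (hpq : (σ c).SameCycle p q) : m p c = m q c :=
  sameCycle_eq_of_invariant (f := fun p => m p c) (h.2 c) hpq

open Classical in
/-- The product of the propagators, summed over all routings. -/
noncomputable def weight [Fintype P] [Fintype M] (E : (Fin D → M) → ℝ) (j : W → P)
    (X : W → Fin D → M) (σ : Fin D → Perm P) : ℝ :=
  ∑ m : P → Fin D → M, if IsRouting j X σ m then ∏ p, (E (m p))⁻¹ else 0

theorem isRouting_congr {j : W → P} {j' : W' → P'} {X : W → Fin D → M} {X' : W' → Fin D → M}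
    {σ : Fin D → Perm P} {σ' : Fin D → Perm P'} (e : P ≃ P') (f : W ≃ W')
    (hj : ∀ w, j' (f w) = e (j w)) (hX : ∀ w, X' (f w) = X w)
    (h : ∀ c p, σ' c (e p) = e (σ c p)) {m : P' → Fin D → M} :
    IsRouting j X σ (fun p => m (e p)) ↔ IsRouting j' X' σ' m := by
  refine and_congr ?_ ?_
  · rw [← f.forall_congr_right (q := fun w => m (j' w) = X' w)]
    simp only [hj, hX]
  · refine forall_congr' fun c => ?_
    rw [← e.forall_congr_right (q := fun p => m (σ' c p) c = m p c)]
    simp only [h]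

theorem weight_congr [Fintype P] [Fintype P'] [Fintype M] {E : (Fin D → M) → ℝ} {j : W → P}
    {j' : W' → P'} {X : W → Fin D → M} {X' : W' → Fin D → M}
    {σ : Fin D → Perm P} {σ' : Fin D → Perm P'} (e : P ≃ P') (f : W ≃ W')
    (hj : ∀ w, j' (f w) = e (j w)) (hX : ∀ w, X' (f w) = X w)
    (h : ∀ c p, σ' c (e p) = e (σ c p)) :
    weight E j' X' σ' = weight E j X σ := by
  classical
  unfold weight
  refine Fintype.sum_equiv (e.arrowCongr (Equiv.refl (Fin D → M))).symm _ _ fun m => ?_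
  have h1 : ((e.arrowCongr (Equiv.refl (Fin D → M))).symm m) = fun p => m (e p) := rfl
  simp only [h1, isRouting_congr e f hj hX h]
  congr 1
  exact (Fintype.prod_equiv e _ _ fun p => rfl).symm

theorem sum_option_pi {N R : Type*} [Fintype N] {_ : Fintype (Option P → N)}
    {_ : Fintype (P → N)} [AddCommMonoid R]
    (F : (Option P → N) → R) :
    ∑ m : Option P → N, F m = ∑ z : N, ∑ m : P → N, F (fun o => o.elim z m) := by
  rw [← Fintype.sum_prod_type' (f := fun z (m : P → N) => F (fun o => o.elim z m))]
  refine Fintype.sum_equiv (Equiv.piOptionEquivProd (β := fun _ : Option P => N)) _ _ fun m => ?_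
  congr 1
  funext o
  cases o <;> rfl

theorem sum_sum_pi {N R : Type*} {_ : Fintype (P ⊕ P' → N)} {_ : Fintype (P → N)}
    {_ : Fintype (P' → N)} [AddCommMonoid R] (F : (P ⊕ P' → N) → R) :
    ∑ m, F m = ∑ a : P → N, ∑ b : P' → N, F (Sum.elim a b) := by
  rw [← Fintype.sum_prod_type' (f := fun (a : P → N) (b : P' → N) => F (Sum.elim a b))]
  refine Fintype.sum_equiv (Equiv.sumArrowEquivProdArrow P P' N) _ _ fun m => ?_
  congr 1
  funext o
  cases o <;> rfl

/-- In each colour the inserted propagator precedes a marked point, so all components of its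
momentum are fixed and it contributes one factor. It will be the propagator that ends at `β`, and
the factor will be `1/E_s`. -/
theorem weight_insertBefore [Fintype P] [Fintype M] {E : (Fin D → M) → ℝ} {j : W → P}
    {X : W → Fin D → M} {σ : Fin D → Perm P} (w : Fin D → W) :
    weight E (fun v => some (j v)) X (fun c => insertBefore (j (w c)) (σ c)) =
      (E fun c => X (w c) c)⁻¹ * weight E j X σ := by
  classical
  unfold weight
  rw [sum_option_pi, Finset.sum_comm, Finset.mul_sum]
  refine Finset.sum_congr rfl fun m _ => ?_
  have key : ∀ z : Fin D → M, IsRouting (fun v => some (j v)) X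
      (fun c => insertBefore (j (w c)) (σ c)) (fun o => o.elim z m) ↔
      z = (fun c => X (w c) c) ∧ IsRouting j X σ m := by
    intro z
    unfold IsRouting
    have : ∀ c, (∀ p : Option P, (insertBefore (j (w c)) (σ c) p).elim z m c = p.elim z m c) ↔ _ :=
      fun c => forall_insertBefore (fun o : Option P => o.elim z m c)
    simp only [this, Option.elim_some, Option.elim_none]
    constructor
    · rintro ⟨h1, h2⟩
      refine ⟨funext fun c => ?_, h1, fun c => (h2 c).2⟩
      rw [(h2 c).1, h1]
    · rintro ⟨rfl, h1, h2⟩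
      exact ⟨h1, fun c => ⟨by rw [h1], h2 c⟩⟩
  simp only [key, Fintype.prod_option, Option.elim_some, Option.elim_none]
  rw [Finset.sum_eq_single (fun c => X (w c) c)]
  · simp
  · intro z _ hz
    rw [if_neg]
    exact fun h => hz h.1
  · simp

open Classical in
/-- A routing for the permutations `σ` is a routing for the cut permutations: the momentum of the
additional marked point is determined in the colours in which it has been cut off from a marked
point, and arbitrary in the others. -/
theorem weight_eq_sum_cut [Fintype P] [Fintype M] {E : (Fin D → M) → ℝ} {j : W → P}
    {X : W → Fin D → M} {σ : Fin D → Perm P} {x : P} (ι : Fin D → Option W)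
    (h : ∀ c w, ι c = some w → (σ c).SameCycle x (j w)) :
    weight E j X σ = ∑ z : Fin D → M, if ∀ c w, ι c = some w → z c = X w c then
      weight E (addMark j x) (fun o => o.elim z X) (fun c => cut j x (ι c) (σ c)) else 0 := by
  unfold weight
  -- The routings of `σ` are sorted by the momentum `z` of `x`. The constraint on `z` makes the
  -- values at both ends of each transposition agree, so that the transposition is invisible.
  have h0 : ∀ z : Fin D → M, (if ∀ c w, ι c = some w → z c = X w c then
      ∑ m : P → Fin D → M, (if IsRouting (addMark j x) (fun o => o.elim z X)
        (fun c => cut j x (ι c) (σ c)) m then ∏ p, (E (m p))⁻¹ else 0) else 0) =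
      ∑ m : P → Fin D → M, if (m x = z ∧ IsRouting j X σ m) then ∏ p, (E (m p))⁻¹ else 0 := by
    intro z
    have key : ∀ m : P → Fin D → M, (m x = z ∧ IsRouting j X σ m) ↔
        (∀ c w, ι c = some w → z c = X w c) ∧ IsRouting (addMark j x) (fun o => o.elim z X)
        (fun c => cut j x (ι c) (σ c)) m := by
      intro m
      constructor
      · rintro ⟨rfl, hm⟩
        refine ⟨fun c w hw => ?_, ?_, ?_⟩
        · rw [hm.apply_eq_of_sameCycle (h c w hw), hm.1]
        · rintro (_ | w)
          · rfl
          · exact hm.1 w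
        · intro c
          simp only [cut]
          rw [forall_mulSwap (f := fun p => m p c)]
          · exact hm.2 c
          · rcases hc : ι c with _ | w
            · rfl
            · exact hm.apply_eq_of_sameCycle (h c w hc)
      · rintro ⟨hz, h1, h2⟩
        refine ⟨h1 none, fun w => h1 (some w), fun c => ?_⟩
        have := h2 c
        simp only [cut] at this
        rw [forall_mulSwap (f := fun p => m p c)] at this
        · exact this
        · rcases hc : ι c with _ | w
          · rfl
          · rw [addMark_some]
            have e1 := h1 none
            have e2 := h1 (some w)
            simp only [addMark_none, addMark_some, Option.elim_none, Option.elim_some] at e1 e2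
            rw [e1, e2]
            exact hz c w hc
    by_cases hz : ∀ c w, ι c = some w → z c = X w c
    · rw [if_pos hz]
      refine Finset.sum_congr rfl fun m _ => ?_
      refine if_congr ?_ rfl rfl
      rw [key, and_iff_right hz]
    · rw [if_neg hz, Finset.sum_eq_zero]
      intro m _
      rw [if_neg]
      exact fun hm => hz ((key m).1 hm).1
  simp only [h0]
  rw [Finset.sum_comm]
  refine Finset.sum_congr rfl fun m _ => ?_
  rw [Finset.sum_eq_single (m x)]
  · simp
  · intro z _ hz
    rw [if_neg]
    exact fun h => hz h.1.symm
  · simp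

/-! ### Disjoint unions -/

section Sum

variable {P₁ P₂ W₁ W₂ : Type*} {σ₁ : Fin D → Perm P₁} {σ₂ : Fin D → Perm P₂}
  {j₁ : W₁ → P₁} {j₂ : W₂ → P₂}

theorem weight_sumCongr [Fintype P₁] [Fintype P₂] [Fintype M] {E : (Fin D → M) → ℝ}
    {X : W₁ ⊕ W₂ → Fin D → M} :
    weight E (Sum.map j₁ j₂) X (fun c => Perm.sumCongr (σ₁ c) (σ₂ c)) =
      weight E j₁ (fun w => X (Sum.inl w)) σ₁ * weight E j₂ (fun w => X (Sum.inr w)) σ₂ := by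
  classical
  unfold weight
  rw [sum_sum_pi, Finset.sum_mul_sum]
  refine Finset.sum_congr rfl fun a _ => Finset.sum_congr rfl fun b _ => ?_
  have h : IsRouting (Sum.map j₁ j₂) X (fun c => Perm.sumCongr (σ₁ c) (σ₂ c)) (Sum.elim a b) ↔
      IsRouting j₁ (fun w => X (Sum.inl w)) σ₁ a ∧
      IsRouting j₂ (fun w => X (Sum.inr w)) σ₂ b := by
    simp only [IsRouting, Sum.forall, Sum.map_inl, Sum.map_inr, Equiv.Perm.sumCongr_apply,
      Sum.elim_inl, Sum.elim_inr]
    constructor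
    · rintro ⟨⟨h1, h2⟩, h3⟩
      exact ⟨⟨h1, fun c => (h3 c).1⟩, h2, fun c => (h3 c).2⟩
    · rintro ⟨⟨h1, h3⟩, h2, h4⟩
      exact ⟨⟨h1, h2⟩, fun c => ⟨h3 c, h4 c⟩⟩
  rw [ite_zero_mul_ite_zero]
  refine if_congr h ?_ rfl
  rw [Fintype.prod_sum_type]
  rfl

theorem sameCycle_sumCongr_inl {s₁ : Perm P₁} {s₂ : Perm P₂} {p q : P₁} :
    (Perm.sumCongr s₁ s₂).SameCycle (Sum.inl p) (Sum.inl q) ↔ s₁.SameCycle p q := by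
  constructor
  · intro h
    refine (sameCycle_map (σ' := s₁) (r := fun o : P₁ ⊕ P₂ => o.elim id fun _ => p) ?_ h)
    rintro (a | a)
    · exact sameCycle_self_apply _ _
    · exact .refl _ _
  · exact sameCycle_map fun a => by
      have := sameCycle_self_apply (Perm.sumCongr s₁ s₂) (Sum.inl a)
      exact this

theorem sameCycle_sumCongr_inr {s₁ : Perm P₁} {s₂ : Perm P₂} {p q : P₂} :
    (Perm.sumCongr s₁ s₂).SameCycle (Sum.inr p) (Sum.inr q) ↔ s₂.SameCycle p q := by
  constructor
  · intro h
    refine (sameCycle_map (σ' := s₂) (r := fun o : P₁ ⊕ P₂ => o.elim (fun _ => p) id) ?_ h)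
    rintro (a | a)
    · exact .refl _ _
    · exact sameCycle_self_apply _ _
  · exact sameCycle_map fun a => by
      have := sameCycle_self_apply (Perm.sumCongr s₁ s₂) (Sum.inr a)
      exact this

theorem not_sameCycle_sumCongr {s₁ : Perm P₁} {s₂ : Perm P₂} {p : P₁} {q : P₂} :
    ¬ (Perm.sumCongr s₁ s₂).SameCycle (Sum.inl p) (Sum.inr q) := by
  intro h
  have := sameCycle_eq_of_invariant (f := fun o : P₁ ⊕ P₂ => o.isLeft) (by rintro (a | a) <;> rfl) h
  simp at this

theorem separates_sumCongr {s₁ : Perm P₁} {s₂ : Perm P₂} :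
    Separates (Sum.map j₁ j₂) (Perm.sumCongr s₁ s₂) ↔ Separates j₁ s₁ ∧ Separates j₂ s₂ := by
  constructor
  · intro h
    refine ⟨fun w w' hw => Sum.inl_injective (h (.inl w) (.inl w') ?_),
      fun w w' hw => Sum.inr_injective (h (.inr w) (.inr w') ?_)⟩
    · exact sameCycle_sumCongr_inl.2 hw
    · exact sameCycle_sumCongr_inr.2 hw
  · rintro ⟨h1, h2⟩ (w | w) (w' | w') hw
    · rw [h1 _ _ (sameCycle_sumCongr_inl.1 hw)]
    · exact absurd hw not_sameCycle_sumCongr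
    · exact absurd hw.symm not_sameCycle_sumCongr
    · rw [h2 _ _ (sameCycle_sumCongr_inr.1 hw)]

theorem linked_sumCongr {x : P₁} {y : P₂} :
    Linked (fun c => Perm.sumCongr (σ₁ c) (σ₂ c)) (Sum.inl x) (Sum.inr y) ↔
      Linked σ₁ x x ∧ Linked σ₂ y y := by
  simp only [linked_self_iff]
  constructor
  · intro h
    constructor
    · intro U hU hne p
      -- `U` is completed by the whole of the other summand or by nothing of it, so that it contains
      -- both or neither of `x` and `y`.
      by_cases hx : x ∈ U
      · have := h (Sum.elim U (fun _ => True)) ?_ ?_ ?_ (Sum.inl p)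
        · exact this
        · rintro c (q | q)
          · exact hU c q
          · exact Iff.rfl
        · exact ⟨fun _ => trivial, fun _ => hx⟩
        · exact ⟨Sum.inl x, hx⟩
      · have := h (Sum.elim U (fun _ => False)) ?_ ?_ ?_ (Sum.inl p)
        · exact this
        · rintro c (q | q)
          · exact hU c q
          · exact Iff.rfl
        · exact ⟨fun h => hx h, fun h => h.elim⟩
        · exact ⟨Sum.inl hne.some, hne.some_mem⟩
    · intro U hU hne p
      by_cases hy : y ∈ U
      · have := h (Sum.elim (fun _ => True) U) ?_ ?_ ?_ (Sum.inr p)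
        · exact this
        · rintro c (q | q)
          · exact Iff.rfl
          · exact hU c q
        · exact ⟨fun _ => hy, fun _ => trivial⟩
        · exact ⟨Sum.inr y, hy⟩
      · have := h (Sum.elim (fun _ => False) U) ?_ ?_ ?_ (Sum.inr p)
        · exact this
        · rintro c (q | q)
          · exact Iff.rfl
          · exact hU c q
        · exact ⟨fun h => h.elim, fun h => hy h⟩
        · exact ⟨Sum.inr hne.some, hne.some_mem⟩
  · rintro ⟨h1, h2⟩ U hU hxy hne p
    have i1 : Invariant σ₁ (Sum.inl ⁻¹' U) := fun c q => hU c (Sum.inl q)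
    have i2 : Invariant σ₂ (Sum.inr ⁻¹' U) := fun c q => hU c (Sum.inr q)
    have key : Sum.inl x ∈ U := by
      obtain ⟨q | q, hq⟩ := hne
      · exact h1 _ i1 ⟨q, hq⟩ x
      · exact hxy.2 (h2 _ i2 ⟨q, hq⟩ y)
    rcases p with p | p
    · exact h1 _ i1 ⟨x, key⟩ p
    · exact h2 _ i2 ⟨y, hxy.1 key⟩ p

end Sum

end Families

/-! ### Wick contractions as permutations of the propagators -/

section Closing

variable {D : ℕ} {W B I M : Type*}

/-- The contraction of the fields of the pillows, in colour `c`. -/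
def pillowEquiv (a : I → Fin D) (c : Fin D) : Perm (I × Bool) where
  toFun v := (v.1, if a v.1 = c then !v.2 else v.2)
  invFun v := (v.1, if a v.1 = c then !v.2 else v.2)
  left_inv := by rintro ⟨i, b⟩; by_cases h : a i = c <;> simp [h]
  right_inv := by rintro ⟨i, b⟩; by_cases h : a i = c <;> simp [h]

theorem pillowEquiv_apply (a : I → Fin D) (c : Fin D) (v : I × Bool) :
    pillowEquiv a c v = (v.1, if a v.1 = c then !v.2 else v.2) := rfl

/-- The fields `φ` are identified with the fields `φ̄` along the `c`-coloured index
contractions of the pillows and the `c`-coloured edges of `g`. -/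
def fieldEquiv (g : ColouredGraph D W B) (a : I → Fin D) (c : Fin D) :
    B ⊕ (I × Bool) ≃ W ⊕ (I × Bool) :=
  Equiv.sumCongr (g c).symm (pillowEquiv a c)

/-- The permutation of the propagators that follows the strands of colour `c`, which are closed by
the edges of `g`. -/
def closing (g : ColouredGraph D W B) (a : I → Fin D)
    (τ : W ⊕ (I × Bool) ≃ B ⊕ (I × Bool)) (c : Fin D) : Perm (W ⊕ (I × Bool)) :=
  τ.trans (fieldEquiv g a c)

theorem closing_apply (g : ColouredGraph D W B) (a : I → Fin D)
    (τ : W ⊕ (I × Bool) ≃ B ⊕ (I × Bool)) (c : Fin D) (p : W ⊕ (I × Bool)) :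
    closing g a τ c p = fieldEquiv g a c (τ p) := rfl

theorem fieldEquiv_inl (g : ColouredGraph D W B) (a : I → Fin D) (c : Fin D) (b : B) :
    fieldEquiv g a c (Sum.inl b) = Sum.inl ((g c).symm b) := rfl

theorem fieldEquiv_inr (g : ColouredGraph D W B) (a : I → Fin D) (c : Fin D) (v : I × Bool) :
    fieldEquiv g a c (Sum.inr v) = Sum.inr (pillowEquiv a c v) := rfl

open Classical in
/-- The sum of `ω` over all Wick contractions with boundary graph `g` that become connected when
the components of the white vertices `x` and `y` are joined. -/
noncomputable def wickSum [Fintype W] [Fintype B] (I : Type*) [Fintype I]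
    (g : ColouredGraph D W B) (x y : W) (ω : (Fin D → Perm (W ⊕ (I × Bool))) → ℝ) : ℝ :=
  ∑ a : I → Fin D, ∑ τ : W ⊕ (I × Bool) ≃ B ⊕ (I × Bool),
    if (∀ c, Separates Sum.inl (closing g a τ c)) ∧
      Linked (closing g a τ) (Sum.inl x) (Sum.inl y) then ω (closing g a τ) else 0

/-- The sum of all Feynman amplitudes with boundary graph `g` and with at most two components: a
single one, or one at the white vertex `x` and one at the white vertex `y`. -/
noncomputable def linkedCorr [Fintype W] [Fintype B] [Fintype M] (E : (Fin D → M) → ℝ)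
    (g : ColouredGraph D W B) (x y : W) (X : W → Fin D → M) : PowerSeries ℝ :=
  PowerSeries.mk fun n => (-1 : ℝ) ^ n / (n ! : ℝ) *
    wickSum (Fin n) g x y (weight E Sum.inl X)

theorem exists_ne_colour (hD : 2 ≤ D) (c : Fin D) : ∃ d : Fin D, d ≠ c := by
  have : Nontrivial (Fin D) := Fin.nontrivial_iff_two_le.2 hD
  exact exists_ne c

/-- A field `φ` of a pillow is contracted with the opposite `φ̄` in the colour of the pillow and
with the parallel one in all other colours. Since `D ≥ 2`, both kinds occur, and both fields `φ̄`
lie in one orbit. -/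
theorem Invariant.pillow_mem_iff (hD : 2 ≤ D) {g : ColouredGraph D W B} {a : I → Fin D}
    {τ : W ⊕ (I × Bool) ≃ B ⊕ (I × Bool)} {U : Set (W ⊕ (I × Bool))}
    (hU : Invariant (closing g a τ) U) (i : I) (e e' : Bool) :
    Sum.inr (i, e) ∈ U ↔ Sum.inr (i, e') ∈ U := by
  obtain ⟨d, hd⟩ := exists_ne_colour hD (a i)
  have key : ∀ e, Sum.inr (i, !e) ∈ U ↔ Sum.inr (i, e) ∈ U := by
    intro e
    have h1 := hU (a i) (τ.symm (Sum.inr (i, e)))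
    have h2 := hU d (τ.symm (Sum.inr (i, e)))
    rw [closing_apply, Equiv.apply_symm_apply, fieldEquiv_inr, pillowEquiv_apply] at h1 h2
    simp only [if_true, if_neg hd.symm] at h1 h2
    exact h1.trans h2.symm
  cases e <;> cases e' <;> first | rfl | exact key true | exact key false

theorem Invariant.mem_of_inr_iff (hD : 2 ≤ D) {g : ColouredGraph D W B} {a : I → Fin D}
    {τ : W ⊕ (I × Bool) ≃ B ⊕ (I × Bool)} {U : Set (W ⊕ (I × Bool))}
    (hU : Invariant (closing g a τ) U) {p : W ⊕ (I × Bool)} {v : I × Bool}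
    (h : τ p = Sum.inr v) (e : Bool) : p ∈ U ↔ Sum.inr (v.1, e) ∈ U := by
  have c : Fin D := ⟨0, by omega⟩
  rw [← hU c p, closing_apply, h, fieldEquiv_inr, pillowEquiv_apply]
  exact hU.pillow_mem_iff hD _ _ _

end Closing

/-! ### Strands -/

section Strands

variable {D n : ℕ} {W B M : Type*} {g : ColouredGraph D W B} {a : Fin n → Fin D}
  {τ : Slot W n ≃ Slot B n}

theorem strandEnds_iff_inr {c : Fin D} {p : Slot W n} {v : Fin n × Bool} {b : B}
    (h : τ p = Sum.inr v) :
    StrandEnds a τ c p b ↔ StrandEnds a τ c (Sum.inr (pillow a c v)) b := by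
  constructor
  · rintro (⟨_, _, h'⟩ | ⟨_, v', _, h', h''⟩)
    · rw [h] at h'; cases h'
    · rw [h] at h'; cases h'; exact h''
  · exact fun h' => .step p v b h h'

theorem strandEnds_iff_inl {c : Fin D} {p : Slot W n} {b b' : B} (h : τ p = Sum.inl b) :
    StrandEnds a τ c p b' ↔ b' = b := by
  constructor
  · rintro (⟨_, _, h'⟩ | ⟨_, v', _, h', h''⟩)
    · rw [h] at h'; cases h'; rfl
    · rw [h] at h'; cases h'
  · rintro rfl; exact .leave p _ h

theorem StrandEnds.unique {c : Fin D} {p : Slot W n} {b b' : B} (h : StrandEnds a τ c p b)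
    (h' : StrandEnds a τ c p b') : b = b' := by
  induction h with
  | leave p b h => exact ((strandEnds_iff_inl h).1 h').symm
  | step p v b h _ ih => exact ih ((strandEnds_iff_inr h).1 h')

theorem closing_apply_inr {c : Fin D} {p : Slot W n} {v : Fin n × Bool}
    (h : τ p = Sum.inr v) : closing g a τ c p = Sum.inr (pillow a c v) := by
  rw [closing_apply, h]; rfl

theorem closing_apply_inl {c : Fin D} {p : Slot W n} {b : B}
    (h : τ p = Sum.inl b) : closing g a τ c p = Sum.inl ((g c).symm b) := by
  rw [closing_apply, h]; rfl

/-- A closing edge leads from a black vertex to the white vertex whose strand ends at that same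
black vertex. Thus the end of a strand is a function on cycles. -/
theorem strandEnds_closing_iff {c : Fin D} (h : ∀ w, StrandEnds a τ c (Sum.inl w) (g c w))
    (p : Slot W n) (b : B) :
    StrandEnds a τ c (closing g a τ c p) b ↔ StrandEnds a τ c p b := by
  rcases hp : τ p with b' | v
  · rw [closing_apply_inl hp, strandEnds_iff_inl hp]
    have := h ((g c).symm b')
    rw [Equiv.apply_symm_apply] at this
    exact ⟨fun h' => h'.unique this, fun h' => h' ▸ this⟩
  · rw [closing_apply_inr hp, strandEnds_iff_inr hp]

/-- Only a closing edge leads to a white vertex, so a path that arrives at one must have left the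
Feynman graph before. The exponent `k + 1` excludes the empty path. -/
theorem exists_strandEnds_of_pow {c : Fin D} (k : ℕ) : ∀ (p : Slot W n) (w : W),
    (closing g a τ c ^ (k + 1)) p = Sum.inl w →
    ∃ b, StrandEnds a τ c p b ∧ (closing g a τ c).SameCycle p (Sum.inl ((g c).symm b)) := by
  induction k with
  | zero =>
    intro p w h
    rw [zero_add, pow_one] at h
    rcases hp : τ p with b | v
    · exact ⟨b, .leave p b hp, closing_apply_inl (g := g) (a := a) (c := c) hp ▸
        sameCycle_self_apply _ _⟩
    · rw [closing_apply_inr hp] at h; cases h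
  | succ k ih =>
    intro p w h
    rcases hp : τ p with b | v
    · exact ⟨b, .leave p b hp, closing_apply_inl (g := g) (a := a) (c := c) hp ▸
        sameCycle_self_apply _ _⟩
    · rw [pow_succ, Equiv.Perm.mul_apply] at h
      obtain ⟨b, hb, hb'⟩ := ih _ _ h
      refine ⟨b, ?_, (sameCycle_self_apply _ _).trans hb'⟩
      rw [closing_apply_inr hp] at hb
      exact .step p v b hp hb

/-- The strand from `w` leaves at some `b`, and its cycle then passes through `(g c).symm b`. If
cycles contain only one white vertex, this is `w`, and `b = g c w`. Conversely, white vertices on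
one cycle have strands with the same end. -/
theorem forall_strandEnds_iff [Finite W] {c : Fin D} :
    (∀ w, StrandEnds a τ c (Sum.inl w) (g c w)) ↔ Separates Sum.inl (closing g a τ c) := by
  constructor
  · intro h w w' hw
    have := (sameCycle_iff_of_invariant (f := fun p => StrandEnds a τ c p (g c w))
      (fun p => strandEnds_closing_iff h p (g c w)) hw).1 (h w)
    exact (g c).injective (this.unique (h w'))
  · intro h w
    have h0 : 0 < orderOf (closing g a τ c) := orderOf_pos _
    have hk : (closing g a τ c ^ (orderOf (closing g a τ c) - 1 + 1)) (Sum.inl w) = Sum.inl w := by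
      rw [Nat.sub_add_cancel h0, pow_orderOf_eq_one]; rfl
    obtain ⟨b, hb, hb'⟩ := exists_strandEnds_of_pow _ _ _ hk
    rwa [(congrArg (g c) (h _ _ hb')).trans (Equiv.apply_symm_apply _ _)]

/-- After its first exit the cycle is back at `w`, because `w` is the only white vertex on it. So
the open strand already runs through the whole cycle. -/
theorem onStrand_iff [Finite W] {c : Fin D} (hsep : Separates Sum.inl (closing g a τ c)) {w : W}
    {p : Slot W n} : OnStrand a τ c w p ↔ (closing g a τ c).SameCycle (Sum.inl w) p := by
  have hends := forall_strandEnds_iff.2 hsep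
  have h1 : ∀ p, OnStrand a τ c w p → (closing g a τ c).SameCycle (Sum.inl w) p := by
    intro p hp
    induction hp with
    | start => exact .refl _ _
    | step p v _ h' ih =>
      rw [← closing_apply_inr (g := g) h']
      exact ih.trans (sameCycle_self_apply _ _)
  refine ⟨h1 p, fun h => ?_⟩
  obtain ⟨k, rfl⟩ := h.exists_nat_pow_eq
  clear h
  induction k with
  | zero => exact .start
  | succ k ih =>
    rw [pow_succ', Equiv.Perm.mul_apply]
    set q := (closing g a τ c ^ k) (Sum.inl w)
    rcases hq : τ q with b | v
    · rw [closing_apply_inl hq]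
      have h2 := sameCycle_self_apply (closing g a τ c) q
      rw [closing_apply_inl hq] at h2
      rw [← hsep _ _ ((h1 _ ih).trans h2)]
      exact .start
    · rw [closing_apply_inr hq]
      exact .step q v ih hq

/-- The vertex of the Feynman graph from which the propagator `p` starts. -/
abbrev slotSource (p : Slot W n) : (W ⊕ B) ⊕ Fin n :=
  Sum.elim (fun w => Sum.inl (Sum.inl w)) (fun f => Sum.inr f.1) p

/-- The vertex of the Feynman graph at which a propagator ends. -/
abbrev slotTarget (q : Slot B n) : (W ⊕ B) ⊕ Fin n :=
  Sum.elim (fun b => Sum.inl (Sum.inr b)) (fun f => Sum.inr f.1) q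

theorem feynmanGraph_reachable (p : Slot W n) :
    (feynmanGraph τ).Reachable (slotSource p) (slotTarget (τ p)) := by
  by_cases h : (slotSource p : (W ⊕ B) ⊕ Fin n) = slotTarget (τ p)
  · rw [h]
  · refine SimpleGraph.Adj.reachable ?_
    rw [feynmanGraph, SimpleGraph.fromRel_adj]
    exact ⟨h, .inl ⟨p, rfl, rfl⟩⟩

theorem StrandEnds.reachable {c : Fin D} {p : Slot W n} {b : B} (h : StrandEnds a τ c p b) :
    (feynmanGraph τ).Reachable (slotSource p) (Sum.inl (Sum.inr b)) := by
  induction h with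
  | leave p b h => have := feynmanGraph_reachable (τ := τ) p; rwa [h] at this
  | step p v b h _ ih =>
    have := feynmanGraph_reachable (τ := τ) p
    rw [h] at this
    exact this.trans ih

/-- Components of the Feynman graph and orbits of propagators determine each other. The closing
edges are no edges of the Feynman graph, but they join the two ends of one strand and hence never
link different components. -/
theorem feynmanGraph_connected_iff [Finite W] (hD : 2 ≤ D) (x : W)
    (hsep : ∀ c, Separates Sum.inl (closing g a τ c)) :
    (feynmanGraph τ).Connected ↔ Linked (closing g a τ) (Sum.inl x) (Sum.inl x) := by
  have c0 : Fin D := ⟨0, by omega⟩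
  rw [linked_self_iff]
  constructor
  · rintro ⟨hpre, _⟩ U hU ⟨q, hq⟩ p
    -- The vertices that belong to the invariant set `U`: a black vertex is represented by the
    -- propagator that ends there, a pillow by either of its fields.
    let N : (W ⊕ B) ⊕ Fin n → Prop := Sum.elim
      (Sum.elim (fun w => Sum.inl w ∈ U) fun b => τ.symm (Sum.inl b) ∈ U)
      fun i => Sum.inr (i, false) ∈ U
    have hsrc : ∀ p : Slot W n, N (slotSource p) ↔ p ∈ U := by
      rintro (w | ⟨i, e⟩)
      · rfl
      · exact hU.pillow_mem_iff hD i false e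
    have htgt : ∀ p : Slot W n, N (slotTarget (τ p)) ↔ p ∈ U := by
      intro p
      rcases hp : τ p with b | v
      · change τ.symm (Sum.inl b) ∈ U ↔ _
        rw [← hp, Equiv.symm_apply_apply]
      · exact (hU.mem_of_inr_iff hD hp false).symm
    have hadj : ∀ u v, (feynmanGraph τ).Adj u v → (N u ↔ N v) := by
      intro u v h
      rw [feynmanGraph, SimpleGraph.fromRel_adj] at h
      rcases h.2 with ⟨p, rfl, rfl⟩ | ⟨p, rfl, rfl⟩
      · exact (hsrc p).trans (htgt p).symm
      · exact (htgt p).trans (hsrc p).symm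
    have hreach : ∀ u v, (feynmanGraph τ).Reachable u v → (N u ↔ N v) := by
      rintro u v ⟨w⟩
      induction w with
      | nil => rfl
      | cons h _ ih => exact (hadj _ _ h).trans ih
    exact (hsrc p).1 ((hreach _ _ (hpre _ _)).1 ((hsrc q).2 hq))
  · intro h
    rw [SimpleGraph.connected_iff_exists_forall_reachable]
    refine ⟨Sum.inl (Sum.inl x), ?_⟩
    -- At a black vertex `b` the closing edge is replaced by the strand from `(g c).symm b` to `b`,
    -- which is a path of the Feynman graph.
    have hU : Invariant (closing g a τ)
        {p | (feynmanGraph τ).Reachable (Sum.inl (Sum.inl x)) (slotSource p)} := by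
      intro c p
      have key : (feynmanGraph τ).Reachable (slotSource p) (slotSource (closing g a τ c p)) := by
        rcases hp : τ p with b | v
        · rw [closing_apply_inl hp]
          have h1 := (forall_strandEnds_iff.2 (hsep c) ((g c).symm b)).reachable
          rw [Equiv.apply_symm_apply] at h1
          have h2 := feynmanGraph_reachable (τ := τ) p
          rw [hp] at h2
          exact h2.trans h1.symm
        · rw [closing_apply_inr hp]
          have h2 := feynmanGraph_reachable (τ := τ) p
          rw [hp] at h2
          exact h2
      exact ⟨fun h => h.trans key.symm, fun h => h.trans key⟩
    have hall := h _ hU ⟨Sum.inl x, .refl _⟩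
    rintro ((w | b) | i)
    · exact hall (Sum.inl w)
    · have h1 := hall (τ.symm (Sum.inl b))
      have h2 := feynmanGraph_reachable (τ := τ) (τ.symm (Sum.inl b))
      rw [Equiv.apply_symm_apply] at h2
      exact SimpleGraph.Reachable.trans h1 h2
    · exact hall (Sum.inr (i, false))

theorem mem_contractions_iff [Fintype W] [Fintype B] (hD : 2 ≤ D) (x : W) :
    τ ∈ contractions g a ↔ (∀ c, Separates Sum.inl (closing g a τ c)) ∧
      Linked (closing g a τ) (Sum.inl x) (Sum.inl x) := by
  classical
  have hx : Nonempty W := ⟨x⟩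
  simp only [contractions, Finset.mem_filter, Finset.mem_univ, true_and, hx]
  simp only [forall_strandEnds_iff]
  rw [and_comm]
  exact and_congr_right fun h => feynmanGraph_connected_iff hD x h

/-- The closing edges impose no new condition: conservation along a strand already gives its last
propagator the component with which it entered. -/
theorem mem_routings_iff [Fintype W] [Fintype M] (X : W → Fin D → M)
    (hsep : ∀ c, Separates Sum.inl (closing g a τ c)) (m : Slot W n → Fin D → M) :
    m ∈ routings a τ X ↔ IsRouting Sum.inl X (closing g a τ) m := by
  classical
  simp only [routings, Finset.mem_filter, Finset.mem_univ, true_and]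
  constructor
  · rintro ⟨h1, h2⟩
    refine ⟨h1, fun c p => ?_⟩
    rcases hp : τ p with b | v
    · have h3 := forall_strandEnds_iff.2 (hsep c) ((g c).symm b)
      rw [Equiv.apply_symm_apply] at h3
      have key : ∀ q b, StrandEnds a τ c q b → m q c = m (τ.symm (Sum.inl b)) c := by
        intro q b hq
        induction hq with
        | leave p b h => rw [← h, Equiv.symm_apply_apply]
        | step p v b h _ ih => rw [← ih, h2 p v c h]
      rw [closing_apply_inl hp, key _ _ h3, ← hp, Equiv.symm_apply_apply]
    · rw [closing_apply_inr hp, h2 p v c hp]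
  · rintro ⟨h1, h2⟩
    refine ⟨h1, fun p v c hp => ?_⟩
    rw [← h2 c p, closing_apply_inr hp]

theorem amplitude_eq [Fintype W] [Fintype M] (E : (Fin D → M) → ℝ) (X : W → Fin D → M)
    (hsep : ∀ c, Separates Sum.inl (closing g a τ c)) :
    amplitude E a τ X 0 = weight E Sum.inl X (closing g a τ) := by
  classical
  unfold amplitude weight
  rw [← Finset.sum_filter]
  refine Finset.sum_congr ?_ fun m _ => ?_
  · ext m
    rw [mem_routings_iff X hsep]
    simp
  · simp

/-- With equal base points `Linked` is plain transitivity, so any white vertex may serve as `x`. -/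
theorem coeff_corr [Fintype W] [Fintype B] [Fintype M] (hD : 2 ≤ D) (E : (Fin D → M) → ℝ)
    (g : ColouredGraph D W B) (X : W → Fin D → M) (x : W) :
    corr E g X = linkedCorr E g x x X := by
  classical
  ext n
  simp only [corr, corrShift, linkedCorr, PowerSeries.coeff_mk]
  congr 1
  unfold wickSum
  refine Finset.sum_congr (by ext; simp) fun a _ => ?_
  rw [← Finset.sum_filter]
  refine Finset.sum_congr ?_ fun τ hτ => ?_
  · ext τ
    rw [mem_contractions_iff hD x]
    simp
  · rw [Finset.mem_filter] at hτ
    exact amplitude_eq E X hτ.2.1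

/-! ### Derivative with respect to the energy carried by an external strand. -/

open Classical in
/-- Minus the derivative of `weight` with respect to the energy of the propagators in the cycle of
the marked point `w` in colour `c`. -/
noncomputable def strandWeight {P : Type*} [Fintype P] [Fintype M] (E : (Fin D → M) → ℝ)
    (j : W → P) (X : W → Fin D → M) (w : W) (c : Fin D) (σ : Fin D → Perm P) : ℝ :=
  ∑ p, if (σ c).SameCycle (j w) p then
    ∑ m : P → Fin D → M, if IsRouting j X σ m then (E (m p))⁻¹ * ∏ q, (E (m q))⁻¹ else 0
  else 0

theorem hasDerivAt_prod_shift {P : Type*} [Fintype P] (e : P → ℝ) (he : ∀ p, 0 < e p)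
    (S : P → Prop) [DecidablePred S] :
    HasDerivAt (fun t : ℝ => ∏ p, (e p + if S p then t else 0)⁻¹)
      (-∑ p, if S p then (e p)⁻¹ * ∏ q, (e q)⁻¹ else 0) 0 := by
  classical
  have h : ∀ p ∈ Finset.univ, HasDerivAt (fun t : ℝ => (e p + if S p then t else 0)⁻¹)
      (if S p then -((e p)⁻¹ * (e p)⁻¹) else 0) 0 := by
    intro p _
    by_cases hp : S p
    · simp only [hp, if_true]
      have := ((hasDerivAt_id (0 : ℝ)).const_add (e p)).inv (by simpa using (he p).ne')
      simp only [id, add_zero] at this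
      refine this.congr_deriv ?_
      rw [neg_div, one_div, sq, mul_inv]
    · simp only [hp, if_false]
      exact hasDerivAt_const _ _
  have h2 := HasDerivAt.fun_finsetProd h
  refine h2.congr_deriv ?_
  rw [← Finset.sum_neg_distrib]
  refine Finset.sum_congr rfl fun p _ => ?_
  by_cases hp : S p
  · simp only [hp, if_true, smul_eq_mul]
    rw [← Finset.mul_prod_erase _ _ (Finset.mem_univ p)]
    have : ∏ q ∈ Finset.univ.erase p, (e q + if S q then (0 : ℝ) else 0)⁻¹ =
      ∏ q ∈ Finset.univ.erase p, (e q)⁻¹ := by simp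
    rw [this]
    ring
  · simp [hp]

theorem hasDerivAt_amplitude [Fintype W] [Fintype M] (E : (Fin D → M) → ℝ) (hE : ∀ x, 0 < E x)
    (X : W → Fin D → M) [DecidableEq W] (w : W) (c : Fin D)
    (hsep : ∀ c, Separates Sum.inl (closing g a τ c)) :
    HasDerivAt (fun t : ℝ => amplitude E a τ X (Pi.single w (Pi.single c t)))
      (-strandWeight E Sum.inl X w c (closing g a τ)) 0 := by
  classical
  have h1 : ∀ (t : ℝ) (p : Slot W n),
      (∑ v, ∑ d, if OnStrand a τ d v p then (Pi.single w (Pi.single c t) : W → Fin D → ℝ) v d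
        else 0) = if (closing g a τ c).SameCycle (Sum.inl w) p then t else 0 := by
    intro t p
    rw [Finset.sum_eq_single w, Finset.sum_eq_single c]
    · simp only [Pi.single_eq_same]
      exact if_congr (onStrand_iff (hsep c)) rfl rfl
    · intro d _ hd; simp [Pi.single_eq_of_ne hd]
    · simp
    · intro v _ hv
      refine Finset.sum_eq_zero fun d _ => ?_
      simp [Pi.single_eq_of_ne hv]
    · simp
  unfold amplitude strandWeight
  simp only [h1]
  have h2 := HasDerivAt.fun_sum (u := routings a τ X) (x := (0 : ℝ))
    (A := fun m (t : ℝ) => ∏ p, (E (m p) +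
      if (closing g a τ c).SameCycle (Sum.inl w) p then t else 0)⁻¹)
    (fun m _ => hasDerivAt_prod_shift (fun p => E (m p)) (fun p => hE _)
      (fun p => (closing g a τ c).SameCycle (Sum.inl w) p))
  refine h2.congr_deriv ?_
  rw [Finset.sum_neg_distrib, Finset.sum_comm]
  congr 1
  refine Finset.sum_congr rfl fun p _ => ?_
  split_ifs with hp
  · rw [← Finset.sum_filter]
    refine Finset.sum_congr ?_ fun m _ => rfl
    ext m
    rw [mem_routings_iff X hsep]
    simp
  · simp

theorem deriv_coeff_corrShift [Fintype W] [Fintype B] [Fintype M] [DecidableEq W] (hD : 2 ≤ D)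
    (E : (Fin D → M) → ℝ) (hE : ∀ x, 0 < E x) (g : ColouredGraph D W B) (X : W → Fin D → M)
    (w : W) (c : Fin D) (x : W) (n : ℕ) :
    deriv (fun t : ℝ => PowerSeries.coeff n
      (corrShift E g X (Pi.single w (Pi.single c t)))) 0 =
    (-1 : ℝ) ^ n / (n ! : ℝ) * -wickSum (Fin n) g x x (strandWeight E Sum.inl X w c) := by
  classical
  simp only [corrShift, PowerSeries.coeff_mk]
  refine HasDerivAt.deriv (HasDerivAt.const_mul _ ?_)
  have := HasDerivAt.fun_sum (u := (Finset.univ : Finset (Fin n → Fin D))) (x := (0 : ℝ))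
    (A := fun a (t : ℝ) => ∑ τ ∈ contractions g a, amplitude E a τ X (Pi.single w (Pi.single c t)))
    (fun a _ => HasDerivAt.fun_sum fun τ hτ => hasDerivAt_amplitude E hE X w c
      ((mem_contractions_iff hD x).1 hτ).1)
  refine this.congr_deriv ?_
  unfold wickSum
  rw [← Finset.sum_neg_distrib]
  refine Finset.sum_congr (by ext; simp) fun a _ => ?_
  rw [← Finset.sum_filter, Finset.sum_neg_distrib]
  congr 1
  refine Finset.sum_congr ?_ fun τ _ => rfl
  ext τ
  rw [mem_contractions_iff hD x]
  simp

end Strands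

/-! ### Removal of the propagator that ends at a black vertex -/

theorem optionCongr_removeNone {α α' : Type*} (e : Option α ≃ Option α') (h : e none = none) :
    Equiv.optionCongr (Equiv.removeNone e) = e := by
  ext1 o
  rcases o with _ | o
  · rw [h]; rfl
  · have h1 : e (some o) ≠ none := fun h' => by
      have := e.injective (h'.trans h.symm); cases this
    obtain ⟨y, hy⟩ := Option.ne_none_iff_exists'.1 h1
    rw [Equiv.optionCongr_apply, Option.map_some]
    exact Equiv.removeNone_some e ⟨y, hy⟩

/-- A bijection with one prescribed value is a bijection of what is left. This removes one
propagator from a Wick contraction. -/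
theorem sum_equiv_apply_eq {α α' A A' R : Type*} {_ : Fintype (A ≃ A')} {_ : Fintype (α ≃ α')}
    [AddCommMonoid R] [DecidableEq A'] (eA : Option α ≃ A) (eA' : Option α' ≃ A')
    (F : (A ≃ A') → R) :
    (∑ τ : A ≃ A', if τ (eA none) = eA' none then F τ else 0) =
      ∑ τ : α ≃ α', F (eA.symm.trans ((Equiv.optionCongr τ).trans eA')) := by
  rw [← Finset.sum_filter]
  symm
  refine Finset.sum_bij (fun τ _ => eA.symm.trans ((Equiv.optionCongr τ).trans eA')) ?_ ?_ ?_ ?_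
  · intro τ _
    simp
  · intro τ _ τ' _ h
    refine Equiv.optionCongr_injective (Equiv.ext fun o => ?_)
    have := congrArg (fun f => eA'.symm (f (eA o))) h
    simpa only [Equiv.trans_apply, Equiv.symm_apply_apply] using this
  · intro τ hτ
    rw [Finset.mem_filter] at hτ
    refine ⟨Equiv.removeNone (eA.trans (τ.trans eA'.symm)), Finset.mem_univ _, ?_⟩
    rw [optionCongr_removeNone]
    · ext; simp
    · simp [hτ.2]
  · intro τ _
    rfl

section Peel

variable {D : ℕ} {W B I M : Type*}

/-- The propagators of a graph from which one propagator has been removed: `none` is the other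
field `φ̄` of the pillow from which that propagator started. -/
def openClosing (g : ColouredGraph D W B) (a : I → Fin D)
    (τ : Option (W ⊕ (I × Bool)) ≃ Option (B ⊕ (I × Bool))) (d : Fin D) :
    Perm (Option (W ⊕ (I × Bool))) :=
  τ.trans (Equiv.optionCongr (fieldEquiv g a d))

/-- The strands of a graph in which the propagator between a pillow of colour `c` and the black
vertex `β` is contracted. -/
noncomputable def peeledClosing (g : ColouredGraph D W B) (a : I → Fin D) (c : Fin D) (β : B)
    (τ : Option (W ⊕ (I × Bool)) ≃ Option (B ⊕ (I × Bool))) :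
    Fin D → Perm (Option (W ⊕ (I × Bool))) :=
  Function.update (openClosing g a τ) c
    (mulSwap none (some (Sum.inl ((g c).symm β))) (openClosing g a τ c))

/-- The marked points of `openClosing`. -/
abbrev someInl (w : W) : Option (W ⊕ (I × Bool)) := some (Sum.inl w)

open Classical in
/-- The contribution to the correlation function of the graphs in which the external vertex `β` is
joined to a pillow of colour `c`. -/
noncomputable def peeledSum [Fintype W] [Fintype B] (I : Type*) [Fintype I]
    (g : ColouredGraph D W B) (c : Fin D) (β : B)
    (ω : (Fin D → Perm (Option (W ⊕ (I × Bool)))) → ℝ) : ℝ :=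
  ∑ a : I → Fin D, ∑ τ : Option (W ⊕ (I × Bool)) ≃ Option (B ⊕ (I × Bool)),
    if (∀ d, Separates someInl (peeledClosing g a c β τ d)) ∧
      Linked (openClosing g a τ) none (someInl ((g c).symm β)) then
    ω (peeledClosing g a c β τ) else 0

theorem openClosing_symm (g : ColouredGraph D W B) (a : I → Fin D) (β : B)
    (τ : Option (W ⊕ (I × Bool)) ≃ Option (B ⊕ (I × Bool))) (d : Fin D) :
    openClosing g a τ d (τ.symm (some (Sum.inl β))) = someInl ((g d).symm β) := by
  simp [openClosing, fieldEquiv_inl]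

theorem peeledClosing_self (g : ColouredGraph D W B) (a : I → Fin D) (c : Fin D) (β : B)
    (τ : Option (W ⊕ (I × Bool)) ≃ Option (B ⊕ (I × Bool))) :
    peeledClosing g a c β τ c =
      mulSwap none (some (Sum.inl ((g c).symm β))) (openClosing g a τ c) := by
  simp [peeledClosing]

theorem peeledClosing_of_ne (g : ColouredGraph D W B) (a : I → Fin D) {c d : Fin D} (h : d ≠ c)
    (β : B) (τ : Option (W ⊕ (I × Bool)) ≃ Option (B ⊕ (I × Bool))) :
    peeledClosing g a c β τ d = openClosing g a τ d := by
  simp [peeledClosing, h]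

/-- The propagator that ended at `β` puts all the white vertices `(g d).symm β` into its orbit. The
field contracted with `β` is followed by `none` in colour `c` and by `(g d).symm β` in a second
colour `d`, so `none` belongs to this orbit too. Once `none` and `(g c).symm β` are identified, the
crossing in colour `c` has no effect. -/
theorem linked_insertBefore_peeledClosing (hD : 2 ≤ D) (g : ColouredGraph D W B) (a : I → Fin D)
    (c : Fin D) (β : B) (τ : Option (W ⊕ (I × Bool)) ≃ Option (B ⊕ (I × Bool)))
    (x : Option (Option (W ⊕ (I × Bool)))) :
    Linked (fun d => insertBefore (someInl ((g d).symm β)) (peeledClosing g a c β τ d)) x x ↔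
      Linked (openClosing g a τ) none (someInl ((g c).symm β)) := by
  classical
  rw [linked_self_iff]
  have hinv : ∀ U : Set (Option (Option (W ⊕ (I × Bool)))),
      Invariant (fun d => insertBefore (someInl ((g d).symm β)) (peeledClosing g a c β τ d)) U ↔
      ∀ d, (none ∈ U ↔ some (someInl ((g d).symm β)) ∈ U) ∧
        ∀ p, some (peeledClosing g a c β τ d p) ∈ U ↔ some p ∈ U := by
    intro U
    refine forall_congr' fun d => ?_
    have := forall_insertBefore (x := someInl ((g d).symm β)) (σ := peeledClosing g a c β τ d)
      (fun o => o ∈ U)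
    simpa only [eq_iff_iff] using this
  have hq : ∀ d, openClosing g a τ d (τ.symm (some (Sum.inl β))) = someInl ((g d).symm β) :=
    openClosing_symm g a β τ
  constructor
  · intro H V hV hlink hne p
    have hall : ∀ d, someInl ((g d).symm β) ∈ V ↔ someInl ((g c).symm β) ∈ V := by
      intro d
      rw [← hq d, ← hq c, hV, hV]
    -- The removed propagator is put into the set together with `(g c).symm β`.
    have := H {o | o.elim (someInl ((g c).symm β) ∈ V) (· ∈ V)} ?_ ?_ (some p)
    · exact this
    · rw [hinv]
      refine fun d => ⟨(hall d).symm, ?_⟩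
      by_cases hd : d = c
      · subst hd
        rw [peeledClosing_self]
        exact (forall_mulSwap_iff hlink).2 (hV d)
      · rw [peeledClosing_of_ne g a hd]
        exact hV d
    · exact ⟨some hne.some, hne.some_mem⟩
  · intro H U hU hne
    rw [hinv] at hU
    obtain ⟨d, hd⟩ := exists_ne_colour hD c
    -- The chain runs from `none` to the field contracted with `β`, then in a second colour `d` to
    -- `(g d).symm β`, to the removed propagator, and to `(g c).symm β`.
    have h1 : none ∈ {p | some p ∈ U} ↔ someInl ((g c).symm β) ∈ {p | some p ∈ U} := by
      have e1 := (hU c).2 (τ.symm (some (Sum.inl β)))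
      rw [peeledClosing_self, mulSwap_eq, Equiv.Perm.mul_apply, hq,
        Equiv.swap_apply_right] at e1
      have e2 := (hU d).2 (τ.symm (some (Sum.inl β)))
      rw [peeledClosing_of_ne g a hd, hq] at e2
      exact e1.trans (e2.symm.trans ((hU d).1.symm.trans (hU c).1))
    have h2 : Invariant (openClosing g a τ) {p | some p ∈ U} := by
      intro d'
      by_cases hd' : d' = c
      · subst hd'
        have := (hU d').2
        rw [peeledClosing_self] at this
        exact (forall_mulSwap_iff h1).1 this
      · have := (hU d').2
        rwa [peeledClosing_of_ne g a hd'] at this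
    have h3 := H _ h2 h1 ?_
    · rintro (_ | p)
      · exact (hU c).1.2 (h3 _)
      · exact h3 p
    · obtain ⟨_ | p, hp⟩ := hne
      · exact ⟨_, (hU c).1.1 hp⟩
      · exact ⟨p, hp⟩

/-- The fields of a graph with `m + 1` pillows: `none` and `some none` are those of the pillow
`i`. -/
def fieldsSucc (V : Type*) {m : ℕ} (i : Fin (m + 1)) (e : Bool) :
    Option (Option (V ⊕ (Fin m × Bool))) → V ⊕ (Fin (m + 1) × Bool)
  | none => Sum.inr (i, e)
  | some none => Sum.inr (i, !e)
  | some (some (Sum.inl v)) => Sum.inl v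
  | some (some (Sum.inr k)) => Sum.inr (i.succAbove k.1, k.2)

theorem fieldsSucc_bijective (V : Type*) {m : ℕ} (i : Fin (m + 1)) (e : Bool) :
    Function.Bijective (fieldsSucc V i e) := by
  constructor
  · rintro (_ | _ | v | ⟨k, b⟩) (_ | _ | v' | ⟨k', b'⟩) h <;>
      simp_all [fieldsSucc, Fin.succAbove_ne, Fin.ne_succAbove]
  · rintro (v | ⟨k, b⟩)
    · exact ⟨some (some (Sum.inl v)), rfl⟩
    · rcases Fin.eq_self_or_eq_succAbove i k with rfl | ⟨k, rfl⟩
      · by_cases h : b = e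
        · subst h; exact ⟨none, rfl⟩
        · refine ⟨some none, ?_⟩
          have : b = !e := by cases b <;> cases e <;> simp_all
          rw [this]; rfl
      · exact ⟨some (some (Sum.inr (k, b))), rfl⟩

/-- `fieldsSucc` as an equivalence. -/
noncomputable def fieldsSuccEquiv (V : Type*) {m : ℕ} (i : Fin (m + 1)) (e : Bool) :
    Option (Option (V ⊕ (Fin m × Bool))) ≃ V ⊕ (Fin (m + 1) × Bool) :=
  Equiv.ofBijective _ (fieldsSucc_bijective V i e)

open Classical in
/-- The fields `φ` and the black vertices, `none` being the black vertex `β`. -/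
noncomputable def blackFieldsSuccEquiv {m : ℕ} (β : B) (i : Fin (m + 1)) (e : Bool) :
    Option (Option (B ⊕ (Fin m × Bool))) ≃ B ⊕ (Fin (m + 1) × Bool) :=
  -- After the removal, the field `φ` labelled `(i, e)` takes over the name `β`: in all colours but
  -- that of the pillow its strands run through the removed propagator to `β`.
  (fieldsSuccEquiv B i e).trans (swap (Sum.inl β) (Sum.inr (i, e)))

/-- In the colours `d ≠ c` the removed pillow contracts parallel fields, so `(i, e)` acts as `β` and
`(i, !e)` runs straight through. In colour `c` it contracts opposite fields and the two strands
cross; this is the transposition in `peeledClosing`. In each colour the propagator that ended at `β`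
is inserted in front of `(g d).symm β`. -/
theorem closing_fieldsSuccEquiv {m : ℕ} (g : ColouredGraph D W B) (a : Fin m → Fin D) (c : Fin D)
    (β : B) (i : Fin (m + 1)) (e : Bool)
    (τ : Option (W ⊕ (Fin m × Bool)) ≃ Option (B ⊕ (Fin m × Bool))) (d : Fin D)
    (p : Option (Option (W ⊕ (Fin m × Bool)))) :
    closing g (i.insertNth c a : Fin (m + 1) → Fin D) ((fieldsSuccEquiv W i e).symm.trans
      ((Equiv.optionCongr τ).trans (blackFieldsSuccEquiv β i e))) d (fieldsSuccEquiv W i e p) =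
    fieldsSuccEquiv W i e
      (insertBefore (someInl ((g d).symm β)) (peeledClosing g a c β τ d) p) := by
  classical
  rw [closing_apply]
  simp only [Equiv.trans_apply, Equiv.symm_apply_apply, blackFieldsSuccEquiv]
  have hS : ∀ q, peeledClosing g a c β τ d q = if d = c then
      swap none (someInl ((g c).symm β)) (openClosing g a τ c q) else openClosing g a τ d q := by
    intro q
    split_ifs with h
    · subst h; rw [peeledClosing_self, mulSwap_eq]; rfl
    · rw [peeledClosing_of_ne g a h]
  rcases p with _ | q
  · rw [insertBefore_none]
    change fieldEquiv g _ d (swap (Sum.inl β) (Sum.inr (i, e)) (Sum.inr (i, e))) =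
      Sum.inl ((g d).symm β)
    rw [Equiv.swap_apply_right]; rfl
  · rw [Equiv.optionCongr_apply, Option.map_some]
    have hS' := hS q
    simp only [openClosing, Equiv.trans_apply, Equiv.optionCongr_apply] at hS'
    -- The propagator ends at the other open field of the removed pillow, at a black vertex (where
    -- `β` stands for the field `(i, e)`), or at one of the remaining pillows.
    rcases hq : τ q with _ | b | ⟨k, v⟩
    · rw [hq] at hS'
      change fieldEquiv g _ d (swap (Sum.inl β) (Sum.inr (i, e)) (Sum.inr (i, !e))) = _
      rw [Equiv.swap_apply_of_ne_of_ne (by simp) (by simp), fieldEquiv_inr, pillowEquiv_apply]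
      by_cases h : d = c
      · subst h
        rw [if_pos rfl, Option.map_none, Equiv.swap_apply_left] at hS'
        rw [insertBefore_of_eq hS']
        simp [fieldsSuccEquiv, fieldsSucc]
      · rw [if_neg h, Option.map_none] at hS'
        rw [insertBefore_of_ne (by rw [hS']; simp), hS']
        simp [fieldsSuccEquiv, fieldsSucc, Ne.symm h]
    · rw [hq, Option.map_some, fieldEquiv_inl, Option.map_some, fieldEquiv_inl] at hS'
      change fieldEquiv g _ d (swap (Sum.inl β) (Sum.inr (i, e)) (Sum.inl b)) = _
      by_cases hb : b = β
      · subst hb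
        rw [Equiv.swap_apply_left, fieldEquiv_inr, pillowEquiv_apply]
        by_cases h : d = c
        · subst h
          rw [if_pos rfl, Equiv.swap_apply_right] at hS'
          rw [insertBefore_of_ne (by rw [hS']; simp), hS']
          simp [fieldsSuccEquiv, fieldsSucc]
        · rw [if_neg h] at hS'
          rw [insertBefore_of_eq hS']
          simp [fieldsSuccEquiv, fieldsSucc, Ne.symm h]
      · rw [Equiv.swap_apply_of_ne_of_ne (by simpa using hb) (by simp), fieldEquiv_inl]
        have hS'' : peeledClosing g a c β τ d q = someInl ((g d).symm b) := by
          rw [hS']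
          split_ifs with h
          · subst h
            exact Equiv.swap_apply_of_ne_of_ne (by simp) (by simpa using hb)
          · rfl
        rw [insertBefore_of_ne (by rw [hS'']; simpa using hb), hS'']
        rfl
    · rw [hq, Option.map_some, fieldEquiv_inr, Option.map_some, fieldEquiv_inr] at hS'
      change fieldEquiv g _ d (swap (Sum.inl β) (Sum.inr (i, e))
        (Sum.inr (i.succAbove k, v))) = _
      rw [Equiv.swap_apply_of_ne_of_ne (by simp) (by simp [Fin.succAbove_ne]), fieldEquiv_inr,
        pillowEquiv_apply]
      have hS'' : peeledClosing g a c β τ d q = some (Sum.inr (pillowEquiv a d (k, v))) := by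
        rw [hS']
        split_ifs with h
        · subst h
          exact Equiv.swap_apply_of_ne_of_ne (by simp) (by simp)
        · rfl
      rw [insertBefore_of_ne (by rw [hS'']; simp), hS'']
      simp [fieldsSuccEquiv, fieldsSucc, pillowEquiv_apply]

/-- A propagator from `w` directly to `β` is a fixed point in every colour, since the closing edge
leads back to a white vertex of the same cycle. Transitivity would make `w` the only white vertex
and `g` connected. This is the only place where disconnectedness of the boundary graph enters. -/
theorem not_linked_of_apply_eq_inl (hD : 2 ≤ D) {g : ColouredGraph D W B}
    (hg : ¬ IsConnected g) {a : I → Fin D} {τ : W ⊕ (I × Bool) ≃ B ⊕ (I × Bool)} {w : W} {β : B}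
    (h : τ (Sum.inl w) = Sum.inl β) (hsep : ∀ c, Separates Sum.inl (closing g a τ c))
    (x : W ⊕ (I × Bool)) : ¬ Linked (closing g a τ) x x := by
  intro hl
  rw [linked_self_iff] at hl
  have hw : ∀ c, closing g a τ c (Sum.inl w) = Sum.inl w := by
    intro c
    have h1 : closing g a τ c (Sum.inl w) = Sum.inl ((g c).symm β) := by
      rw [closing_apply, h, fieldEquiv_inl]
    have h2 := sameCycle_self_apply (closing g a τ c) (Sum.inl w)
    rw [h1] at h2
    rw [h1, ← hsep c _ _ h2]
  have hall := hl {Sum.inl w} (fun c p => by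
    simp only [Set.mem_singleton_iff]
    constructor
    · intro h'; exact (closing g a τ c).injective (h'.trans (hw c).symm)
    · rintro rfl; exact hw c) ⟨_, rfl⟩
  have hW : ∀ v : W, v = w := fun v => Sum.inl_injective (hall (Sum.inl v))
  have c0 : Fin D := ⟨0, by omega⟩
  apply hg
  rw [IsConnected, SimpleGraph.connected_iff_exists_forall_reachable]
  refine ⟨Sum.inl w, ?_⟩
  rintro (v | b)
  · rw [hW v]
  · have := adj_edge g c0 ((g c0).symm b)
    rw [hW ((g c0).symm b)] at this
    rw [show b = g c0 w by rw [← hW ((g c0).symm b), Equiv.apply_symm_apply]]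
    exact (adj_edge g c0 w).reachable

/-- Every propagator that ends at `β` starts at a pillow, which may be removed. -/
theorem wickSum_succ [Fintype W] [Fintype B] [Fintype M] (hD : 2 ≤ D) (E : (Fin D → M) → ℝ)
    {g : ColouredGraph D W B} (hg : ¬ IsConnected g) (X : W → Fin D → M) (β : B) (x : W) (m : ℕ) :
    wickSum (Fin (m + 1)) g x x (weight E Sum.inl X) =
      2 * (m + 1) * (E fun c => X ((g c).symm β) c)⁻¹ *
        ∑ c, peeledSum (Fin m) g c β (weight E someInl X) := by
  classical
  set F : (Fin (m + 1) → Fin D) → (W ⊕ (Fin (m + 1) × Bool) ≃ B ⊕ (Fin (m + 1) × Bool)) → ℝ :=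
    fun a τ => if (∀ c, Separates Sum.inl (closing g a τ c)) ∧
      Linked (closing g a τ) (Sum.inl x) (Sum.inl x) then
      weight E Sum.inl X (closing g a τ) else 0 with hF
  -- The contractions are sorted by the field from which the propagator to `β` starts.
  have step1 : ∀ a, ∑ τ, F a τ = ∑ ie : Fin (m + 1) × Bool,
      ∑ τ, if τ (Sum.inr ie) = Sum.inl β then F a τ else 0 := by
    intro a
    rw [Finset.sum_comm]
    refine Finset.sum_congr rfl fun τ _ => ?_
    rcases hτ : τ.symm (Sum.inl β) with w | ie
    · have h : τ (Sum.inl w) = Sum.inl β := by rw [← hτ, Equiv.apply_symm_apply]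
      have h0 : F a τ = 0 := by
        rw [hF]
        exact if_neg fun h' => not_linked_of_apply_eq_inl hD hg h h'.1 _ h'.2
      simp [h0]
    · rw [Finset.sum_eq_single ie, if_pos]
      · rw [← hτ, Equiv.apply_symm_apply]
      · intro ie' _ hne
        rw [if_neg]
        intro h'
        apply hne
        rw [← Equiv.eq_symm_apply, hτ] at h'
        exact Sum.inr_injective h'
      · simp
  have step2 : ∀ (i : Fin (m + 1)) (e : Bool) (c : Fin D) (a : Fin m → Fin D),
      (∑ τ, if τ (Sum.inr (i, e)) = Sum.inl β then F (i.insertNth c a) τ else 0) =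
      (E fun c => X ((g c).symm β) c)⁻¹ *
        ∑ τ : Option (W ⊕ (Fin m × Bool)) ≃ Option (B ⊕ (Fin m × Bool)),
        if (∀ d, Separates someInl (peeledClosing g a c β τ d)) ∧
          Linked (openClosing g a τ) none (someInl ((g c).symm β)) then
        weight E someInl X (peeledClosing g a c β τ) else 0 := by
    intro i e c a
    have h0 : fieldsSuccEquiv W i e none = Sum.inr (i, e) := rfl
    have h1 : blackFieldsSuccEquiv β i e none = Sum.inl β := by
      simp [blackFieldsSuccEquiv, fieldsSuccEquiv, fieldsSucc]
    rw [← h0, ← h1, sum_equiv_apply_eq, Finset.mul_sum]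
    refine Finset.sum_congr rfl fun τ _ => ?_
    have hcl := closing_fieldsSuccEquiv g a c β i e τ
    set τ' := (fieldsSuccEquiv W i e).symm.trans
      ((Equiv.optionCongr τ).trans (blackFieldsSuccEquiv β i e))
    have e1 : ∀ d, Separates Sum.inl (closing g (i.insertNth c a : Fin (m + 1) → Fin D) τ' d) ↔
        Separates someInl (peeledClosing g a c β τ d) := by
      intro d
      rw [separates_congr (j := fun w => some (someInl w)) (fieldsSuccEquiv W i e)
        (Equiv.refl W) (fun w => rfl) (hcl d), separates_insertBefore]
    have e2 : Linked (closing g (i.insertNth c a : Fin (m + 1) → Fin D) τ')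
        (Sum.inl x) (Sum.inl x) ↔
        Linked (openClosing g a τ) none (someInl ((g c).symm β)) := by
      rw [← linked_insertBefore_peeledClosing hD g a c β τ (some (someInl x))]
      exact linked_congr (x := some (someInl x)) (y := some (someInl x)) (fieldsSuccEquiv W i e) hcl
    have e3 : weight E Sum.inl X (closing g (i.insertNth c a : Fin (m + 1) → Fin D) τ') =
        (E fun c => X ((g c).symm β) c)⁻¹ * weight E someInl X (peeledClosing g a c β τ) := by
      rw [weight_congr (X := X) (j := fun w => some (someInl w)) (fieldsSuccEquiv W i e)
        (Equiv.refl W) (fun w => rfl) (fun w => rfl) hcl,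
        weight_insertBefore (j := someInl) (fun d => (g d).symm β)]
    simp only [hF, e1, e2, e3, mul_ite, mul_zero]
  have step0 : wickSum (Fin (m + 1)) g x x (weight E Sum.inl X) = ∑ a, ∑ τ, F a τ :=
    Finset.sum_congr (by ext; simp) fun a _ =>
      Finset.sum_congr (by ext; simp) fun τ _ => if_congr Iff.rfl rfl rfl
  rw [step0]
  simp only [step1]
  rw [Finset.sum_comm, Fintype.sum_prod_type]
  have step3 : ∀ (i : Fin (m + 1)) (e : Bool),
      (∑ a, ∑ τ, if τ (Sum.inr (i, e)) = Sum.inl β then F a τ else 0) =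
      (E fun c => X ((g c).symm β) c)⁻¹ * ∑ c, peeledSum (Fin m) g c β (weight E someInl X) := by
    intro i e
    -- The colour `c` of the removed pillow is split off from the colours of the others and becomes
    -- the summation variable of the equation.
    rw [← (Fin.insertNthEquiv (fun _ => Fin D) i).sum_comp, Fintype.sum_prod_type, Finset.mul_sum]
    refine Finset.sum_congr rfl fun c _ => ?_
    unfold peeledSum
    rw [Finset.mul_sum]
    refine Finset.sum_congr (by ext; simp) fun a _ => ?_
    refine (step2 i e c a).trans (congrArg (fun r => (E fun c => X ((g c).symm β) c)⁻¹ * r) ?_)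
    exact Finset.sum_congr (by ext; simp) fun τ _ => if_congr Iff.rfl rfl rfl
  simp only [step3]
  -- The `m + 1` pillows and the two fields `φ̄` of each contribute equally.
  simp only [Finset.sum_const, Finset.card_univ, Fintype.card_fin, Fintype.card_bool, nsmul_eq_mul]
  push_cast
  ring

end Peel

/-! ### The Ward identity -/

section Ward

variable {D : ℕ} {P W M : Type*}

open Function (minimalPeriod)

/-- The points of the cycle of `x` from the `i`-th one on, counted from `x`. -/
def cycleTail (σ : Perm P) (x : P) (i : ℕ) : Set P :=
  {p | ∃ k, i ≤ k ∧ k < minimalPeriod σ x ∧ σ^[k] x = p}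

theorem minimalPeriod_perm_pos [Finite P] (σ : Perm P) (x : P) : 0 < minimalPeriod σ x :=
  Function.IsPeriodicPt.minimalPeriod_pos (orderOf_pos σ) (by
    rw [Function.IsPeriodicPt, Function.IsFixedPt, ← Equiv.Perm.coe_pow, pow_orderOf_eq_one]; rfl)

theorem sameCycle_iterate (σ : Perm P) (x : P) (k : ℕ) : σ.SameCycle x (σ^[k] x) := by
  rw [← Equiv.Perm.coe_pow]; exact Equiv.Perm.sameCycle_pow_right.2 (.refl _ _)

theorem sameCycle_iff_exists_iterate [Finite P] {σ : Perm P} {x p : P} :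
    σ.SameCycle x p ↔ ∃ k < minimalPeriod σ x, σ^[k] x = p := by
  constructor
  · intro h
    obtain ⟨n, rfl⟩ := h.exists_nat_pow_eq
    refine ⟨n % minimalPeriod σ x, Nat.mod_lt _ (minimalPeriod_perm_pos σ x), ?_⟩
    rw [Function.iterate_mod_minimalPeriod_eq, Equiv.Perm.coe_pow]
  · rintro ⟨k, _, rfl⟩
    exact sameCycle_iterate σ x k

theorem cycleTail_zero [Finite P] (σ : Perm P) (x : P) :
    cycleTail σ x 0 = {p | σ.SameCycle x p} := by
  ext p
  rw [Set.mem_ofPred_eq, sameCycle_iff_exists_iterate]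
  simp [cycleTail]

theorem cycleTail_minimalPeriod (σ : Perm P) (x : P) :
    cycleTail σ x (minimalPeriod σ x) = ∅ := by
  ext p
  simp only [cycleTail, Set.mem_ofPred_eq, Set.mem_empty_iff_false, iff_false]
  rintro ⟨k, h, h', _⟩
  omega

theorem iterate_inj {σ : Perm P} {x : P} {i k : ℕ} (hi : i < minimalPeriod σ x)
    (hk : k < minimalPeriod σ x) (h : σ^[i] x = σ^[k] x) : i = k :=
  (Function.iterate_eq_iterate_iff_of_lt_minimalPeriod hi hk).1 h

theorem iterate_notMem_cycleTail {σ : Perm P} {x : P} {i : ℕ} (hi : i < minimalPeriod σ x) :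
    σ^[i] x ∉ cycleTail σ x (i + 1) := by
  rintro ⟨k, h, h', e⟩
  have := iterate_inj h' hi e
  omega

theorem self_notMem_cycleTail {σ : Perm P} {x : P} {i : ℕ} :
    x ∉ cycleTail σ x (i + 1) := by
  rintro ⟨k, h, h', e⟩
  have := iterate_inj h' (by omega : 0 < _) e
  omega

theorem mem_cycleTail_iff {σ : Perm P} {x : P} {i : ℕ} (hi : i < minimalPeriod σ x) {p : P} :
    p ∈ cycleTail σ x i ↔ p ∈ cycleTail σ x (i + 1) ∨ p = σ^[i] x := by
  constructor
  · rintro ⟨k, h, h', rfl⟩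
    rcases h.eq_or_lt with rfl | h
    · exact .inr rfl
    · exact .inl ⟨k, h, h', rfl⟩
  · rintro (⟨k, h, h', rfl⟩ | rfl)
    · exact ⟨k, by omega, h', rfl⟩
    · exact ⟨i, le_rfl, hi, rfl⟩

/-- One step of `σ` shifts the tail by one; the exception is the last point, whose image is `x` and
not a point of the tail. -/
theorem apply_mem_cycleTail_iff {σ : Perm P} {x : P} {i : ℕ} {p : P} :
    σ p ∈ cycleTail σ x (i + 1) ↔ p ∈ cycleTail σ x i ∧ σ p ≠ x := by
  constructor
  · rintro ⟨k, h, h', e⟩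
    obtain ⟨k, rfl⟩ : ∃ l, k = l + 1 := ⟨k - 1, by omega⟩
    refine ⟨⟨k, by omega, by omega, ?_⟩, fun hx => ?_⟩
    · rw [Function.iterate_succ_apply'] at e
      exact σ.injective e
    · rw [hx] at e
      have := iterate_inj h' (by omega : 0 < _) e
      omega
  · rintro ⟨⟨k, h, h', rfl⟩, hx⟩
    refine ⟨k + 1, by omega, ?_, Function.iterate_succ_apply' _ _ _⟩
    by_contra hk
    apply hx
    rw [← Function.iterate_succ_apply' σ, show k.succ = minimalPeriod σ x by omega,
      Function.iterate_minimalPeriod]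

theorem mem_cycleTail_of_apply_eq {σ : Perm P} {x : P} {i : ℕ} (hi : i < minimalPeriod σ x)
    {p : P} (hp : σ p = x) : p ∈ cycleTail σ x i := by
  refine ⟨minimalPeriod σ x - 1, by omega, by omega, σ.injective ?_⟩
  rw [← Function.iterate_succ_apply' σ, show (minimalPeriod σ x - 1).succ = minimalPeriod σ x by
    omega, Function.iterate_minimalPeriod, hp]

theorem sum_sameCycle_eq_sum_range [Fintype P] {R : Type*} [AddCommMonoid R] (σ : Perm P) (x : P)
    [DecidablePred (σ.SameCycle x)] (F : P → R) :
    (∑ p, if σ.SameCycle x p then F p else 0) =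
      ∑ i ∈ Finset.range (minimalPeriod σ x), F (σ^[i] x) := by
  rw [← Finset.sum_filter]
  symm
  refine Finset.sum_bij (fun i _ => σ^[i] x) ?_ ?_ ?_ ?_
  · intro i _
    simpa using sameCycle_iterate σ x i
  · intro i hi k hk h
    exact iterate_inj (Finset.mem_range.1 hi) (Finset.mem_range.1 hk) h
  · intro p hp
    rw [Finset.mem_filter] at hp
    obtain ⟨k, hk, rfl⟩ := sameCycle_iff_exists_iterate.1 hp.2
    exact ⟨k, Finset.mem_range.2 hk, rfl⟩
  · intro i _
    rfl

open Classical in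
/-- A labelling of the points of a cycle that has been cut behind the `i`-th point. -/
theorem forall_cut_insertBefore_iff {N : Type*} {σ : Perm P} {x : P} {i : ℕ}
    (hi : i < minimalPeriod σ x) {f : P → N} {s t : N} (hs : f x = s) :
    (∀ o : Option P, (mulSwap none (some x) (insertBefore (σ (σ^[i] x)) σ) o).elim t f =
      o.elim t f) ↔
    (∀ p, (if σ p ∈ cycleTail σ x (i + 1) then s else f (σ p)) =
      if p ∈ cycleTail σ x (i + 1) then s else f p) ∧ ∀ p ∈ cycleTail σ x (i + 1), f p = t := by
  -- Inserting `none` behind `q` and exchanging the arrivals at `none` and `x` breaks the cycle into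
  -- `x, …, q` and `none, σ q, …`. The first part carries `s`, the second one `t`.
  set q := σ^[i] x with hq
  have hN0 : σ q ≠ x → mulSwap none (some x) (insertBefore (σ q) σ) none = some (σ q) := by
    intro h
    rw [mulSwap_eq, Equiv.Perm.mul_apply, insertBefore_none,
      Equiv.swap_apply_of_ne_of_ne (by simp) (by simpa using h)]
  have hN0' : σ q = x → mulSwap none (some x) (insertBefore (σ q) σ) none = none := by
    intro h
    rw [mulSwap_eq, Equiv.Perm.mul_apply, insertBefore_none, h, Equiv.swap_apply_right]
  have hNq : mulSwap none (some x) (insertBefore (σ q) σ) (some q) = some x := by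
    rw [mulSwap_eq, Equiv.Perm.mul_apply, insertBefore_of_eq rfl, Equiv.swap_apply_left]
  have hNx : ∀ p, p ≠ q → σ p = x →
      mulSwap none (some x) (insertBefore (σ q) σ) (some p) = none := by
    intro p hp hx
    rw [mulSwap_eq, Equiv.Perm.mul_apply, insertBefore_of_ne (fun h => hp (σ.injective h)), hx,
      Equiv.swap_apply_right]
  have hN : ∀ p, p ≠ q → σ p ≠ x →
      mulSwap none (some x) (insertBefore (σ q) σ) (some p) = some (σ p) := by
    intro p hp hx
    rw [mulSwap_eq, Equiv.Perm.mul_apply, insertBefore_of_ne (fun h => hp (σ.injective h)),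
      Equiv.swap_apply_of_ne_of_ne (by simp) (by simpa using hx)]
  have hxT := self_notMem_cycleTail (σ := σ) (x := x) (i := i)
  have hqT := iterate_notMem_cycleTail hi
  constructor
  · intro h
    -- The value `t` spreads from `none` through the tail, by induction on the distance from `q`.
    have hall : ∀ p ∈ cycleTail σ x (i + 1), f p = t := by
      rintro p ⟨k, hk, hk', rfl⟩
      obtain ⟨l, rfl⟩ := Nat.exists_eq_add_of_le hk
      clear hk
      induction l with
      | zero =>
        rw [add_zero, Function.iterate_succ_apply', ← hq]
        have hne : σ q ≠ x := fun h' => by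
          rw [hq, ← Function.iterate_succ_apply' σ] at h'
          have := iterate_inj (by omega) (by omega : 0 < _) h'
          omega
        have := h none
        rwa [hN0 hne] at this
      | succ l ih =>
        have ih := ih (by omega)
        set p := σ^[i + 1 + l] x with hp
        have e : σ^[i + 1 + (l + 1)] x = σ p := by
          rw [hp, ← Function.iterate_succ_apply' σ]; rfl
        rw [e]
        have h1 : p ≠ q := fun h' => by
          have := iterate_inj (by omega) (by omega) h'
          omega
        have h2 : σ p ≠ x := fun h' => by
          rw [← e] at h'
          have := iterate_inj hk' (by omega : 0 < _) h'
          omega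
        have := h (some p)
        rw [hN p h1 h2] at this
        exact this.trans ih
    refine ⟨fun p => ?_, hall⟩
    by_cases hp : p ∈ cycleTail σ x (i + 1)
    · rw [if_pos hp]
      by_cases hx : σ p = x
      · rw [hx, if_neg hxT, hs]
      · rw [if_pos]
        exact apply_mem_cycleTail_iff.2 ⟨(mem_cycleTail_iff hi).2 (.inl hp), hx⟩
    · rw [if_neg hp]
      by_cases hpq : p = q
      · subst hpq
        have h1 : f q = s := by
          have := h (some q)
          rw [hNq] at this
          exact this.symm.trans hs
        by_cases hx : σ q = x
        · rw [hx, if_neg hxT, hs, h1]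
        · rw [if_pos, h1]
          exact apply_mem_cycleTail_iff.2 ⟨(mem_cycleTail_iff hi).2 (.inr rfl), hx⟩
      · have h1 : p ∉ cycleTail σ x i := fun h => ((mem_cycleTail_iff hi).1 h).elim hp hpq
        have h2 : σ p ≠ x := fun h => h1 (mem_cycleTail_of_apply_eq hi h)
        rw [if_neg fun h => h1 (apply_mem_cycleTail_iff.1 h).1]
        have := h (some p)
        rwa [hN p hpq h2] at this
  · rintro ⟨h, hall⟩
    -- The relabelled function is constant on the whole cycle, and neither `x` nor `q` lies in the
    -- tail.
    have hqs : f q = s := by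
      have := sameCycle_eq_of_invariant
        (f := fun p => if p ∈ cycleTail σ x (i + 1) then s else f p) h (sameCycle_iterate σ x i)
      simp only [← hq] at this
      rw [if_neg hxT, if_neg hqT, hs] at this
      exact this.symm
    rintro (_ | p)
    · by_cases hx : σ q = x
      · rw [hN0' hx]
      · rw [hN0 hx]
        exact hall _ (apply_mem_cycleTail_iff.2 ⟨(mem_cycleTail_iff hi).2 (.inr rfl), hx⟩)
    · by_cases hpq : p = q
      · subst hpq
        rw [hNq]
        exact hs.trans hqs.symm
      by_cases hx : σ p = x
      · rw [hNx p hpq hx]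
        have := ((mem_cycleTail_iff hi).1 (mem_cycleTail_of_apply_eq hi hx)).resolve_right hpq
        exact (hall p this).symm
      · rw [hN p hpq hx]
        by_cases hp : p ∈ cycleTail σ x (i + 1)
        · exact (hall _ (apply_mem_cycleTail_iff.2
            ⟨(mem_cycleTail_iff hi).2 (.inl hp), hx⟩)).trans (hall p hp).symm
        · have h1 : p ∉ cycleTail σ x i := fun h => ((mem_cycleTail_iff hi).1 h).elim hp hpq
          have := h p
          rwa [if_neg hp, if_neg fun h => h1 (apply_mem_cycleTail_iff.1 h).1] at this

open Classical in
/-- The momenta `m`, with the `c`-component replaced by `t` at the points of `S`. -/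
noncomputable def setMomentum (S : Set P) (c : Fin D) (t : M) (m : P → Fin D → M) :
    P → Fin D → M :=
  fun p => if p ∈ S then Function.update (m p) c t else m p

theorem setMomentum_setMomentum {S : Set P} {c : Fin D} {s t : M} {m : P → Fin D → M}
    (h : ∀ p ∈ S, m p c = t) : setMomentum S c t (setMomentum S c s m) = m := by
  funext p
  by_cases hp : p ∈ S
  · simp only [setMomentum, if_pos hp, Function.update_idem]
    rw [← h p hp, Function.update_eq_self]
  · simp only [setMomentum, if_neg hp]

theorem setMomentum_apply_of_ne {S : Set P} {c d : Fin D} (h : d ≠ c) {t : M} {m : P → Fin D → M}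
    (p : P) : setMomentum S c t m p d = m p d := by
  unfold setMomentum
  split_ifs
  · exact Function.update_of_ne h _ _
  · rfl

open Classical in
theorem setMomentum_apply_self {S : Set P} {c : Fin D} {t : M} {m : P → Fin D → M}
    (p : P) : setMomentum S c t m p c = if p ∈ S then t else m p c := by
  unfold setMomentum
  split_ifs
  · exact Function.update_self _ _ _
  · rfl

/-- On `S` the component is forced to be `s` on one side and `t` on the other, so the two
replacements are inverse to each other. This is the change of variables to routings of the uncut
strand. -/
theorem sum_isRouting_setMomentum [Fintype P] [Fintype M] {S : Set P} {c : Fin D} {s t : M}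
    {A : (P → Fin D → M) → Prop} (hA : ∀ m, A m → ∀ p ∈ S, m p c = s)
    [DecidablePred A] {_ : DecidablePred fun m : P → Fin D → M =>
      A (setMomentum S c s m) ∧ ∀ p ∈ S, m p c = t}
    {_ : Fintype (P → Fin D → M)} (F : (P → Fin D → M) → ℝ) :
    (∑ m : P → Fin D → M, if A (setMomentum S c s m) ∧ ∀ p ∈ S, m p c = t then F m else 0) =
      ∑ m : P → Fin D → M, if A m then F (setMomentum S c t m) else 0 := by
  rw [← Finset.sum_filter, ← Finset.sum_filter]
  refine Finset.sum_bij' (fun m _ => setMomentum S c s m) (fun m _ => setMomentum S c t m)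
    ?_ ?_ ?_ ?_ ?_
  · intro m hm
    rw [Finset.mem_filter] at hm ⊢
    exact ⟨Finset.mem_univ _, hm.2.1⟩
  · intro m hm
    rw [Finset.mem_filter] at hm ⊢
    refine ⟨Finset.mem_univ _, ?_, fun p hp => ?_⟩
    · rw [setMomentum_setMomentum (hA m hm.2)]; exact hm.2
    · rw [setMomentum_apply_self, if_pos hp]
  · intro m hm
    rw [Finset.mem_filter] at hm
    exact setMomentum_setMomentum hm.2.2
  · intro m hm
    rw [Finset.mem_filter] at hm
    exact setMomentum_setMomentum (hA m hm.2)
  · intro m hm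
    rw [Finset.mem_filter] at hm
    rw [setMomentum_setMomentum hm.2.2]

open Classical in
/-- The sum over the routings for which the `c`-cycle of the marked point `w` is cut into two
at `x`, the part that contains `x` carrying the momentum `t`. -/
noncomputable def cutWeight [Fintype P] [Fintype M] (E : (Fin D → M) → ℝ) (j : W → P)
    (X : W → Fin D → M) (x : P) (w : W) (c : Fin D) (t : M) (σ : Fin D → Perm P) : ℝ :=
  ∑ m : P → Fin D → M, if IsRouting j X (Function.update σ c (mulSwap x (j w) (σ c))) m ∧
    m x c = t then ∏ p, (E (m p))⁻¹ else 0

theorem marked_notMem_cycleTail {j : W → P} {σ : Perm P} (hsep : Separates j σ) {w : W} {i : ℕ}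
    (v : W) : j v ∉ cycleTail σ (j w) (i + 1) := by
  intro h
  have h' := h
  obtain ⟨k, _, _, e⟩ := h'
  have h1 := sameCycle_iterate σ (j w) k
  rw [e] at h1
  rw [← hsep _ _ h1] at h
  exact self_notMem_cycleTail h

/-- A routing of the cut strand is a routing of the uncut one with the momentum changed from `X w c`
to `t` behind the cut. The inserted propagator repeats the momentum of the propagator before the
cut, except for its component `t`. -/
theorem isRouting_cut_iff {j : W → P} {X : W → Fin D → M} {σ : Fin D → Perm P} {w : W} {c : Fin D}
    {t : M} (hsep : Separates j (σ c)) {i : ℕ} (hi : i < minimalPeriod (σ c) (j w))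
    (z : Fin D → M) (m : P → Fin D → M) :
    (IsRouting (fun v => some (j v)) X (Function.update
      (fun d => insertBefore (σ d ((σ c)^[i] (j w))) (σ d)) c
      (mulSwap none (some (j w)) (insertBefore (σ c ((σ c)^[i] (j w))) (σ c))))
      (fun o => o.elim z m) ∧ z c = t) ↔
    z = Function.update (m ((σ c)^[i] (j w))) c t ∧
      IsRouting j X σ (setMomentum (cycleTail (σ c) (j w) (i + 1)) c (X w c) m) ∧
      ∀ p ∈ cycleTail (σ c) (j w) (i + 1), m p c = t := by
  classical
  set q := (σ c)^[i] (j w) with hq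
  have hmark : (∀ v, setMomentum (cycleTail (σ c) (j w) (i + 1)) c (X w c) m (j v) = X v) ↔
      ∀ v, m (j v) = X v := by
    refine forall_congr' fun v => ?_
    rw [setMomentum, if_neg (marked_notMem_cycleTail hsep v)]
  have hne : ∀ d, d ≠ c → ((∀ p, setMomentum (cycleTail (σ c) (j w) (i + 1)) c (X w c) m (σ d p) d =
      setMomentum (cycleTail (σ c) (j w) (i + 1)) c (X w c) m p d) ↔
      ∀ p, m (σ d p) d = m p d) := by
    intro d hd
    simp only [setMomentum_apply_of_ne hd]
  have hins : ∀ d, (∀ o : Option P, (insertBefore (σ d q) (σ d) o).elim z m d = o.elim z m d) ↔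
      z d = m (σ d q) d ∧ ∀ p, m (σ d p) d = m p d := fun d =>
    forall_insertBefore (fun o : Option P => o.elim z m d)
  constructor
  · rintro ⟨⟨h1, h2⟩, rfl⟩
    have h1' : ∀ v, m (j v) = X v := h1
    have hd : ∀ d, d ≠ c → z d = m (σ d q) d ∧ ∀ p, m (σ d p) d = m p d := by
      intro d hd
      have := h2 d
      rw [Function.update_of_ne hd] at this
      exact (hins d).1 this
    have hc := h2 c
    rw [Function.update_self] at hc
    have hc' := (forall_cut_insertBefore_iff hi (f := fun p => m p c) (s := X w c) (t := z c)
      (by rw [h1'])).1 (fun o => by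
        have := hc o
        rw [← hq]
        rcases o with _ | o <;> rcases ho : (mulSwap none (some (j w))
          (insertBefore (σ c q) (σ c))) _ with _ | o' <;> rw [ho] at this <;> exact this)
    refine ⟨?_, ⟨hmark.2 h1', fun d => ?_⟩, hc'.2⟩
    · funext d
      by_cases hdc : d = c
      · subst hdc; rw [Function.update_self]
      · rw [Function.update_of_ne hdc, (hd d hdc).1, (hd d hdc).2]
    · by_cases hdc : d = c
      · subst hdc
        intro p
        rw [setMomentum_apply_self, setMomentum_apply_self]
        exact hc'.1 p
      · exact (hne d hdc).2 (hd d hdc).2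
  · rintro ⟨rfl, ⟨h1, h2⟩, h3⟩
    have h1' := hmark.1 h1
    refine ⟨⟨h1', fun d => ?_⟩, Function.update_self _ _ _⟩
    by_cases hdc : d = c
    · subst hdc
      rw [Function.update_self]
      have := (forall_cut_insertBefore_iff hi (f := fun p => m p d) (s := X w d) (t := t)
        (by rw [h1'])).2 ⟨fun p => by
          have := h2 d p
          rwa [setMomentum_apply_self, setMomentum_apply_self] at this, h3⟩
      intro o
      have := this o
      rw [← hq] at this
      rcases o with _ | o <;> rcases ho : (mulSwap none (some (j w))
        (insertBefore (σ d q) (σ d))) _ with _ | o' <;> rw [ho] at this <;>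
        simp only [Option.elim_none, Option.elim_some, Function.update_self] at this ⊢ <;>
        exact this
    · rw [Function.update_of_ne hdc]
      have h4 := (hne d hdc).1 (h2 d)
      refine (hins d).2 ⟨?_, h4⟩
      rw [Function.update_of_ne hdc, h4]

theorem IsRouting.eq_of_mem_cycleTail {j : W → P} {X : W → Fin D → M} {σ : Fin D → Perm P} {w : W}
    {c : Fin D} {m : P → Fin D → M} (h : IsRouting j X σ m) {i : ℕ} :
    ∀ p ∈ cycleTail (σ c) (j w) i, m p c = X w c := by
  rintro p ⟨k, _, _, rfl⟩
  rw [← h.apply_eq_of_sameCycle (sameCycle_iterate (σ c) (j w) k), h.1]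

open Classical in
-- The summation now runs over the routings of the uncut strand, the same for every position `i` of
-- the cut, so the contributions of all positions can be compared term by term.
theorem cutWeight_insertBefore [Fintype P] [Fintype M] {E : (Fin D → M) → ℝ} {j : W → P}
    {X : W → Fin D → M} {σ : Fin D → Perm P} {w : W} {c : Fin D}
    {t : M} (hsep : Separates j (σ c)) {i : ℕ} (hi : i < minimalPeriod (σ c) (j w)) :
    cutWeight E (fun v => some (j v)) X none w c t
      (fun d => insertBefore (σ d ((σ c)^[i] (j w))) (σ d)) =
    ∑ m : P → Fin D → M, if IsRouting j X σ m then
      (E (Function.update (m ((σ c)^[i] (j w))) c t))⁻¹ *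
        ∏ p, (E (setMomentum (cycleTail (σ c) (j w) (i + 1)) c t m p))⁻¹ else 0 := by
  unfold cutWeight
  rw [sum_option_pi, Finset.sum_comm]
  have h := isRouting_cut_iff (M := M) (X := X) (t := t) hsep hi
  simp only [Option.elim_none]
  set q := (σ c)^[i] (j w) with hq
  set S := cycleTail (σ c) (j w) (i + 1) with hS
  have h1 : ∀ m : P → Fin D → M, (∑ z : Fin D → M,
      if IsRouting (fun v => some (j v)) X (Function.update
        (fun d => insertBefore (σ d q) (σ d)) c
        (mulSwap none (some (j w)) (insertBefore (σ c q) (σ c)))) (fun o => o.elim z m) ∧ z c = t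
      then ∏ o : Option P, (E (o.elim z m))⁻¹ else 0) =
      if IsRouting j X σ (setMomentum S c (X w c) m) ∧ ∀ p ∈ S, m p c = t then
        (E (Function.update (m q) c t))⁻¹ * ∏ p, (E (m p))⁻¹ else 0 := by
    intro m
    simp only [h]
    rw [Finset.sum_eq_single (Function.update (m q) c t)]
    · simp [Fintype.prod_option, mul_comm]
    · intro z _ hz
      exact if_neg fun h => hz h.1
    · simp
  refine (Finset.sum_congr rfl fun m _ => h1 m).trans ?_
  rw [sum_isRouting_setMomentum (A := IsRouting j X σ)
    (fun m hm => hm.eq_of_mem_cycleTail)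
    (fun m => (E (Function.update (m q) c t))⁻¹ * ∏ p, (E (m p))⁻¹)]
  refine Finset.sum_congr rfl fun m _ => ?_
  have : setMomentum S c t m q = m q := if_neg (iterate_notMem_cycleTail hi)
  rw [this]

open Classical in
-- Changing the entering momentum changes it along the whole cycle. In this form it is the lower end
-- `i = 0` of the telescoping sum.
theorem weight_update_eq [Fintype P] [Fintype M] {E : (Fin D → M) → ℝ} {j : W → P}
    {X : W → Fin D → M} {σ : Fin D → Perm P} {w : W} {c : Fin D}
    {t : M} (hsep : Separates j (σ c)) :
    weight E j (Function.update X w (Function.update (X w) c t)) σ =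
    ∑ m : P → Fin D → M, if IsRouting j X σ m then
        ∏ p, (E (setMomentum (cycleTail (σ c) (j w) 0) c t m p))⁻¹ else 0 := by
  unfold weight
  set S := cycleTail (σ c) (j w) 0 with hS
  have hS' : ∀ p, p ∈ S ↔ (σ c).SameCycle (j w) p := by
    intro p
    have : Finite P := inferInstance
    rw [hS, cycleTail_zero]; rfl
  have hjS : ∀ v, j v ∈ S ↔ v = w := by
    intro v
    rw [hS']
    exact ⟨fun h => (hsep _ _ h).symm, fun h => h ▸ .refl _ _⟩
  have key : ∀ m : P → Fin D → M,
      IsRouting j (Function.update X w (Function.update (X w) c t)) σ m ↔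
      IsRouting j X σ (setMomentum S c (X w c) m) ∧ ∀ p ∈ S, m p c = t := by
    intro m
    have hinv : (∀ p ∈ S, m p c = t) → ∀ d, ((∀ p, setMomentum S c (X w c) m (σ d p) d =
        setMomentum S c (X w c) m p d) ↔ ∀ p, m (σ d p) d = m p d) := by
      intro h3 d
      by_cases hd : d = c
      · subst hd
        simp only [setMomentum_apply_self]
        have hσ : ∀ p, σ d p ∈ S ↔ p ∈ S := fun p => by
          rw [hS', hS', Equiv.Perm.sameCycle_apply_right]
        refine forall_congr' fun p => ?_
        by_cases hp : p ∈ S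
        · rw [if_pos ((hσ p).2 hp), if_pos hp, h3 p hp, h3 _ ((hσ p).2 hp)]
          simp
        · rw [if_neg (mt (hσ p).1 hp), if_neg hp]
      · simp only [setMomentum_apply_of_ne hd]
    have hmark : (∀ p ∈ S, m p c = t) → ((∀ v, setMomentum S c (X w c) m (j v) = X v) ↔
        ∀ v, m (j v) = Function.update X w (Function.update (X w) c t) v) := by
      intro h3
      refine forall_congr' fun v => ?_
      by_cases hv : v = w
      · subst hv
        rw [Function.update_self, setMomentum, if_pos ((hjS v).2 rfl)]
        have h4 := h3 (j v) ((hjS v).2 rfl)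
        constructor
        · intro h
          rw [← h, Function.update_idem, ← h4, Function.update_eq_self]
        · intro h
          rw [h, Function.update_idem, Function.update_eq_self]
      · rw [Function.update_of_ne hv, setMomentum, if_neg (mt (hjS v).1 hv)]
    constructor
    · intro h
      have h3 : ∀ p ∈ S, m p c = t := by
        intro p hp
        rw [← h.apply_eq_of_sameCycle ((hS' p).1 hp), h.1 w, Function.update_self,
          Function.update_self]
      exact ⟨⟨(hmark h3).2 h.1, fun d => (hinv h3 d).2 (h.2 d)⟩, h3⟩
    · rintro ⟨h, h3⟩
      exact ⟨(hmark h3).1 h.1, fun d => (hinv h3 d).1 (h.2 d)⟩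
  simp only [key]
  exact sum_isRouting_setMomentum (A := IsRouting j X σ)
    (fun m hm => hm.eq_of_mem_cycleTail) (fun m => ∏ p, (E (m p))⁻¹)

open Classical in
/-- The Ward identity: the sum over all ways of cutting an external strand into a part of momentum
`s = X w c` and a part of momentum `t`. -/
theorem sum_cutWeight_of_ne [Fintype P] [Fintype M] {E : (Fin D → M) → ℝ} (hE : ∀ x, 0 < E x)
    (hkin : ∀ (c : Fin D) (t s : M) (p p' : Fin D → M),
      kineticDiff E p c t s = kineticDiff E p' c t s)
    (hinj : ∀ (c : Fin D) (t s : M) (p : Fin D → M), t ≠ s → kineticDiff E p c t s ≠ 0)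
    {j : W → P} {X : W → Fin D → M} {σ : Fin D → Perm P} {w : W}
    {c : Fin D} {t : M} (hsep : Separates j (σ c)) (ht : t ≠ X w c) (y : Fin D → M) :
    (∑ p, if (σ c).SameCycle (j w) p then cutWeight E (fun v => some (j v)) X none w c t
      (fun d => insertBefore (σ d p) (σ d)) else 0) =
    1 / kineticDiff E y c t (X w c) * (weight E j X σ -
      weight E j (Function.update X w (Function.update (X w) c t)) σ) := by
  rw [sum_sameCycle_eq_sum_range]
  rw [Finset.sum_congr rfl fun i hi =>
    cutWeight_insertBefore (E := E) (X := X) (t := t) hsep (Finset.mem_range.1 hi)]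
  rw [Finset.sum_comm, weight_update_eq hsep]
  unfold weight
  rw [← Finset.sum_sub_distrib, Finset.mul_sum]
  refine Finset.sum_congr rfl fun m _ => ?_
  by_cases hm : IsRouting j X σ m
  swap
  · simp [hm]
  simp only [if_pos hm]
  -- In `A i` the propagators from position `i` on carry `t`: `A 0` has `t` everywhere, and `A` at
  -- the length of the cycle has `s` everywhere.
  set A : ℕ → ℝ := fun i => ∏ p, (E (setMomentum (cycleTail (σ c) (j w) i) c t m p))⁻¹ with hA
  have hAn : A (minimalPeriod (σ c) (j w)) = ∏ p, (E (m p))⁻¹ := by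
    simp only [hA, cycleTail_minimalPeriod]
    refine Finset.prod_congr rfl fun p _ => ?_
    simp [setMomentum]
  -- The propagator at position `i` appears twice, with `s` and with `t`. Partial fractions write
  -- `1/(E_t E_s)` as a difference, whose terms are completed by the other propagators to `A (i +
  -- 1)` and `A i`.
  have hstep : ∀ i ∈ Finset.range (minimalPeriod (σ c) (j w)),
      (E (Function.update (m ((σ c)^[i] (j w))) c t))⁻¹ * A (i + 1) =
      1 / kineticDiff E y c t (X w c) * (A (i + 1) - A i) := by
    intro i hi
    have hi := Finset.mem_range.1 hi
    set q := (σ c)^[i] (j w) with hq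
    have hk := hinj c t (X w c) y ht
    have hrest : ∏ p ∈ Finset.univ.erase q,
        (E (setMomentum (cycleTail (σ c) (j w) (i + 1)) c t m p))⁻¹ =
        ∏ p ∈ Finset.univ.erase q, (E (setMomentum (cycleTail (σ c) (j w) i) c t m p))⁻¹ := by
      refine Finset.prod_congr rfl fun p hp => ?_
      have hp := Finset.ne_of_mem_erase hp
      have : p ∈ cycleTail (σ c) (j w) i ↔ p ∈ cycleTail (σ c) (j w) (i + 1) := by
        rw [mem_cycleTail_iff hi, ← hq]; tauto
      simp only [setMomentum, this]
    have h1 : A (i + 1) = (E (m q))⁻¹ * ∏ p ∈ Finset.univ.erase q,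
        (E (setMomentum (cycleTail (σ c) (j w) i) c t m p))⁻¹ := by
      rw [hA]
      simp only
      rw [← Finset.mul_prod_erase _ _ (Finset.mem_univ q), hrest]
      congr 3
      exact if_neg (iterate_notMem_cycleTail hi)
    have h2 : A i = (E (Function.update (m q) c t))⁻¹ * ∏ p ∈ Finset.univ.erase q,
        (E (setMomentum (cycleTail (σ c) (j w) i) c t m p))⁻¹ := by
      rw [hA]
      simp only
      rw [← Finset.mul_prod_erase _ _ (Finset.mem_univ q)]
      congr 3
      exact if_pos ((mem_cycleTail_iff hi).2 (.inr rfl))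
    -- By `hkin` the denominator is the same at every propagator of the strand, which is what allows
    -- the sum to telescope.
    have h3 : kineticDiff E y c t (X w c) = E (Function.update (m q) c t) - E (m q) := by
      rw [hkin c t (X w c) y (m q), kineticDiff]
      have h4 : m q c = X w c :=
        hm.eq_of_mem_cycleTail q ((mem_cycleTail_iff hi).2 (.inr rfl))
      rw [← h4, Function.update_eq_self]
    rw [h1, h2]
    rw [h3] at hk ⊢
    have h5 := (hE (m q)).ne'
    have h6 := (hE (Function.update (m q) c t)).ne'
    field_simp
  rw [Finset.sum_congr rfl hstep, ← Finset.mul_sum, Finset.sum_range_sub, hAn]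

open Classical in
-- For `t = s` the cut changes no momentum and only doubles one propagator. Since `1/E²` is minus
-- the derivative of `1/E`, the sum over the cuts is minus the derivative with respect to the energy
-- of the strand.
theorem sum_cutWeight_self [Fintype P] [Fintype M] {E : (Fin D → M) → ℝ}
    {j : W → P} {X : W → Fin D → M} {σ : Fin D → Perm P} {w : W}
    {c : Fin D} (hsep : Separates j (σ c)) :
    (∑ p, if (σ c).SameCycle (j w) p then cutWeight E (fun v => some (j v)) X none w c (X w c)
      (fun d => insertBefore (σ d p) (σ d)) else 0) = strandWeight E j X w c σ := by
  unfold strandWeight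
  rw [sum_sameCycle_eq_sum_range, sum_sameCycle_eq_sum_range]
  refine Finset.sum_congr rfl fun i hi => ?_
  rw [cutWeight_insertBefore (E := E) (X := X) hsep (Finset.mem_range.1 hi)]
  refine Finset.sum_congr rfl fun m _ => ?_
  by_cases hm : IsRouting j X σ m
  swap
  · simp [hm]
  simp only [if_pos hm]
  have h0 : ∀ (S : Set P), (∀ p ∈ S, m p c = X w c) → setMomentum S c (X w c) m = m := by
    intro S hS
    funext p
    unfold setMomentum
    split_ifs with hp
    · rw [← hS p hp, Function.update_eq_self]
    · rfl
  rw [h0 _ hm.eq_of_mem_cycleTail]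
  have h4 := hm.eq_of_mem_cycleTail _ ((mem_cycleTail_iff (Finset.mem_range.1 hi)).2 (.inr rfl))
  rw [← h4, Function.update_eq_self]

end Ward

/-! ### Decomposition of the peeled sum -/

section Decomposition

variable {D : ℕ} {P W B I M : Type*}

/-- The open field `φ` is contracted either with the open field `φ̄` or with another propagator `p`.
In the second case the open pair interrupts the propagator `p` of an ordinary contraction. -/
theorem sum_option_equiv {α α' R : Type*} {i₁ : Fintype (Option α ≃ Option α')}
    [i₂ : Fintype (α ≃ α')] [Fintype α] [DecidableEq α] [AddCommMonoid R]
    (F : (Option α ≃ Option α') → R) :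
    ∑ τ, F τ = ∑ τ : α ≃ α', (F (Equiv.optionCongr τ) +
      ∑ p, F ((swap none (some p)).trans (Equiv.optionCongr τ))) := by
  classical
  have h1 : ∑ τ, F τ = ∑ o : Option α, ∑ τ : Option α ≃ Option α',
      if τ o = none then F τ else 0 := by
    rw [Finset.sum_comm]
    refine Finset.sum_congr rfl fun τ _ => ?_
    rw [Finset.sum_eq_single (τ.symm none)]
    · simp
    · intro o _ ho
      rw [if_neg]
      exact fun h => ho (by rw [← h, Equiv.symm_apply_apply])
    · simp
  have h2 : ∀ o : Option α, (∑ τ : Option α ≃ Option α', if τ o = none then F τ else 0) =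
      ∑ τ : α ≃ α', F ((swap none o).trans (Equiv.optionCongr τ)) := by
    intro o
    have := @sum_equiv_apply_eq _ _ _ _ _ i₁ i₂ _ _ (swap none o) (Equiv.refl (Option α')) F
    simp only [Equiv.swap_apply_left, Equiv.refl_apply, Equiv.symm_swap, Equiv.trans_refl] at this
    refine Eq.trans ?_ this
    refine Finset.sum_congr rfl fun τ _ => ?_
    congr
  rw [h1, Finset.sum_congr rfl fun o _ => h2 o, Fintype.sum_option, Finset.sum_add_distrib,
    Finset.sum_comm]
  congr 1
  refine Finset.sum_congr rfl fun τ _ => ?_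
  rw [Equiv.swap_self]
  rfl

/-- In every colour `none` is inserted behind the same `p` and therefore belongs to the orbit of
`p`. -/
theorem linked_insertBefore {σ : Fin D → Perm P} (c : Fin D) (p : P) {x y : P} :
    Linked (fun d => insertBefore (σ d p) (σ d)) (some x) (some y) ↔ Linked σ x y := by
  have hinv : ∀ U : Set (Option P), Invariant (fun d => insertBefore (σ d p) (σ d)) U ↔
      ∀ d, (none ∈ U ↔ some (σ d p) ∈ U) ∧ ∀ q, some (σ d q) ∈ U ↔ some q ∈ U := by
    intro U
    refine forall_congr' fun d => ?_
    have := forall_insertBefore (x := σ d p) (σ := σ d) (fun o => o ∈ U)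
    simpa only [eq_iff_iff] using this
  constructor
  · intro H U hU hxy hne q
    refine H {o | o.elim (p ∈ U) (· ∈ U)} ?_ hxy ⟨some hne.some, hne.some_mem⟩ (some q)
    rw [hinv]
    exact fun d => ⟨(hU d p).symm, hU d⟩
  · intro H U hU hxy hne
    rw [hinv] at hU
    have h0 : none ∈ U ↔ some p ∈ U := (hU c).1.trans ((hU c).2 p)
    have hall := H {q | some q ∈ U} (fun d => (hU d).2) hxy (by
      obtain ⟨_ | q, hq⟩ := hne
      · exact ⟨p, h0.1 hq⟩
      · exact ⟨q, hq⟩)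
    rintro (_ | q)
    · exact h0.2 (hall p)
    · exact hall q

theorem openClosing_optionCongr (g : ColouredGraph D W B) (a : I → Fin D)
    (τ : W ⊕ (I × Bool) ≃ B ⊕ (I × Bool)) (d : Fin D) :
    openClosing g a (Equiv.optionCongr τ) d none = none := by
  simp [openClosing]

theorem openClosing_swap_trans [DecidableEq (Option (W ⊕ (I × Bool)))] (g : ColouredGraph D W B)
    (a : I → Fin D) (τ : W ⊕ (I × Bool) ≃ B ⊕ (I × Bool)) (p : W ⊕ (I × Bool)) (d : Fin D) :
    openClosing g a ((swap none (some p)).trans (Equiv.optionCongr τ)) d =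
      insertBefore (closing g a τ d p) (closing g a τ d) := by
  ext1 o
  simp only [openClosing, Equiv.trans_apply]
  rcases o with _ | q
  · rw [Equiv.swap_apply_left, insertBefore_none]; rfl
  · by_cases hq : q = p
    · subst hq
      rw [Equiv.swap_apply_right, insertBefore_of_eq rfl]; rfl
    · rw [Equiv.swap_apply_of_ne_of_ne (by simp) (by simpa using hq), insertBefore_of_ne
        (fun h => hq ((closing g a τ d).injective h))]
      rfl

open Classical in
/-- The sum over all ways of cutting the `c`-strand at the white vertex `w`. -/
noncomputable def cutStrandWeight [Fintype P] [Fintype M] (E : (Fin D → M) → ℝ) (j : W → P)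
    (X : W → Fin D → M) (w : W) (c : Fin D) (t : M) (σ : Fin D → Perm P) : ℝ :=
  ∑ p, if (σ c).SameCycle (j w) p then cutWeight E (fun v => some (j v)) X none w c t
      (fun d => insertBefore (σ d p) (σ d)) else 0

open Classical in
-- If the open fields were contracted with each other, `none` would be a fixed point and could not
-- lie on the strand of `w`. Hence they interrupt some propagator `p` on that strand, and the sum
-- over `p` is the one evaluated by the Ward identity.
theorem sum_cutWeight_openClosing [Fintype W] [Fintype B] [Fintype I] [Fintype M]
    (E : (Fin D → M) → ℝ) (h : ColouredGraph D W B) (X : W → Fin D → M) (c : Fin D) (w v : W)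
    (t : M) :
    (∑ a : I → Fin D, ∑ τ : Option (W ⊕ (I × Bool)) ≃ Option (B ⊕ (I × Bool)),
      if (∀ d, Separates someInl (openClosing h a τ d)) ∧
        (openClosing h a τ c).SameCycle none (someInl w) ∧
        Linked (openClosing h a τ) (someInl w) (someInl v) then
      cutWeight E someInl X none w c t (openClosing h a τ) else 0) =
    wickSum I h w v (cutStrandWeight E Sum.inl X w c t) := by
  unfold wickSum
  refine Finset.sum_congr (by ext; simp) fun a _ => ?_
  rw [sum_option_equiv]
  refine Finset.sum_congr (by ext; simp) fun τ _ => ?_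
  have h0 : ¬ (openClosing h a (Equiv.optionCongr τ) c).SameCycle none (someInl w) := by
    intro h'
    have := h'.eq_of_left (openClosing_optionCongr h a τ c)
    simp at this
  rw [if_neg fun h' => h0 h'.2.1, zero_add]
  have h1 : ∀ p : W ⊕ (I × Bool),
      openClosing h a ((swap none (some p)).trans (Equiv.optionCongr τ)) =
      fun d => insertBefore (closing h a τ d p) (closing h a τ d) :=
    fun p => funext fun d => openClosing_swap_trans h a τ p d
  have h2 : ∀ p : W ⊕ (I × Bool), (insertBefore (closing h a τ c p) (closing h a τ c)).SameCycle none
      (someInl w) ↔ (closing h a τ c).SameCycle (Sum.inl w) p := by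
    intro p
    have e := sameCycle_self_apply (insertBefore (closing h a τ c p) (closing h a τ c)) none
    rw [insertBefore_none] at e
    have : (insertBefore (closing h a τ c p) (closing h a τ c)).SameCycle none (someInl w) ↔
        (insertBefore (closing h a τ c p) (closing h a τ c)).SameCycle
          (some (closing h a τ c p)) (some (Sum.inl w)) :=
      ⟨fun h => e.symm.trans h, fun h => e.trans h⟩
    rw [this, sameCycle_insertBefore, Equiv.Perm.sameCycle_apply_left,
      Equiv.Perm.sameCycle_comm]
  have h3 : ∀ (p : W ⊕ (I × Bool)) d,
      Separates someInl (insertBefore (closing h a τ d p) (closing h a τ d)) ↔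
      Separates Sum.inl (closing h a τ d) := fun p d => separates_insertBefore
  have h4 : ∀ p : W ⊕ (I × Bool),
      Linked (fun d => insertBefore (closing h a τ d p) (closing h a τ d)) (someInl w) (someInl v) ↔
      Linked (closing h a τ) (Sum.inl w) (Sum.inl v) := fun p => linked_insertBefore c p
  simp only [h1, h2, h3, h4]
  unfold cutStrandWeight
  by_cases hc : (∀ d, Separates Sum.inl (closing h a τ d)) ∧
    Linked (closing h a τ) (Sum.inl w) (Sum.inl v)
  · rw [if_pos hc]
    refine Finset.sum_congr (by ext; simp) fun p _ => ?_
    by_cases hp : (closing h a τ c).SameCycle (Sum.inl w) p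
    · rw [if_pos hp, if_pos ⟨hc.1, hp, hc.2⟩]
    · rw [if_neg hp, if_neg fun h => hp h.2.1]
  · rw [if_neg hc]
    refine Finset.sum_eq_zero fun p _ => if_neg ?_
    exact fun h => hc ⟨h.1, h.2.2⟩

theorem mulSwap_mulSwap (x y : P) (σ : Perm P) : mulSwap x y (mulSwap x y σ) = σ := by
  classical
  rw [mulSwap_eq, mulSwap_eq, ← mul_assoc, Equiv.swap_mul_self, one_mul]

theorem mulSwap_self (x : P) (σ : Perm P) : mulSwap x x σ = σ := by
  classical
  rw [mulSwap_eq, Equiv.swap_self]; rfl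

/-- This relation between transpositions moves the cut at `ρ` past the crossing at `β`: it becomes a
transposition of the white vertices of `β` and `ρ`, which is an edge swap of the boundary graph. -/
theorem mulSwap_mulSwap_of_ne {x y z : P} (hxy : x ≠ y) (hxz : x ≠ z) (hyz : y ≠ z)
    (σ : Perm P) :
    mulSwap x z (mulSwap x y σ) = mulSwap x y (mulSwap y z σ) := by
  classical
  ext1 p
  simp only [mulSwap_eq, Equiv.Perm.mul_apply]
  generalize σ p = q
  simp only [Equiv.swap_apply_def]
  split_ifs <;> simp_all

theorem edgeSwap_self (g : ColouredGraph D W B) (c : Fin D) (β : B) : edgeSwap g c β β = g := by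
  classical
  unfold edgeSwap
  rw [Equiv.swap_self, Equiv.trans_refl, Function.update_eq_self]

theorem edgeSwap_of_ne (g : ColouredGraph D W B) {c d : Fin D} (h : d ≠ c) (β ρ : B) :
    edgeSwap g c β ρ d = g d := by
  simp [edgeSwap, h]

theorem edgeSwap_same [DecidableEq B] (g : ColouredGraph D W B) (c : Fin D) (β ρ : B) :
    edgeSwap g c β ρ c = (g c).trans (swap β ρ) := by
  simp only [edgeSwap, Function.update_self]
  congr!

theorem openClosing_edgeSwap_of_ne (g : ColouredGraph D W B) {c d : Fin D} (h : d ≠ c) (β ρ : B)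
    (a : I → Fin D) (τ : Option (W ⊕ (I × Bool)) ≃ Option (B ⊕ (I × Bool))) :
    openClosing (edgeSwap g c β ρ) a τ d = openClosing g a τ d := by
  simp only [openClosing, fieldEquiv, edgeSwap_of_ne g h]

theorem openClosing_edgeSwap (g : ColouredGraph D W B) (c : Fin D) (β ρ : B)
    (a : I → Fin D) (τ : Option (W ⊕ (I × Bool)) ≃ Option (B ⊕ (I × Bool))) :
    openClosing (edgeSwap g c β ρ) a τ c =
      mulSwap (someInl ((g c).symm β)) (someInl ((g c).symm ρ)) (openClosing g a τ c) := by
  classical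
  ext1 p
  rw [mulSwap_eq, Equiv.Perm.mul_apply]
  simp only [openClosing, Equiv.trans_apply]
  rcases τ p with _ | b | v
  · simp [Equiv.swap_apply_of_ne_of_ne]
  · simp only [Equiv.optionCongr_apply, Option.map_some, fieldEquiv_inl, edgeSwap_same,
      Equiv.symm_trans_apply, Equiv.symm_swap]
    by_cases hb : b = β
    · subst hb; simp
    by_cases hr : b = ρ
    · subst hr; simp
    rw [Equiv.swap_apply_of_ne_of_ne hb hr, Equiv.swap_apply_of_ne_of_ne]
    · simpa using hb
    · simpa using hr
  · simp only [Equiv.optionCongr_apply, Option.map_some, fieldEquiv_inr]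
    rw [Equiv.swap_apply_of_ne_of_ne] <;> simp

/-- The way of cutting that corresponds to a black vertex. -/
def cutMark [DecidableEq B] (g : ColouredGraph D W B) (c : Fin D) (β ρ : B) : Option W :=
  if ρ = β then none else some ((g c).symm ρ)

/-- Every cut except the one at the white vertex of `β` corresponds to a black vertex. The
exceptional one gives the `Y`-term; `ρ = β` stands for no cut, where the open field lies on an
internal face. -/
theorem sum_option_cutMark [Fintype W] [Fintype B] [DecidableEq B] {R : Type*} [AddCommMonoid R]
    (g : ColouredGraph D W B) (c : Fin D) (β : B) (F : Option W → R) :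
    ∑ o, F o = F (some ((g c).symm β)) + ∑ ρ, F (cutMark g c β ρ) := by
  rw [Fintype.sum_option, ← (g c).symm.sum_comp (fun w => F (some w)),
    ← Finset.add_sum_erase _ _ (Finset.mem_univ β),
    ← Finset.add_sum_erase _ (fun ρ => F (cutMark g c β ρ)) (Finset.mem_univ β)]
  have h1 : cutMark g c β β = none := if_pos rfl
  have h2 : ∑ ρ ∈ Finset.univ.erase β, F (cutMark g c β ρ) =
      ∑ ρ ∈ Finset.univ.erase β, F (some ((g c).symm ρ)) := by
    refine Finset.sum_congr rfl fun ρ hρ => ?_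
    rw [cutMark, if_neg (Finset.ne_of_mem_erase hρ)]
  rw [h1, h2, ← add_assoc, ← add_assoc, add_comm (F none)]

/-! ### The cuts of a fixed contraction as swaps of edges of the boundary graph. -/

section Fixed

variable (g : ColouredGraph D W B) (a : I → Fin D)
  (τ : Option (W ⊕ (I × Bool)) ≃ Option (B ⊕ (I × Bool))) (c : Fin D) (β ρ : B)

theorem none_ne_someInl (w : W) : (none : Option (W ⊕ (I × Bool))) ≠ someInl w := by simp

theorem cut_cutMark_peeledClosing [DecidableEq B] :
    cut someInl none (cutMark g c β ρ) (peeledClosing g a c β τ c) =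
      mulSwap none (someInl ((g c).symm β)) (openClosing (edgeSwap g c β ρ) a τ c) := by
  rw [peeledClosing_self, openClosing_edgeSwap]
  unfold cutMark
  split_ifs with h
  · subst h
    rw [cut_none, mulSwap_self]
  · rw [cut_some, mulSwap_mulSwap_of_ne (by simp) (by simp)
      (by simpa using Ne.symm h)]

/-- After the swap the cut is again a cut at the white vertex of `β`, so the condition says that in
a Feynman graph with the swapped boundary the open fields lie on the `c`-strand of this vertex. -/
theorem separates_cutMark_iff [Finite W] [Finite I] [DecidableEq B] :
    Separates (addMark someInl none) (cut someInl none (cutMark g c β ρ)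
      (peeledClosing g a c β τ c)) ↔
    Separates someInl (openClosing (edgeSwap g c β ρ) a τ c) ∧
      (openClosing (edgeSwap g c β ρ) a τ c).SameCycle none (someInl ((g c).symm β)) := by
  rw [cut_cutMark_peeledClosing]
  exact separates_addMark_cut_some (w := (g c).symm β) none_ne_someInl

theorem sameCycle_of_separates_cutMark [Finite W] [Finite I] [DecidableEq B] (hρ : ρ ≠ β)
    (h : Separates (addMark someInl none) (cut someInl none (cutMark g c β ρ)
      (peeledClosing g a c β τ c))) :
    (peeledClosing g a c β τ c).SameCycle none (someInl ((g c).symm ρ)) := by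
  rw [cutMark, if_neg hρ] at h
  exact ((separates_addMark_cut_some none_ne_someInl).1 h).2

/-- The two families of permutations differ by the transposition of the white vertices of `β` and
`ρ`, so they have the same invariant sets among those that do not distinguish these two. Each side
provides this condition: the right one assumes it, and the left one derives it from the strand
through `none`. -/
theorem linked_openClosing_edgeSwap [Finite W] [Finite I] [DecidableEq B]
    (h : Separates (addMark someInl none) (cut someInl none (cutMark g c β ρ)
      (peeledClosing g a c β τ c))) :
    Linked (openClosing g a τ) none (someInl ((g c).symm β)) ↔
      Linked (openClosing (edgeSwap g c β ρ) a τ) (someInl ((g c).symm β))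
        (someInl ((g c).symm ρ)) := by
  have h' := ((separates_cutMark_iff g a τ c β ρ).1 h).2
  have hinv : ∀ U : Set (Option (W ⊕ (I × Bool))),
      (someInl ((g c).symm β) ∈ U ↔ someInl ((g c).symm ρ) ∈ U) →
      (Invariant (openClosing (edgeSwap g c β ρ) a τ) U ↔ Invariant (openClosing g a τ) U) := by
    intro U hU
    refine forall_congr' fun d => ?_
    by_cases hd : d = c
    · subst hd
      rw [openClosing_edgeSwap]
      exact forall_mulSwap_iff hU
    · rw [openClosing_edgeSwap_of_ne g hd]
  -- In the peeled permutation `none` and the white vertex of `ρ` lie on one cycle; joining `none`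
  -- to the white vertex of `β` therefore joins all three.
  have hlink : ∀ U : Set (Option (W ⊕ (I × Bool))), Invariant (openClosing g a τ) U →
      (none ∈ U ↔ someInl ((g c).symm β) ∈ U) →
      (someInl ((g c).symm β) ∈ U ↔ someInl ((g c).symm ρ) ∈ U) := by
    intro U hU hn
    by_cases hρ : ρ = β
    · rw [hρ]
    · have h1 := sameCycle_of_separates_cutMark g a τ c β ρ hρ h
      have h2 : ∀ p, peeledClosing g a c β τ c p ∈ U ↔ p ∈ U := by
        rw [peeledClosing_self]
        exact (forall_mulSwap_iff hn).2 (hU c)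
      exact hn.symm.trans (sameCycle_iff_of_invariant (f := (· ∈ U)) h2 h1)
  constructor
  · intro H U hU hxy hne
    refine H U ((hinv U hxy).1 hU) ?_ hne
    exact hU.mem_iff_of_sameCycle h'
  · intro H U hU hn hne
    exact H U ((hinv U (hlink U hU hn)).2 hU) (hlink U hU hn) hne

theorem peeledClosing_eq_update [DecidableEq B] :
    (fun d => if d = c then cut someInl none (cutMark g c β ρ) (peeledClosing g a c β τ c)
      else peeledClosing g a c β τ d) =
    Function.update (openClosing (edgeSwap g c β ρ) a τ) c
      (mulSwap none (someInl ((g c).symm β)) (openClosing (edgeSwap g c β ρ) a τ c)) := by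
  funext d
  by_cases hd : d = c
  · subst hd
    rw [if_pos rfl, Function.update_self, cut_cutMark_peeledClosing]
  · rw [if_neg hd, Function.update_of_ne hd, peeledClosing_of_ne g a hd,
      openClosing_edgeSwap_of_ne g hd]

end Fixed

open Classical in
-- The `c`-component `t` at `none` is free and summed if its strand is an internal face (`ρ = β`);
-- otherwise it is the component that enters at the white vertex of `ρ`, that is `y^ρ_c`.
theorem weight_peeledClosing [Fintype W] [Fintype I] [Fintype M]
    (E : (Fin D → M) → ℝ) (X : W → Fin D → M) (g : ColouredGraph D W B) (a : I → Fin D)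
    (τ : Option (W ⊕ (I × Bool)) ≃ Option (B ⊕ (I × Bool))) (c : Fin D) (β ρ : B)
    (h : Separates (addMark someInl none) (cut someInl none (cutMark g c β ρ)
      (peeledClosing g a c β τ c))) :
    weight E someInl X (peeledClosing g a c β τ) = ∑ t : M,
      if ρ = β ∨ t = X ((g c).symm ρ) c then
        cutWeight E someInl X none ((g c).symm β) c t (openClosing (edgeSwap g c β ρ) a τ)
      else 0 := by
  have key : ∀ m : Option (W ⊕ (I × Bool)) → Fin D → M,
      IsRouting someInl X (peeledClosing g a c β τ) m ↔
      IsRouting someInl X (Function.update (openClosing (edgeSwap g c β ρ) a τ) c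
        (mulSwap none (someInl ((g c).symm β)) (openClosing (edgeSwap g c β ρ) a τ c))) m ∧
      (ρ = β ∨ m none c = X ((g c).symm ρ) c) := by
    intro m
    rw [← peeledClosing_eq_update]
    have hcol : (ρ = β ∨ m none c = X ((g c).symm ρ) c) → (∀ w, m (someInl w) = X w) →
        ((∀ p, m (cut someInl none (cutMark g c β ρ) (peeledClosing g a c β τ c) p) c = m p c) ↔
        ∀ p, m (peeledClosing g a c β τ c p) c = m p c) := by
      intro h1 h2
      unfold cut
      refine forall_mulSwap (f := fun p => m p c) ?_
      unfold cutMark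
      split_ifs with hρ
      · rfl
      · rw [addMark_some, h2]
        exact h1.resolve_left hρ
    constructor
    · intro hm
      have h1 : ρ = β ∨ m none c = X ((g c).symm ρ) c := by
        by_cases hρ : ρ = β
        · exact .inl hρ
        · right
          rw [hm.apply_eq_of_sameCycle (sameCycle_of_separates_cutMark g a τ c β ρ hρ h), hm.1]
      refine ⟨⟨hm.1, fun d => ?_⟩, h1⟩
      by_cases hd : d = c
      · subst hd
        simp only [↓reduceIte]
        exact (hcol h1 hm.1).2 (hm.2 d)
      · simp only [if_neg hd]
        exact hm.2 d
    · rintro ⟨hm, h1⟩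
      refine ⟨hm.1, fun d => ?_⟩
      have := hm.2 d
      by_cases hd : d = c
      · subst hd
        simp only [↓reduceIte] at this
        exact (hcol h1 hm.1).1 this
      · simpa only [if_neg hd] using this
  have h2 : ∀ t : M, (if ρ = β ∨ t = X ((g c).symm ρ) c then
      cutWeight E someInl X none ((g c).symm β) c t (openClosing (edgeSwap g c β ρ) a τ)
      else 0) =
      ∑ m : Option (W ⊕ (I × Bool)) → Fin D → M,
        if m none c = t then (if IsRouting someInl X (peeledClosing g a c β τ) m then
          ∏ p, (E (m p))⁻¹ else 0) else 0 := by
    intro t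
    by_cases ht : ρ = β ∨ t = X ((g c).symm ρ) c
    · rw [if_pos ht]
      unfold cutWeight
      refine Finset.sum_congr (by ext; simp) fun m _ => ?_
      rw [← ite_and]
      refine if_congr ?_ rfl rfl
      rw [key, and_comm]
      refine and_congr_right ?_
      rintro rfl
      exact ⟨fun h => ⟨h, ht⟩, fun h => h.1⟩
    · rw [if_neg ht, Finset.sum_eq_zero]
      intro m _
      split_ifs with h3 h4
      · exact absurd (h3 ▸ ((key m).1 h4).2) ht
      · rfl
      · rfl
  rw [Finset.sum_congr rfl fun t _ => h2 t, Finset.sum_comm]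
  unfold weight
  refine Finset.sum_congr (by ext; simp) fun m _ => ?_
  simp

end Decomposition

/-! ### The two parts of the peeled sum -/

section Parts

variable {D : ℕ} {W B I M : Type*}

/-- `Option` commutes with the sum with a fixed type. -/
def optionSum (V F : Type*) : Option (V ⊕ F) ≃ Option V ⊕ F where
  toFun
    | none => Sum.inl none
    | some (Sum.inl v) => Sum.inl (some v)
    | some (Sum.inr f) => Sum.inr f
  invFun
    | Sum.inl none => none
    | Sum.inl (some v) => some (Sum.inl v)
    | Sum.inr f => some (Sum.inr f)
  left_inv := by rintro (_ | _ | _) <;> rfl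
  right_inv := by rintro ((_ | _) | _) <;> rfl

theorem insertEdge_of_none {g : ColouredGraph D W B} {ι : Fin D → Option W} {d : Fin D}
    (h : ι d = none) : insertEdge g ι d = Equiv.optionCongr (g d) := by
  simp [insertEdge, h]

theorem insertEdge_of_some [DecidableEq B] {g : ColouredGraph D W B} {ι : Fin D → Option W}
    {d : Fin D} {w : W} (h : ι d = some w) :
    insertEdge g ι d = (Equiv.optionCongr (g d)).trans (swap none (some (g d w))) := by
  simp only [insertEdge, h]
  congr!

/-- The open fields are regarded as a new white and a new black vertex. To isolate them in colour
`d` by a cut at `ι d` is to insert them into the `d`-edge at `ι d`; without a cut they are joined to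
each other. -/
theorem closing_insertEdge (g : ColouredGraph D W B) (ι : Fin D → Option W) (a : I → Fin D)
    (τ : Option (W ⊕ (I × Bool)) ≃ Option (B ⊕ (I × Bool))) (d : Fin D)
    (p : Option (W ⊕ (I × Bool))) :
    closing (insertEdge g ι) a ((optionSum W (I × Bool)).symm.trans
      (τ.trans (optionSum B (I × Bool)))) d (optionSum W (I × Bool) p) =
    optionSum W (I × Bool) (cut someInl none (ι d) (openClosing g a τ d) p) := by
  classical
  rw [closing_apply]
  simp only [Equiv.trans_apply, Equiv.symm_apply_apply]
  have key : ∀ q : Option (B ⊕ (I × Bool)), fieldEquiv (insertEdge g ι) a d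
      (optionSum B (I × Bool) q) = optionSum W (I × Bool)
      (swap none (addMark someInl none (ι d)) (Equiv.optionCongr (fieldEquiv g a d) q)) := by
    intro q
    rcases hι : ι d with _ | w
    · rw [addMark_none, Equiv.swap_self, Equiv.refl_apply]
      rcases q with _ | b | v
      · change Sum.inl ((insertEdge g ι d).symm none) = Sum.inl none
        rw [insertEdge_of_none hι]; rfl
      · change Sum.inl ((insertEdge g ι d).symm (some b)) = Sum.inl (some ((g d).symm b))
        rw [insertEdge_of_none hι]; rfl
      · rfl
    · rw [addMark_some]
      rcases q with _ | b | v
      · change Sum.inl ((insertEdge g ι d).symm none) = _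
        rw [insertEdge_of_some hι]
        change _ = optionSum W (I × Bool) (swap none (someInl w) none)
        rw [Equiv.swap_apply_left, Equiv.symm_trans_apply, Equiv.symm_swap, Equiv.swap_apply_left]
        change Sum.inl (some ((g d).symm (g d w))) = Sum.inl (some w)
        rw [Equiv.symm_apply_apply]
      · change Sum.inl ((insertEdge g ι d).symm (some b)) =
          optionSum W (I × Bool) (swap none (someInl w) (someInl ((g d).symm b)))
        rw [insertEdge_of_some hι, Equiv.symm_trans_apply, Equiv.symm_swap]
        by_cases hb : b = g d w
        · subst hb
          rw [Equiv.swap_apply_right, Equiv.symm_apply_apply, Equiv.swap_apply_right]; rfl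
        · rw [Equiv.swap_apply_of_ne_of_ne (by simp) (by simpa using hb),
            Equiv.swap_apply_of_ne_of_ne (by simp)
            (by simpa [Equiv.symm_apply_eq] using hb)]
          rfl
      · change Sum.inr (pillowEquiv a d v) = optionSum W (I × Bool)
          (swap none (someInl w) (some (Sum.inr (pillowEquiv a d v))))
        rw [Equiv.swap_apply_of_ne_of_ne (by simp) (by simp)]; rfl
  rw [key, cut, mulSwap_eq, Equiv.Perm.mul_apply]
  rfl

theorem sum_equivCongr {A A' C C' R : Type*} [Fintype (A ≃ A')] {_ : Fintype (C ≃ C')}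
    [AddCommMonoid R] (e : A ≃ C) (e' : A' ≃ C') (F : (C ≃ C') → R) :
    ∑ τ : A ≃ A', F (e.symm.trans (τ.trans e')) = ∑ τ, F τ :=
  Fintype.sum_equiv (Equiv.equivCongr e e') _ _ fun _ => rfl

open Classical in
theorem sum_weight_cut_eq_wickSum [Fintype W] [Fintype B] [Fintype I] [Fintype M]
    (E : (Fin D → M) → ℝ) (g : ColouredGraph D W B) (ι : Fin D → Option W)
    (X : Option W → Fin D → M) (w : W) :
    (∑ a : I → Fin D, ∑ τ : Option (W ⊕ (I × Bool)) ≃ Option (B ⊕ (I × Bool)),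
      if (∀ d, Separates (addMark someInl none) (cut someInl none (ι d) (openClosing g a τ d))) ∧
        Linked (fun d => cut someInl none (ι d) (openClosing g a τ d)) none (someInl w) then
      weight E (addMark someInl none) X
        (fun d => cut someInl none (ι d) (openClosing g a τ d)) else 0) =
    wickSum I (insertEdge g ι) none (some w) (weight E Sum.inl X) := by
  unfold wickSum
  refine Finset.sum_congr (by ext; simp) fun a _ => ?_
  rw [← sum_equivCongr (optionSum W (I × Bool)) (optionSum B (I × Bool))]
  refine Finset.sum_congr (by ext; simp) fun τ _ => ?_
  have hcl := closing_insertEdge g ι a τ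
  have hmark : ∀ o : Option W, (Sum.inl (Equiv.refl (Option W) o) : Option W ⊕ (I × Bool)) =
      optionSum W (I × Bool) (addMark someInl none o) := by
    rintro (_ | w) <;> rfl
  have e1 : ∀ d, Separates Sum.inl (closing (insertEdge g ι) a
      ((optionSum W (I × Bool)).symm.trans (τ.trans (optionSum B (I × Bool)))) d) ↔
      Separates (addMark someInl none) (cut someInl none (ι d) (openClosing g a τ d)) := fun d =>
    separates_congr (optionSum W (I × Bool)) (Equiv.refl (Option W)) hmark (hcl d)
  have e2 : Linked (closing (insertEdge g ι) a ((optionSum W (I × Bool)).symm.trans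
      (τ.trans (optionSum B (I × Bool))))) (Sum.inl none) (Sum.inl (some w)) ↔
      Linked (fun d => cut someInl none (ι d) (openClosing g a τ d)) none (someInl w) :=
    linked_congr (x := none) (y := someInl w) (optionSum W (I × Bool)) hcl
  have e3 : weight E Sum.inl X (closing (insertEdge g ι) a ((optionSum W (I × Bool)).symm.trans
      (τ.trans (optionSum B (I × Bool))))) = weight E (addMark someInl none) X
      (fun d => cut someInl none (ι d) (openClosing g a τ d)) :=
    weight_congr (optionSum W (I × Bool)) (Equiv.refl (Option W)) hmark (fun _ => rfl) hcl
  rw [e3]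
  exact if_congr (and_congr (forall_congr' fun d => (e1 d).symm) e2.symm) rfl rfl

/-- The cut permutations are linked if and only if the original ones are. -/
theorem linked_cut_iff [Finite W] [Finite I] {g : ColouredGraph D W B} {ι : Fin D → Option W}
    {c : Fin D} (hc : ι c = none) {a : I → Fin D}
    {τ : Option (W ⊕ (I × Bool)) ≃ Option (B ⊕ (I × Bool))} {x y : Option (W ⊕ (I × Bool))}
    (h : ∀ d, Separates (addMark someInl none) (cut someInl none (ι d) (openClosing g a τ d))) :
    Linked (fun d => cut someInl none (ι d) (openClosing g a τ d)) x y ↔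
      Linked (openClosing g a τ) x y := by
  classical
  have hinv : ∀ U : Set (Option (W ⊕ (I × Bool))),
      (∀ d, none ∈ U ↔ addMark someInl none (ι d) ∈ U) →
      (Invariant (fun d => cut someInl none (ι d) (openClosing g a τ d)) U ↔
        Invariant (openClosing g a τ) U) := fun U hU =>
    forall_congr' fun d => forall_mulSwap_iff (hU d)
  have h1 : ∀ U : Set (Option (W ⊕ (I × Bool))), Invariant (openClosing g a τ) U →
      ∀ d, none ∈ U ↔ addMark someInl none (ι d) ∈ U := by
    intro U hU d
    rcases hd : ι d with _ | w
    · rfl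
    · have := h d
      rw [hd] at this
      exact hU.mem_iff_of_sameCycle ((separates_addMark_cut_some none_ne_someInl).1 this).2
  have h2 : ∀ U : Set (Option (W ⊕ (I × Bool))),
      Invariant (fun d => cut someInl none (ι d) (openClosing g a τ d)) U →
      ∀ d, none ∈ U ↔ addMark someInl none (ι d) ∈ U := by
    intro U hU d
    -- The field contracted with the open `φ` is followed by `none` in colour `c`, where nothing is
    -- cut, and by the vertex `ι d` in colour `d`. So an invariant set cannot separate them.
    have hq : ∀ d, openClosing g a τ d (τ.symm none) = none := fun d => by simp [openClosing]
    have h3 := hU d (τ.symm none)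
    have h4 := hU c (τ.symm none)
    have h5 : cut someInl none (ι d) (openClosing g a τ d) (τ.symm none) =
        addMark someInl none (ι d) := by
      rw [cut, mulSwap_eq, Equiv.Perm.mul_apply, hq, Equiv.swap_apply_left]
    have h6 : cut someInl none (ι c) (openClosing g a τ c) (τ.symm none) = none := by
      rw [hc, cut_none, hq]
    simp only [h5] at h3
    simp only [h6] at h4
    exact h4.trans h3.symm
  constructor
  · exact fun H U hU hxy hne => H U ((hinv U (h1 U hU)).2 hU) hxy hne
  · exact fun H U hU hxy hne => H U ((hinv U (h2 U hU)).1 hU) hxy hne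

open Classical in
-- The unique cuts of the single colours form a unique `ι`. In colour `c` the point `none` is
-- already isolated, which means `ι c = none`.
theorem sum_forall_separates_cut [Fintype W] [Finite I] {R : Type*} [AddCommMonoid R]
    (σ : Fin D → Perm (Option (W ⊕ (I × Bool)))) (c : Fin D) (r : R) :
    (if (∀ d, d ≠ c → Separates someInl (σ d)) ∧ Separates (addMark someInl none) (σ c) then r
      else 0) =
    ∑ ι : Fin D → Option W, if ι c = none ∧
      ∀ d, Separates (addMark someInl none) (cut someInl none (ι d) (σ d)) then r else 0 := by
  by_cases h : (∀ d, d ≠ c → Separates someInl (σ d)) ∧ Separates (addMark someInl none) (σ c)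
  · rw [if_pos h]
    have h1 : ∀ d, ∃ o, (d = c → o = none) ∧
        Separates (addMark someInl none) (cut someInl none o (σ d)) := by
      intro d
      by_cases hd : d = c
      · subst hd
        exact ⟨none, fun _ => rfl, by rw [cut_none]; exact h.2⟩
      · obtain ⟨o, ho⟩ := (separates_iff_existsUnique_cut none_ne_someInl).1 (h.1 d hd)
        exact ⟨o, fun h => absurd h hd, ho⟩
    choose ι hι hι' using h1
    rw [Finset.sum_eq_single ι, if_pos ⟨hι c rfl, hι'⟩]
    · intro ι' _ hne
      rw [if_neg]
      exact fun h' => hne (funext fun d => cut_unique none_ne_someInl (h'.2 d) (hι' d))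
    · simp
  · rw [if_neg h, Finset.sum_eq_zero]
    intro ι _
    rw [if_neg]
    rintro ⟨hc, hι⟩
    refine h ⟨fun d _ => (separates_iff_existsUnique_cut none_ne_someInl).2 ⟨_, hι d⟩, ?_⟩
    have := hι c
    rwa [hc, cut_none] at this

open Classical in
theorem weight_peeledClosing_eq_sum [Fintype W] [Fintype I] [Fintype M]
    (E : (Fin D → M) → ℝ) (X : W → Fin D → M) (g : ColouredGraph D W B) (a : I → Fin D)
    (τ : Option (W ⊕ (I × Bool)) ≃ Option (B ⊕ (I × Bool))) (c : Fin D) (β : B)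
    {ι : Fin D → Option W} (hc : ι c = none)
    (h : ∀ d, Separates (addMark someInl none) (cut someInl none (ι d) (openClosing g a τ d))) :
    weight E someInl X (peeledClosing g a c β τ) = ∑ z : Fin D → M,
      if z c = X ((g c).symm β) c ∧ ∀ d w, ι d = some w → z d = X w d then
        weight E (addMark someInl none) (fun o => o.elim z X)
          (fun d => cut someInl none (ι d) (openClosing g a τ d))
      else 0 := by
  -- In colour `c` the cut at the white vertex of `β` undoes the crossing. It also fixes `z c` to be
  -- `s_c`, while the other colours are governed by `ι`.
  set ι' := Function.update ι c (some ((g c).symm β)) with hι'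
  have hcut : ∀ d, cut someInl none (ι' d) (peeledClosing g a c β τ d) =
      cut someInl none (ι d) (openClosing g a τ d) := by
    intro d
    by_cases hd : d = c
    · subst hd
      rw [hι', Function.update_self, peeledClosing_self, cut_some, mulSwap_mulSwap, hc, cut_none]
    · rw [hι', Function.update_of_ne hd, peeledClosing_of_ne g a hd]
  rw [weight_eq_sum_cut (x := none) ι']
  · refine Finset.sum_congr rfl fun z _ => ?_
    simp only [hcut]
    refine if_congr ?_ rfl rfl
    constructor
    · intro H
      refine ⟨H c _ (by rw [hι', Function.update_self]), fun d w hd => H d w ?_⟩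
      rw [hι', Function.update_of_ne]
      · exact hd
      · rintro rfl
        rw [hc] at hd; cases hd
    · rintro ⟨h1, h2⟩ d w hd
      by_cases hdc : d = c
      · subst hdc
        rw [hι', Function.update_self] at hd
        rw [← Option.some_injective _ hd]
        exact h1
      · rw [hι', Function.update_of_ne hdc] at hd
        exact h2 d w hd
  · intro d w hd
    have := h d
    rw [← hcut, hd] at this
    exact ((separates_addMark_cut_some none_ne_someInl).1 this).2

open Classical in
/-- The peeled sum, decomposed according to the place where the strand of colour `c` that starts
at the cut pillow ends. -/
theorem peeledSum_eq [Fintype W] [Fintype B] [Fintype I] [Fintype M]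
    (E : (Fin D → M) → ℝ) (X : W → Fin D → M) (g : ColouredGraph D W B) (c : Fin D) (β : B) :
    peeledSum I g c β (weight E someInl X) =
    (∑ ι : Fin D → Option W, if ι c = none then ∑ z : Fin D → M,
      if z c = X ((g c).symm β) c ∧ ∀ d w, ι d = some w → z d = X w d then
        wickSum I (insertEdge g ι) none (some ((g c).symm β))
          (weight E Sum.inl fun o => o.elim z X) else 0 else 0) +
    ∑ ρ, ∑ t, if ρ = β ∨ t = X ((g c).symm ρ) c then
      wickSum I (edgeSwap g c β ρ) ((g c).symm β) ((g c).symm ρ)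
        (cutStrandWeight E Sum.inl X ((g c).symm β) c t) else 0 := by
  -- The contribution of a contraction for which `o` is the cut that isolates the open field in
  -- colour `c`.
  set T : (I → Fin D) → (Option (W ⊕ (I × Bool)) ≃ Option (B ⊕ (I × Bool))) → Option W → ℝ :=
    fun a τ o => if ((∀ d, d ≠ c → Separates someInl (openClosing g a τ d)) ∧
      Separates (addMark someInl none) (cut someInl none o (peeledClosing g a c β τ c))) ∧
      Linked (openClosing g a τ) none (someInl ((g c).symm β)) then
      weight E someInl X (peeledClosing g a c β τ) else 0 with hT
  have hsplit : peeledSum I g c β (weight E someInl X) = ∑ a : I → Fin D, ∑ τ,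
      (T a τ (some ((g c).symm β)) + ∑ ρ, T a τ (cutMark g c β ρ)) := by
    unfold peeledSum
    refine Finset.sum_congr (by ext; simp) fun a _ => Finset.sum_congr (by ext; simp) fun τ _ => ?_
    rw [← sum_option_cutMark g c β (T a τ)]
    have h1 : (∀ d, Separates someInl (peeledClosing g a c β τ d)) ↔
        (∀ d, d ≠ c → Separates someInl (openClosing g a τ d)) ∧
        Separates someInl (peeledClosing g a c β τ c) := by
      constructor
      · exact fun h => ⟨fun d hd => peeledClosing_of_ne g a hd β τ ▸ h d, h c⟩
      · rintro ⟨h1, h2⟩ d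
        by_cases hd : d = c
        · exact hd ▸ h2
        · rw [peeledClosing_of_ne g a hd]; exact h1 d hd
    have h2 := sum_separates_cut (j := someInl) (σ := peeledClosing g a c β τ c)
      none_ne_someInl (weight E someInl X (peeledClosing g a c β τ))
    by_cases h3 : (∀ d, d ≠ c → Separates someInl (openClosing g a τ d)) ∧
        Linked (openClosing g a τ) none (someInl ((g c).symm β))
    · refine (if_congr (Q := Separates someInl (peeledClosing g a c β τ c)) ?_ rfl rfl).trans
        (h2.trans (Finset.sum_congr rfl fun o _ => if_congr ?_ rfl rfl))
      · exact ⟨fun h => (h1.1 h.1).2, fun h => ⟨h1.2 ⟨h3.1, h⟩, h3.2⟩⟩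
      · exact ⟨fun h => ⟨⟨h3.1, h⟩, h3.2⟩, fun h => h.1.2⟩
    · rw [if_neg fun h : _ ∧ _ => h3 ⟨(h1.1 h.1).1, h.2⟩, Finset.sum_eq_zero]
      intro o _
      exact if_neg fun h => h3 ⟨h.1.1, h.2⟩
  -- The open field lies on the strand of `β`: uncrossing leaves an inserted edge of colour `c`,
  -- whose position in the other colours is the sum over `ι`.
  have hY : ∀ a τ, T a τ (some ((g c).symm β)) =
      ∑ ι : Fin D → Option W, if ι c = none then ∑ z : Fin D → M,
      if z c = X ((g c).symm β) c ∧ ∀ d w, ι d = some w → z d = X w d then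
        (if (∀ d, Separates (addMark someInl none)
            (cut someInl none (ι d) (openClosing g a τ d))) ∧
          Linked (fun d => cut someInl none (ι d) (openClosing g a τ d)) none
            (someInl ((g c).symm β)) then
          weight E (addMark someInl none) (fun o => o.elim z X)
            (fun d => cut someInl none (ι d) (openClosing g a τ d)) else 0)
        else 0 else 0 := by
    intro a τ
    have h1 : cut someInl none (some ((g c).symm β)) (peeledClosing g a c β τ c) =
        openClosing g a τ c := by
      rw [peeledClosing_self, cut_some, mulSwap_mulSwap]
    have h2 := sum_forall_separates_cut (I := I) (openClosing g a τ) c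
      (weight E someInl X (peeledClosing g a c β τ))
    by_cases h3 : Linked (openClosing g a τ) none (someInl ((g c).symm β))
    · have h4 : T a τ (some ((g c).symm β)) =
          if (∀ d, d ≠ c → Separates someInl (openClosing g a τ d)) ∧
          Separates (addMark someInl none) (openClosing g a τ c) then
          weight E someInl X (peeledClosing g a c β τ) else 0 := by
        simp only [hT, h1]
        exact if_congr (and_iff_left h3) rfl rfl
      rw [h4, h2]
      refine Finset.sum_congr rfl fun ι _ => ?_
      by_cases hc : ι c = none
      swap
      · rw [if_neg hc, if_neg fun h => hc h.1]
      by_cases hι : ∀ d, Separates (addMark someInl none)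
          (cut someInl none (ι d) (openClosing g a τ d))
      · rw [if_pos ⟨hc, hι⟩, if_pos hc, weight_peeledClosing_eq_sum E X g a τ c β hc hι]
        refine Finset.sum_congr rfl fun z _ => ?_
        rw [if_pos (And.intro hι ((linked_cut_iff hc hι).2 h3))]
      · rw [if_neg fun h => hι h.2, if_pos hc, Finset.sum_eq_zero]
        intro z _
        rw [if_neg fun h : _ ∧ _ => hι h.1, ite_self]
    · have h4 : T a τ (some ((g c).symm β)) = 0 := if_neg fun h => h3 h.2
      rw [h4, Finset.sum_eq_zero]
      intro ι _
      by_cases hc : ι c = none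
      · rw [if_pos hc]
        refine Finset.sum_eq_zero fun z _ => ?_
        rw [if_neg fun h : _ ∧ _ => h3 ((linked_cut_iff hc h.1).1 h.2), ite_self]
      · rw [if_neg hc]
  -- All other cases: a boundary graph with swapped edges and an interrupted strand.
  have hN : ∀ a τ ρ, T a τ (cutMark g c β ρ) = ∑ t, if ρ = β ∨ t = X ((g c).symm ρ) c then
      (if (∀ d, Separates someInl (openClosing (edgeSwap g c β ρ) a τ d)) ∧
        (openClosing (edgeSwap g c β ρ) a τ c).SameCycle none (someInl ((g c).symm β)) ∧
        Linked (openClosing (edgeSwap g c β ρ) a τ) (someInl ((g c).symm β))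
          (someInl ((g c).symm ρ)) then
      cutWeight E someInl X none ((g c).symm β) c t (openClosing (edgeSwap g c β ρ) a τ) else 0)
      else 0 := by
    intro a τ ρ
    have h1 := separates_cutMark_iff g a τ c β ρ
    have h0 : (∀ d, Separates someInl (openClosing (edgeSwap g c β ρ) a τ d)) ↔
        (∀ d, d ≠ c → Separates someInl (openClosing g a τ d)) ∧
        Separates someInl (openClosing (edgeSwap g c β ρ) a τ c) := by
      constructor
      · exact fun h => ⟨fun d hd => openClosing_edgeSwap_of_ne g hd β ρ a τ ▸ h d, h c⟩
      · rintro ⟨h1, h2⟩ d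
        by_cases hd : d = c
        · exact hd ▸ h2
        · rw [openClosing_edgeSwap_of_ne g hd]; exact h1 d hd
    by_cases h2 : Separates (addMark someInl none) (cut someInl none (cutMark g c β ρ)
      (peeledClosing g a c β τ c))
    · have h3 := linked_openClosing_edgeSwap g a τ c β ρ h2
      have h4 := h1.1 h2
      simp only [hT]
      rw [weight_peeledClosing E X g a τ c β ρ h2]
      by_cases h5 : (∀ d, d ≠ c → Separates someInl (openClosing g a τ d)) ∧
        Linked (openClosing g a τ) none (someInl ((g c).symm β))
      · rw [if_pos ⟨⟨h5.1, h2⟩, h5.2⟩]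
        refine Finset.sum_congr rfl fun t _ => ?_
        rw [if_pos (And.intro (h0.2 ⟨h5.1, h4.1⟩) (And.intro h4.2 (h3.1 h5.2)))]
      · rw [if_neg fun h => h5 ⟨h.1.1, h.2⟩, Finset.sum_eq_zero]
        intro t _
        rw [if_neg fun h : _ ∧ _ ∧ _ => h5 ⟨(h0.1 h.1).1, h3.2 h.2.2⟩, ite_self]
    · have h4 : T a τ (cutMark g c β ρ) = 0 := if_neg fun h => h2 h.1.2
      rw [h4, Finset.sum_eq_zero]
      intro t _
      exact (if_congr Iff.rfl (if_neg fun h => h2 (h1.2 ⟨h.1 c, h.2.1⟩)) rfl).trans (ite_self _)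
  rw [hsplit]
  simp only [Finset.sum_add_distrib]
  congr 1
  · simp only [hY]
    have hcomm : ∀ a : I → Fin D, (∑ τ : Option (W ⊕ (I × Bool)) ≃ Option (B ⊕ (I × Bool)),
        ∑ ι : Fin D → Option W, if ι c = none then ∑ z : Fin D → M,
      if z c = X ((g c).symm β) c ∧ ∀ d w, ι d = some w → z d = X w d then
        (if (∀ d, Separates (addMark someInl none)
            (cut someInl none (ι d) (openClosing g a τ d))) ∧
          Linked (fun d => cut someInl none (ι d) (openClosing g a τ d)) none
            (someInl ((g c).symm β)) then
          weight E (addMark someInl none) (fun o => o.elim z X)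
            (fun d => cut someInl none (ι d) (openClosing g a τ d)) else 0)
        else 0 else 0) = ∑ ι : Fin D → Option W, if ι c = none then ∑ z : Fin D → M,
      if z c = X ((g c).symm β) c ∧ ∀ d w, ι d = some w → z d = X w d then
        ∑ τ, (if (∀ d, Separates (addMark someInl none)
            (cut someInl none (ι d) (openClosing g a τ d))) ∧
          Linked (fun d => cut someInl none (ι d) (openClosing g a τ d)) none
            (someInl ((g c).symm β)) then
          weight E (addMark someInl none) (fun o => o.elim z X)
            (fun d => cut someInl none (ι d) (openClosing g a τ d)) else 0)
        else 0 else 0 := by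
      intro a
      rw [Finset.sum_comm]
      refine Finset.sum_congr rfl fun ι _ => ?_
      by_cases hc : ι c = none
      · simp only [if_pos hc]
        rw [Finset.sum_comm]
        refine Finset.sum_congr rfl fun z _ => ?_
        by_cases hz : z c = X ((g c).symm β) c ∧ ∀ d w, ι d = some w → z d = X w d
        · simp only [if_pos hz]
        · simp only [if_neg hz, Finset.sum_const_zero]
      · simp only [if_neg hc, Finset.sum_const_zero]
    simp only [hcomm]
    rw [Finset.sum_comm]
    refine Finset.sum_congr rfl fun ι _ => ?_
    by_cases hc : ι c = none
    · simp only [if_pos hc]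
      rw [Finset.sum_comm]
      refine Finset.sum_congr rfl fun z _ => ?_
      by_cases hz : z c = X ((g c).symm β) c ∧ ∀ d w, ι d = some w → z d = X w d
      · simp only [if_pos hz]
        rw [← sum_weight_cut_eq_wickSum]
      · simp only [if_neg hz, Finset.sum_const_zero]
    · simp only [if_neg hc, Finset.sum_const_zero]
  · simp only [hN]
    have hcomm : ∀ a : I → Fin D, (∑ τ : Option (W ⊕ (I × Bool)) ≃ Option (B ⊕ (I × Bool)),
        ∑ ρ, ∑ t, if ρ = β ∨ t = X ((g c).symm ρ) c then
      (if (∀ d, Separates someInl (openClosing (edgeSwap g c β ρ) a τ d)) ∧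
        (openClosing (edgeSwap g c β ρ) a τ c).SameCycle none (someInl ((g c).symm β)) ∧
        Linked (openClosing (edgeSwap g c β ρ) a τ) (someInl ((g c).symm β))
          (someInl ((g c).symm ρ)) then
      cutWeight E someInl X none ((g c).symm β) c t (openClosing (edgeSwap g c β ρ) a τ) else 0)
      else 0) = ∑ ρ, ∑ t, if ρ = β ∨ t = X ((g c).symm ρ) c then ∑ τ,
      (if (∀ d, Separates someInl (openClosing (edgeSwap g c β ρ) a τ d)) ∧
        (openClosing (edgeSwap g c β ρ) a τ c).SameCycle none (someInl ((g c).symm β)) ∧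
        Linked (openClosing (edgeSwap g c β ρ) a τ) (someInl ((g c).symm β))
          (someInl ((g c).symm ρ)) then
      cutWeight E someInl X none ((g c).symm β) c t (openClosing (edgeSwap g c β ρ) a τ) else 0)
      else 0 := by
      intro a
      rw [Finset.sum_comm]
      refine Finset.sum_congr rfl fun ρ _ => ?_
      rw [Finset.sum_comm]
      refine Finset.sum_congr rfl fun t _ => ?_
      by_cases ht : ρ = β ∨ t = X ((g c).symm ρ) c
      · simp only [if_pos ht]
      · simp only [if_neg ht, Finset.sum_const_zero]
    simp only [hcomm]
    rw [Finset.sum_comm]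
    refine Finset.sum_congr rfl fun ρ _ => ?_
    rw [Finset.sum_comm]
    refine Finset.sum_congr rfl fun t _ => ?_
    by_cases ht : ρ = β ∨ t = X ((g c).symm ρ) c
    · simp only [if_pos ht]
      rw [← sum_cutWeight_openClosing]
    · simp only [if_neg ht, Finset.sum_const_zero]

end Parts

/-! ### Isomorphic graphs -/

section Congr

variable {D : ℕ} {W W' B B' I I' M : Type*}

/-- Relabelling of the fields. -/
def slotCongr (e : W ≃ W') (k : I ≃ I') : W ⊕ (I × Bool) ≃ W' ⊕ (I' × Bool) :=
  Equiv.sumCongr e (k.prodCongr (Equiv.refl Bool))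

theorem closing_slotCongr {g : ColouredGraph D W B} {g' : ColouredGraph D W' B'} (e : W ≃ W')
    (f : B ≃ B') (k : I ≃ I') (h : ∀ c w, g' c (e w) = f (g c w)) (a : I' → Fin D)
    (τ : W ⊕ (I × Bool) ≃ B ⊕ (I × Bool)) (c : Fin D) (p : W ⊕ (I × Bool)) :
    closing g' a ((slotCongr e k).symm.trans (τ.trans (slotCongr f k))) c (slotCongr e k p) =
      slotCongr e k (closing g (fun i => a (k i)) τ c p) := by
  rw [closing_apply, closing_apply]
  simp only [Equiv.trans_apply, Equiv.symm_apply_apply]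
  rcases τ p with b | v
  · change Sum.inl ((g' c).symm (f b)) = Sum.inl (e ((g c).symm b))
    congr 1
    rw [Equiv.symm_apply_eq, h, Equiv.apply_symm_apply]
  · rfl

theorem wickSum_congr {_ : Fintype W} {_ : Fintype W'} {_ : Fintype B} {_ : Fintype B'}
    {_ : Fintype I} {_ : Fintype I'} [Fintype M] {E : (Fin D → M) → ℝ}
    {g : ColouredGraph D W B} {g' : ColouredGraph D W' B'} (e : W ≃ W')
    (f : B ≃ B') (k : I ≃ I') (h : ∀ c w, g' c (e w) = f (g c w)) {X : W → Fin D → M}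
    {X' : W' → Fin D → M} (hX : ∀ w, X' (e w) = X w) (x y : W) :
    wickSum I' g' (e x) (e y) (weight E Sum.inl X') = wickSum I g x y (weight E Sum.inl X) := by
  classical
  unfold wickSum
  rw [← (k.symm.arrowCongr (Equiv.refl (Fin D))).sum_comp]
  refine Finset.sum_congr (by ext; simp) fun a _ => ?_
  rw [← sum_equivCongr (slotCongr e k) (slotCongr f k)]
  refine Finset.sum_congr (by ext; simp) fun τ _ => ?_
  have hcl := closing_slotCongr e f k h a τ
  have e3 := weight_congr (E := E) (j := Sum.inl) (j' := Sum.inl) (slotCongr e k) e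
    (fun _ => rfl) hX hcl
  rw [e3]
  refine if_congr (and_congr (forall_congr' fun c => ?_) ?_) rfl rfl
  · exact separates_congr (slotCongr e k) e (fun _ => rfl) (hcl c)
  · exact linked_congr (x := Sum.inl x) (y := Sum.inl y) (slotCongr e k) hcl

theorem linkedCorr_congr {_ : Fintype W} {_ : Fintype W'} {_ : Fintype B} {_ : Fintype B'}
    [Fintype M] {E : (Fin D → M) → ℝ}
    {g : ColouredGraph D W B} {g' : ColouredGraph D W' B'} (e : W ≃ W')
    (f : B ≃ B') (h : ∀ c w, g' c (e w) = f (g c w)) {X : W → Fin D → M}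
    {X' : W' → Fin D → M} (hX : ∀ w, X' (e w) = X w) (x y : W) :
    linkedCorr E g' (e x) (e y) X' = linkedCorr E g x y X := by
  ext n
  simp only [linkedCorr, PowerSeries.coeff_mk]
  rw [wickSum_congr e f (Equiv.refl (Fin n)) h hX]

theorem corr_of_isEmpty [Fintype W] [Fintype B] [Fintype M] [IsEmpty W] (E : (Fin D → M) → ℝ)
    (g : ColouredGraph D W B) (X : W → Fin D → M) : corr E g X = 0 := by
  have hW : ¬ Nonempty W := not_nonempty_iff.2 inferInstance
  ext n
  simp only [corr, corrShift, contractions, hW, false_and, Finset.filter_false,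
    Finset.sum_empty, Finset.sum_const_zero, mul_zero, PowerSeries.coeff_mk, map_zero]

theorem corr_congr (hD : 2 ≤ D) {_ : Fintype W} {_ : Fintype W'} {_ : Fintype B} {_ : Fintype B'}
    [Fintype M] {E : (Fin D → M) → ℝ}
    {g : ColouredGraph D W B} {g' : ColouredGraph D W' B'} (e : W ≃ W')
    (f : B ≃ B') (h : ∀ c w, g' c (e w) = f (g c w)) {X : W → Fin D → M}
    {X' : W' → Fin D → M} (hX : ∀ w, X' (e w) = X w) :
    corr E g' X' = corr E g X := by
  rcases isEmpty_or_nonempty W with hW | ⟨⟨x⟩⟩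
  · have : IsEmpty W' := e.symm.isEmpty
    rw [corr_of_isEmpty, corr_of_isEmpty]
  · rw [coeff_corr hD E g X x, coeff_corr hD E g' X' (e x), linkedCorr_congr e f h hX]

end Congr

/-! ### Disjoint unions -/

section Union

variable {D : ℕ} {W W₁ W₂ B B₁ B₂ I I₁ I₂ M : Type*}

theorem sum_equiv_isLeft {α₁ α₂ β₁ β₂ R : Type*} [Fintype (α₁ ⊕ α₂ ≃ β₁ ⊕ β₂)]
    [Fintype (α₁ ≃ β₁)] [Fintype (α₂ ≃ β₂)] [AddCommMonoid R]
    (F : (α₁ ⊕ α₂ ≃ β₁ ⊕ β₂) → R) [DecidablePred fun τ : α₁ ⊕ α₂ ≃ β₁ ⊕ β₂ =>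
      ∀ p, (τ p).isLeft = p.isLeft] :
    (∑ τ : α₁ ⊕ α₂ ≃ β₁ ⊕ β₂, if ∀ p, (τ p).isLeft = p.isLeft then F τ else 0) =
      ∑ τ₁ : α₁ ≃ β₁, ∑ τ₂ : α₂ ≃ β₂, F (Equiv.sumCongr τ₁ τ₂) := by
  rw [← Finset.sum_filter,
    ← Fintype.sum_prod_type' (f := fun τ₁ τ₂ => F (Equiv.sumCongr τ₁ τ₂))]
  symm
  refine Finset.sum_bij (fun t _ => Equiv.sumCongr t.1 t.2) ?_ ?_ ?_ fun _ _ => rfl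
  · rintro ⟨τ₁, τ₂⟩ _
    simp only [Finset.mem_filter, Finset.mem_univ, true_and]
    rintro (p | p) <;> rfl
  · rintro ⟨τ₁, τ₂⟩ _ ⟨τ₁', τ₂'⟩ _ h
    have h' := fun p => congrArg (fun e : α₁ ⊕ α₂ ≃ β₁ ⊕ β₂ => e p) h
    refine Prod.ext (Equiv.ext fun p => ?_) (Equiv.ext fun p => ?_)
    · exact Sum.inl_injective (h' (Sum.inl p))
    · exact Sum.inr_injective (h' (Sum.inr p))
  · intro τ hτ
    simp only [Finset.mem_filter, Finset.mem_univ, true_and] at hτ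
    have hτ' : ∀ q, (τ.symm q).isLeft = q.isLeft := fun q => by
      rw [← hτ, Equiv.apply_symm_apply]
    choose f₁ hf₁ using fun p => Sum.isLeft_iff.1 ((hτ (Sum.inl p)).trans rfl)
    choose f₂ hf₂ using fun p => Sum.isRight_iff.1
      (show (τ (Sum.inr p)).isRight = true by simpa using hτ (Sum.inr p))
    choose k₁ hk₁ using fun p => Sum.isLeft_iff.1 ((hτ' (Sum.inl p)).trans rfl)
    choose k₂ hk₂ using fun p => Sum.isRight_iff.1
      (show (τ.symm (Sum.inr p)).isRight = true by simpa using hτ' (Sum.inr p))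
    refine ⟨(⟨f₁, k₁, fun p => ?_, fun p => ?_⟩, ⟨f₂, k₂, fun p => ?_, fun p => ?_⟩),
      Finset.mem_univ _, ?_⟩
    · apply Sum.inl_injective (β := α₂); rw [← hk₁, ← hf₁, Equiv.symm_apply_apply]
    · apply Sum.inl_injective (β := β₂); rw [← hf₁, ← hk₁, Equiv.apply_symm_apply]
    · apply Sum.inr_injective (α := α₁); rw [← hk₂, ← hf₂, Equiv.symm_apply_apply]
    · apply Sum.inr_injective (α := β₁); rw [← hf₂, ← hk₂, Equiv.apply_symm_apply]
    · ext p
      rcases p with p | p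
      · exact (hf₁ p).symm
      · exact (hf₂ p).symm

/-- The fields of a disjoint union. -/
def slotSum (e : W₁ ⊕ W₂ ≃ W) (k : I₁ ⊕ I₂ ≃ I) :
    (W₁ ⊕ (I₁ × Bool)) ⊕ (W₂ ⊕ (I₂ × Bool)) ≃ W ⊕ (I × Bool) :=
  (Equiv.sumSumSumComm _ _ _ _).trans (Equiv.sumCongr e
    ((Equiv.sumProdDistrib I₁ I₂ Bool).symm.trans (k.prodCongr (Equiv.refl Bool))))

theorem closing_slotSum {g : ColouredGraph D W B} {g₁ : ColouredGraph D W₁ B₁}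
    {g₂ : ColouredGraph D W₂ B₂} (e : W₁ ⊕ W₂ ≃ W) (f : B₁ ⊕ B₂ ≃ B) (k : I₁ ⊕ I₂ ≃ I)
    (h₁ : ∀ c w, g c (e (Sum.inl w)) = f (Sum.inl (g₁ c w)))
    (h₂ : ∀ c w, g c (e (Sum.inr w)) = f (Sum.inr (g₂ c w))) (a : I → Fin D)
    (τ₁ : W₁ ⊕ (I₁ × Bool) ≃ B₁ ⊕ (I₁ × Bool)) (τ₂ : W₂ ⊕ (I₂ × Bool) ≃ B₂ ⊕ (I₂ × Bool))
    (c : Fin D) (p : (W₁ ⊕ (I₁ × Bool)) ⊕ (W₂ ⊕ (I₂ × Bool))) :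
    closing g a ((slotSum e k).symm.trans ((Equiv.sumCongr τ₁ τ₂).trans (slotSum f k))) c
      (slotSum e k p) =
    slotSum e k (Perm.sumCongr (closing g₁ (fun i => a (k (Sum.inl i))) τ₁ c)
      (closing g₂ (fun i => a (k (Sum.inr i))) τ₂ c) p) := by
  rw [closing_apply]
  simp only [Equiv.trans_apply, Equiv.symm_apply_apply]
  rcases p with p | p
  · change _ = slotSum e k (Sum.inl (fieldEquiv g₁ _ c (τ₁ p)))
    change fieldEquiv g a c (slotSum f k (Sum.inl (τ₁ p))) = _
    rcases τ₁ p with b | v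
    · change Sum.inl ((g c).symm (f (Sum.inl b))) = Sum.inl (e (Sum.inl ((g₁ c).symm b)))
      congr 1
      rw [Equiv.symm_apply_eq, h₁, Equiv.apply_symm_apply]
    · rfl
  · change _ = slotSum e k (Sum.inr (fieldEquiv g₂ _ c (τ₂ p)))
    change fieldEquiv g a c (slotSum f k (Sum.inr (τ₂ p))) = _
    rcases τ₂ p with b | v
    · change Sum.inl ((g c).symm (f (Sum.inr b))) = Sum.inl (e (Sum.inr ((g₂ c).symm b)))
      congr 1
      rw [Equiv.symm_apply_eq, h₂, Equiv.apply_symm_apply]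
    · rfl

open Classical in
-- A contraction that respects the splitting is a pair of contractions. Separation, weights and
-- linkedness all factorize, and linking the two base points means that each part is connected by
-- itself.
theorem sum_isLeft_eq_mul [Fintype W] {_ : Fintype W₁} {_ : Fintype W₂} [Fintype B]
    {_ : Fintype B₁} {_ : Fintype B₂} [Fintype I] {_ : Fintype I₁} {_ : Fintype I₂}
    [Fintype M] {E : (Fin D → M) → ℝ} {g : ColouredGraph D W B} {g₁ : ColouredGraph D W₁ B₁}
    {g₂ : ColouredGraph D W₂ B₂} (e : W₁ ⊕ W₂ ≃ W) (f : B₁ ⊕ B₂ ≃ B) (k : I₁ ⊕ I₂ ≃ I)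
    (h₁ : ∀ c w, g c (e (Sum.inl w)) = f (Sum.inl (g₁ c w)))
    (h₂ : ∀ c w, g c (e (Sum.inr w)) = f (Sum.inr (g₂ c w)))
    (X : W → Fin D → M) (x : W₁) (y : W₂) :
    (∑ a : I → Fin D, ∑ τ : W ⊕ (I × Bool) ≃ B ⊕ (I × Bool),
      if (∀ p, ((slotSum f k).symm (τ (slotSum e k p))).isLeft = p.isLeft) ∧
        (∀ c, Separates Sum.inl (closing g a τ c)) ∧
        Linked (closing g a τ) (Sum.inl (e (Sum.inl x))) (Sum.inl (e (Sum.inr y))) then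
      weight E Sum.inl X (closing g a τ) else 0) =
    wickSum I₁ g₁ x x (weight E Sum.inl fun w => X (e (Sum.inl w))) *
      wickSum I₂ g₂ y y (weight E Sum.inl fun w => X (e (Sum.inr w))) := by
  have hL : ∀ a : I → Fin D, (∑ τ : W ⊕ (I × Bool) ≃ B ⊕ (I × Bool),
      if (∀ p, ((slotSum f k).symm (τ (slotSum e k p))).isLeft = p.isLeft) ∧
        (∀ c, Separates Sum.inl (closing g a τ c)) ∧
        Linked (closing g a τ) (Sum.inl (e (Sum.inl x))) (Sum.inl (e (Sum.inr y))) then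
      weight E Sum.inl X (closing g a τ) else 0) =
      ∑ τ₁ : W₁ ⊕ (I₁ × Bool) ≃ B₁ ⊕ (I₁ × Bool), ∑ τ₂ : W₂ ⊕ (I₂ × Bool) ≃ B₂ ⊕ (I₂ × Bool),
      (if (∀ c, Separates Sum.inl (closing g₁ (fun i => a (k (Sum.inl i))) τ₁ c)) ∧
        Linked (closing g₁ (fun i => a (k (Sum.inl i))) τ₁) (Sum.inl x) (Sum.inl x) then
        weight E Sum.inl (fun w => X (e (Sum.inl w))) (closing g₁ (fun i => a (k (Sum.inl i))) τ₁)
        else 0) *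
      (if (∀ c, Separates Sum.inl (closing g₂ (fun i => a (k (Sum.inr i))) τ₂ c)) ∧
        Linked (closing g₂ (fun i => a (k (Sum.inr i))) τ₂) (Sum.inl y) (Sum.inl y) then
        weight E Sum.inl (fun w => X (e (Sum.inr w))) (closing g₂ (fun i => a (k (Sum.inr i))) τ₂)
        else 0) := by
    intro a
    rw [← sum_equivCongr (slotSum e k) (slotSum f k)]
    refine Eq.trans ?_ ((sum_equiv_isLeft fun τ =>
      if (∀ c, Separates Sum.inl (closing g a ((slotSum e k).symm.trans
          (τ.trans (slotSum f k))) c)) ∧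
        Linked (closing g a ((slotSum e k).symm.trans (τ.trans (slotSum f k))))
          (Sum.inl (e (Sum.inl x))) (Sum.inl (e (Sum.inr y))) then
      weight E Sum.inl X (closing g a ((slotSum e k).symm.trans (τ.trans (slotSum f k))))
      else 0).trans ?_)
    · refine Finset.sum_congr (by ext; simp) fun τ _ => ?_
      rw [← ite_and]
      refine if_congr (and_congr_left' (forall_congr' fun p => ?_)) rfl rfl
      simp only [Equiv.trans_apply, Equiv.symm_apply_apply]
    · refine Finset.sum_congr (by ext; simp) fun τ₁ _ =>
        Finset.sum_congr (by ext; simp) fun τ₂ _ => ?_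
      have hcl := closing_slotSum e f k h₁ h₂ a τ₁ τ₂
      have hj : ∀ w : W₁ ⊕ W₂, (Sum.inl (e w) : W ⊕ (I × Bool)) =
          slotSum e k (Sum.map Sum.inl Sum.inl w) := by rintro (w | w) <;> rfl
      rw [weight_congr (E := E) (X := fun w => X (e w)) (slotSum e k) e hj (fun _ => rfl) hcl,
        weight_sumCongr, ite_zero_mul_ite_zero]
      refine if_congr ?_ rfl rfl
      have e1 : (∀ c, Separates Sum.inl (closing g a ((slotSum e k).symm.trans
          ((Equiv.sumCongr τ₁ τ₂).trans (slotSum f k))) c)) ↔ ∀ c,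
          (Separates Sum.inl (closing g₁ (fun i => a (k (Sum.inl i))) τ₁ c) ∧
           Separates Sum.inl (closing g₂ (fun i => a (k (Sum.inr i))) τ₂ c)) :=
        forall_congr' fun c => (separates_congr (slotSum e k) e hj (hcl c)).trans
          separates_sumCongr
      have e2 := (linked_congr (x := Sum.inl (Sum.inl x)) (y := Sum.inr (Sum.inl y))
        (slotSum e k) hcl).trans linked_sumCongr
      have e3 : (∀ c,
          (Separates Sum.inl (closing g₁ (fun i => a (k (Sum.inl i))) τ₁ c) ∧
           Separates Sum.inl (closing g₂ (fun i => a (k (Sum.inr i))) τ₂ c))) ∧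
          Linked (closing g₁ (fun i => a (k (Sum.inl i))) τ₁) (Sum.inl x) (Sum.inl x) ∧
          Linked (closing g₂ (fun i => a (k (Sum.inr i))) τ₂) (Sum.inl y) (Sum.inl y) ↔ _ :=
        (and_congr_left' forall_and).trans and_and_and_comm
      exact (and_congr e1 e2).trans e3
  simp only [hL]
  unfold wickSum
  have key : ∀ (G : (I₁ → Fin D) → ℝ) (H : (I₂ → Fin D) → ℝ), (∑ a, G a) * ∑ b, H b =
      ∑ t : (I₁ → Fin D) × (I₂ → Fin D), G t.1 * H t.2 := fun G H => by
    rw [Finset.sum_mul_sum, Fintype.sum_prod_type]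
  rw [key]
  symm
  refine Fintype.sum_equiv ((Equiv.sumArrowEquivProdArrow I₁ I₂ (Fin D)).symm.trans
    (k.arrowCongr (Equiv.refl (Fin D)))) _ _ fun t => ?_
  have ht₁ : (fun i => ((Equiv.sumArrowEquivProdArrow I₁ I₂ (Fin D)).symm.trans
    (k.arrowCongr (Equiv.refl (Fin D)))) t (k (Sum.inl i))) = t.1 := by
    funext i; simp; rfl
  have ht₂ : (fun i => ((Equiv.sumArrowEquivProdArrow I₁ I₂ (Fin D)).symm.trans
    (k.arrowCongr (Equiv.refl (Fin D)))) t (k (Sum.inr i))) = t.2 := by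
    funext i; simp; rfl
  rw [ht₁, ht₂, Finset.sum_mul_sum]

end Union

/-! ### Feynman graphs with two components -/

section TwoComponents

variable {D : ℕ} {W B I M : Type*}

/-- The fields of the external vertices in `A` and the pillows in `K`. -/
def slotsIn {V : Type*} (A : Set V) (K : Set I) : Set (V ⊕ (I × Bool)) :=
  Sum.elim (· ∈ A) fun v => v.1 ∈ K

@[simp] theorem inl_mem_slotsIn {V : Type*} {A : Set V} {K : Set I} {w : V} :
    Sum.inl w ∈ slotsIn A K ↔ w ∈ A := Iff.rfl

/-- The external vertices in `A` and the pillows in `K` form a union of components. -/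
def IsBlock (g : ColouredGraph D W B) (τ : W ⊕ (I × Bool) ≃ B ⊕ (I × Bool)) (A : Set (W ⊕ B))
    (K : Set I) : Prop :=
  IsUnion g A ∧ ∀ p, τ p ∈ slotsIn (Sum.inr ⁻¹' A) K ↔ p ∈ slotsIn (Sum.inl ⁻¹' A) K

variable {g : ColouredGraph D W B} {a : I → Fin D} {τ : W ⊕ (I × Bool) ≃ B ⊕ (I × Bool)}

theorem IsBlock.invariant {A : Set (W ⊕ B)} {K : Set I} (h : IsBlock g τ A K) (a : I → Fin D) :
    Invariant (closing g a τ) (slotsIn (Sum.inl ⁻¹' A) K) := by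
  intro c p
  rw [← h.2 p, closing_apply]
  rcases τ p with b | v
  · rw [fieldEquiv_inl, inl_mem_slotsIn, inl_mem_slotsIn, Set.mem_preimage, Set.mem_preimage,
      h.1 c, Equiv.apply_symm_apply]
  · rfl

/-- The external vertices of an invariant set of propagators. -/
def endsOf (τ : W ⊕ (I × Bool) ≃ B ⊕ (I × Bool)) (U : Set (W ⊕ (I × Bool))) : Set (W ⊕ B) :=
  Sum.elim (fun w => Sum.inl w ∈ U) fun b => τ.symm (Sum.inl b) ∈ U

/-- The pillows of an invariant set of propagators. -/
def pillowsOf (U : Set (W ⊕ (I × Bool))) : Set I := {i | Sum.inr (i, false) ∈ U}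

theorem slotsIn_endsOf (hD : 2 ≤ D) {U : Set (W ⊕ (I × Bool))}
    (hU : Invariant (closing g a τ) U) :
    slotsIn (Sum.inl ⁻¹' endsOf τ U) (pillowsOf U) = U := by
  ext (w | ⟨i, e⟩)
  · rfl
  · exact hU.pillow_mem_iff hD i false e

theorem Invariant.isBlock (hD : 2 ≤ D) {U : Set (W ⊕ (I × Bool))}
    (hU : Invariant (closing g a τ) U) : IsBlock g τ (endsOf τ U) (pillowsOf U) := by
  constructor
  · intro c w
    have := hU c (τ.symm (Sum.inl (g c w)))
    rw [closing_apply, Equiv.apply_symm_apply, fieldEquiv_inl, Equiv.symm_apply_apply] at this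
    exact this
  · intro p
    rw [slotsIn_endsOf hD hU]
    rcases hp : τ p with b | v
    · change τ.symm (Sum.inl b) ∈ U ↔ _
      rw [← hp, Equiv.symm_apply_apply]
    · exact (hU.mem_of_inr_iff hD hp false).symm

theorem IsBlock.eq_endsOf {A : Set (W ⊕ B)} {K : Set I} (h : IsBlock g τ A K) :
    A = endsOf τ (slotsIn (Sum.inl ⁻¹' A) K) := by
  ext (w | b)
  · rfl
  · change _ ↔ τ.symm (Sum.inl b) ∈ slotsIn (Sum.inl ⁻¹' A) K
    rw [← h.2, Equiv.apply_symm_apply]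
    rfl

/-- A contraction that is connected after joining `x` and `y` is either connected, or it consists
of a component at `x` and one at `y`. -/
theorem linked_iff_or_isBlock (hD : 2 ≤ D) {x y : W} :
    Linked (closing g a τ) (Sum.inl x) (Sum.inl y) ↔
      Linked (closing g a τ) (Sum.inl x) (Sum.inl x) ∨
      ∃ A K, (IsBlock g τ A K ∧ Sum.inl x ∈ A ∧ Sum.inl y ∉ A) ∧
        Linked (closing g a τ) (Sum.inl x) (Sum.inl y) := by
  constructor
  · intro h
    by_contra! hcon
    obtain ⟨hx, hA⟩ := hcon
    have hno : ∀ U, Invariant (closing g a τ) U → Sum.inl x ∈ U → Sum.inl y ∈ U := by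
      intro U hU hxU
      by_contra hyU
      exact hA _ _ ⟨hU.isBlock hD, hxU, hyU⟩ h
    -- If no invariant set contains `x` without `y`, then, by complements, none contains `y` without
    -- `x`; joining them adds nothing, and the contraction is already connected.
    refine hx (linked_self_iff.2 fun U hU hne => h U hU ⟨hno U hU, fun hy => ?_⟩ hne)
    by_contra hx'
    exact hno _ hU.compl hx' hy
  · rintro (h | ⟨_, _, _, h⟩)
    · exact h.of_self _ _
    · exact h

theorem not_linked_of_isBlock {A : Set (W ⊕ B)} {K : Set I} {x y : W} (h : IsBlock g τ A K)
    (hx : Sum.inl x ∈ A) (hy : Sum.inl y ∉ A) :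
    ¬ Linked (closing g a τ) (Sum.inl x) (Sum.inl x) := fun hl =>
  hy (linked_self_iff.1 hl _ (h.invariant a) ⟨Sum.inl x, hx⟩ (Sum.inl y))

/-- The difference of two such blocks is invariant and contains neither `x` nor `y`. Linkedness
would force a nonempty one to be everything, so it is empty. -/
theorem isBlock_unique {A A' : Set (W ⊕ B)} {K K' : Set I} {x y : W} (h : IsBlock g τ A K)
    (hx : Sum.inl x ∈ A) (hy : Sum.inl y ∉ A) (h' : IsBlock g τ A' K')
    (hx' : Sum.inl x ∈ A') (hy' : Sum.inl y ∉ A')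
    (hl : Linked (closing g a τ) (Sum.inl x) (Sum.inl y)) : A = A' ∧ K = K' := by
  have key : ∀ U U' : Set (W ⊕ (I × Bool)), Invariant (closing g a τ) U →
      Invariant (closing g a τ) U' → Sum.inl x ∈ U' → Sum.inl y ∉ U → U ⊆ U' := by
    intro U U' hU hU' hx' hy p hp
    by_contra hp'
    exact hy (hl _ (hU.inter hU'.compl) ⟨fun h => absurd hx' h.2, fun h => absurd h.1 hy⟩
      ⟨p, hp, hp'⟩ (Sum.inl y)).1
  have heq : slotsIn (Sum.inl ⁻¹' A) K = slotsIn (Sum.inl ⁻¹' A') K' :=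
    (key _ _ (h.invariant a) (h'.invariant a) hx' hy).antisymm
      (key _ _ (h'.invariant a) (h.invariant a) hx hy')
  refine ⟨by rw [h.eq_endsOf, heq, ← h'.eq_endsOf], ?_⟩
  ext i
  have := congrArg (fun U => (Sum.inr (i, false) : W ⊕ (I × Bool)) ∈ U) heq
  exact iff_of_eq this

theorem isUnion_compl {A : Set (W ⊕ B)} (h : IsUnion g A) : IsUnion g Aᶜ :=
  fun c w => not_congr (h c w)

open Classical in
-- For fixed external vertices `A` and pillows `K` the contraction factorizes; the pillows are
-- renumbered, so that only the size of `K` matters.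
theorem sum_isBlock_eq_mul [Fintype W] [Fintype B] [Fintype I] [Fintype M] (E : (Fin D → M) → ℝ)
    (X : W → Fin D → M) {x y : W} {A : Set (W ⊕ B)} (hA : IsUnion g A) (hx : Sum.inl x ∈ A)
    (hy : Sum.inl y ∉ A) (K : Finset I) :
    (∑ a : I → Fin D, ∑ τ : W ⊕ (I × Bool) ≃ B ⊕ (I × Bool),
      if IsBlock g τ A K ∧ (∀ c, Separates Sum.inl (closing g a τ c)) ∧
        Linked (closing g a τ) (Sum.inl x) (Sum.inl y) then
      weight E Sum.inl X (closing g a τ) else 0) =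
    wickSum (Fin K.card) (restrict g A hA) ⟨x, hx⟩ ⟨x, hx⟩
        (weight E Sum.inl fun w => X w.1) *
      wickSum (Fin (Fintype.card I - K.card)) (restrict g Aᶜ (isUnion_compl hA)) ⟨y, hy⟩ ⟨y, hy⟩
        (weight E Sum.inl fun w => X w.1) := by
  let e : {w : W // Sum.inl w ∈ A} ⊕ {w : W // Sum.inl w ∈ Aᶜ} ≃ W :=
    Equiv.sumCompl fun w => Sum.inl w ∈ A
  let f : {b : B // Sum.inr b ∈ A} ⊕ {b : B // Sum.inr b ∈ Aᶜ} ≃ B :=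
    Equiv.sumCompl fun b => Sum.inr b ∈ A
  let k₁ : Fin K.card ≃ {i // i ∈ K} := K.equivFin.symm
  let k₂ : Fin (Fintype.card I - K.card) ≃ {i // i ∉ K} :=
    (Fintype.equivFinOfCardEq (by rw [Fintype.card_subtype_compl, Fintype.card_coe])).symm
  let k : Fin K.card ⊕ Fin (Fintype.card I - K.card) ≃ I :=
    (Equiv.sumCongr k₁ k₂).trans (Equiv.sumCompl fun i => i ∈ K)
  have h₁ : ∀ c w, g c (e (Sum.inl w)) = f (Sum.inl (restrict g A hA c w)) := fun c w => rfl
  have h₂ : ∀ c w, g c (e (Sum.inr w)) =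
      f (Sum.inr (restrict g Aᶜ (isUnion_compl hA) c w)) := fun c w => rfl
  refine Eq.trans ?_ (sum_isLeft_eq_mul (E := E) e f k h₁ h₂ X ⟨x, hx⟩ ⟨y, hy⟩)
  refine Finset.sum_congr (by ext; simp) fun a _ => Finset.sum_congr (by ext; simp) fun τ _ =>
    if_congr (and_congr_left' ?_) rfl rfl
  have s₁ : ∀ p, (slotSum e k p ∈ slotsIn (Sum.inl ⁻¹' A) (K : Set I)) ↔ p.isLeft = true := by
    rintro ((w | v) | (w | v))
    · exact iff_of_true w.2 rfl
    · exact iff_of_true (k₁ v.1).2 rfl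
    · exact iff_of_false w.2 Bool.false_ne_true
    · exact iff_of_false (k₂ v.1).2 Bool.false_ne_true
  have s₂ : ∀ p, (slotSum f k p ∈ slotsIn (Sum.inr ⁻¹' A) (K : Set I)) ↔ p.isLeft = true := by
    rintro ((w | v) | (w | v))
    · exact iff_of_true w.2 rfl
    · exact iff_of_true (k₁ v.1).2 rfl
    · exact iff_of_false w.2 Bool.false_ne_true
    · exact iff_of_false (k₂ v.1).2 Bool.false_ne_true
  rw [IsBlock, and_iff_right hA, ← (slotSum e k).forall_congr_right]
  refine forall_congr' fun p => ?_
  rw [s₁, ← (slotSum f k).apply_symm_apply (τ (slotSum e k p)), s₂, Equiv.symm_apply_apply]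
  exact Bool.eq_iff_iff.symm

open Classical in
-- A contraction that is linked but not connected has exactly one block `(A, K)` with `x` and
-- without `y`, while a connected one has none.
theorem wickSum_eq_add [Fintype W] [Fintype B] [Fintype I] [Fintype M] (hD : 2 ≤ D)
    (E : (Fin D → M) → ℝ) (g : ColouredGraph D W B) (X : W → Fin D → M) {x y : W} :
    wickSum I g x y (weight E Sum.inl X) = wickSum I g x x (weight E Sum.inl X) +
      ∑ A : Set (W ⊕ B), if h : IsUnion g A ∧ Sum.inl x ∈ A ∧ Sum.inl y ∉ A then
        ∑ K : Finset I, wickSum (Fin K.card) (restrict g A h.1) ⟨x, h.2.1⟩ ⟨x, h.2.1⟩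
          (weight E Sum.inl fun w => X w.1) *
        wickSum (Fin (Fintype.card I - K.card)) (restrict g Aᶜ (isUnion_compl h.1))
          ⟨y, h.2.2⟩ ⟨y, h.2.2⟩ (weight E Sum.inl fun w => X w.1)
      else 0 := by
  have hF : ∀ (A : Set (W ⊕ B)), (if h : IsUnion g A ∧ Sum.inl x ∈ A ∧ Sum.inl y ∉ A then
        ∑ K : Finset I, wickSum (Fin K.card) (restrict g A h.1) ⟨x, h.2.1⟩ ⟨x, h.2.1⟩
          (weight E Sum.inl fun w => X w.1) *
        wickSum (Fin (Fintype.card I - K.card)) (restrict g Aᶜ (isUnion_compl h.1))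
          ⟨y, h.2.2⟩ ⟨y, h.2.2⟩ (weight E Sum.inl fun w => X w.1)
      else 0) = ∑ a : I → Fin D, ∑ τ : W ⊕ (I × Bool) ≃ B ⊕ (I × Bool), ∑ K : Finset I,
        if (Sum.inl x ∈ A ∧ Sum.inl y ∉ A) ∧ IsBlock g τ A K ∧
          (∀ c, Separates Sum.inl (closing g a τ c)) ∧
          Linked (closing g a τ) (Sum.inl x) (Sum.inl y) then
        weight E Sum.inl X (closing g a τ) else 0 := by
    intro A
    by_cases h : IsUnion g A ∧ Sum.inl x ∈ A ∧ Sum.inl y ∉ A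
    · rw [dif_pos h]
      have h1 : ∀ a : I → Fin D, (∑ τ : W ⊕ (I × Bool) ≃ B ⊕ (I × Bool), ∑ K : Finset I,
          if (Sum.inl x ∈ A ∧ Sum.inl y ∉ A) ∧ IsBlock g τ A K ∧
            (∀ c, Separates Sum.inl (closing g a τ c)) ∧
            Linked (closing g a τ) (Sum.inl x) (Sum.inl y) then
          weight E Sum.inl X (closing g a τ) else 0) =
          ∑ K : Finset I, ∑ τ : W ⊕ (I × Bool) ≃ B ⊕ (I × Bool),
          if IsBlock g τ A K ∧ (∀ c, Separates Sum.inl (closing g a τ c)) ∧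
            Linked (closing g a τ) (Sum.inl x) (Sum.inl y) then
          weight E Sum.inl X (closing g a τ) else 0 := by
        intro a
        rw [Finset.sum_comm]
        exact Finset.sum_congr rfl fun K _ => Finset.sum_congr rfl fun τ _ =>
          if_congr (and_iff_right h.2) rfl rfl
      simp only [h1]
      rw [Finset.sum_comm]
      refine Finset.sum_congr rfl fun K _ => ?_
      rw [← sum_isBlock_eq_mul E X h.1 h.2.1 h.2.2 K]
    · rw [dif_neg h]
      symm
      refine Finset.sum_eq_zero fun a _ => Finset.sum_eq_zero fun τ _ =>
        Finset.sum_eq_zero fun K _ => if_neg fun h' => h ⟨h'.2.1.1, h'.1⟩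
  simp only [hF]
  rw [Finset.sum_comm]
  unfold wickSum
  rw [← Finset.sum_add_distrib]
  refine Finset.sum_congr (by ext; simp) fun a _ => ?_
  rw [Finset.sum_comm, ← Finset.sum_add_distrib]
  refine Finset.sum_congr (by ext; simp) fun τ _ => ?_
  rw [← Fintype.sum_prod_type']
  by_cases hs : ∀ c, Separates Sum.inl (closing g a τ c)
  swap
  · rw [if_neg fun h => hs h.1, if_neg fun h => hs h.1, Finset.sum_eq_zero, add_zero]
    exact fun t _ => if_neg fun h => hs h.2.2.1
  by_cases hl : Linked (closing g a τ) (Sum.inl x) (Sum.inl y)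
  swap
  · rw [if_neg fun h => hl h.2, if_neg fun h : _ ∧ _ => hl (h.2.of_self _ _),
      Finset.sum_eq_zero, add_zero]
    exact fun t _ => if_neg fun h => hl h.2.2.2
  rw [if_pos ⟨hs, hl⟩]
  by_cases hxx : Linked (closing g a τ) (Sum.inl x) (Sum.inl x)
  · rw [if_pos ⟨hs, hxx⟩, Finset.sum_eq_zero, add_zero]
    exact fun t _ => if_neg fun h => not_linked_of_isBlock h.2.1 h.1.1 h.1.2 hxx
  · rw [if_neg fun h : _ ∧ _ => hxx h.2, zero_add]
    obtain ⟨A, K, ⟨hb, hx, hy⟩, -⟩ := ((linked_iff_or_isBlock hD).1 hl).resolve_left hxx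
    rw [Finset.sum_eq_single (A, K.toFinset)]
    · rw [if_pos]
      exact ⟨⟨hx, hy⟩, by simpa using hb, hs, hl⟩
    · rintro ⟨A', K'⟩ _ hne
      refine if_neg fun h => hne ?_
      obtain ⟨h1, h2⟩ := isBlock_unique h.2.1 h.1.1 h.1.2 hb hx hy hl
      refine Prod.ext h1 (Finset.coe_injective ?_)
      simpa using h2
    · simp

theorem corrOn_eq [Fintype W] [Fintype B] [Fintype M] (E : (Fin D → M) → ℝ)
    (g : ColouredGraph D W B) (X : W → Fin D → M) {A : Set (W ⊕ B)} (h : IsUnion g A)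
    {i : Fintype {w : W // Sum.inl w ∈ A}} {i' : Fintype {b : B // Sum.inr b ∈ A}} :
    corrOn E g A X = corr E (restrict g A h) (fun w => X w.1) := by
  classical
  rw [corrOn, dif_pos h]
  have h1 : i = Subtype.fintype _ := Subsingleton.elim _ _
  have h2 : i' = Subtype.fintype _ := Subsingleton.elim _ _
  rw [h1, h2]

theorem corrOn_eq_linkedCorr [Fintype W] [Fintype B] [Fintype M] (hD : 2 ≤ D)
    (E : (Fin D → M) → ℝ) (g : ColouredGraph D W B) (X : W → Fin D → M) {A : Set (W ⊕ B)}
    (h : IsUnion g A) {x : W} (hx : Sum.inl x ∈ A) [Fintype {w : W // Sum.inl w ∈ A}]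
    [Fintype {b : B // Sum.inr b ∈ A}] :
    corrOn E g A X = linkedCorr E (restrict g A h) ⟨x, hx⟩ ⟨x, hx⟩ fun w => X w.1 := by
  rw [corrOn_eq E g X h, coeff_corr hD]

open Classical in
/-- The correlation function of Feynman graphs that become connected when `x` and `y` are joined is
the sum of the connected one and of all products of a connected function of a union of components
containing `x` with that of the other components, which contain `y`. -/
theorem linkedCorr_eq_add [Fintype W] [Fintype B] [Fintype M] (hD : 2 ≤ D)
    (E : (Fin D → M) → ℝ) (g : ColouredGraph D W B) (X : W → Fin D → M) (x y : W) :
    linkedCorr E g x y X = corr E g X + ∑ A : Set (W ⊕ B),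
      if IsUnion g A ∧ Sum.inl x ∈ A ∧ Sum.inl y ∉ A then
        corrOn E g A X * corrOn E g Aᶜ X else 0 := by
  rw [coeff_corr hD E g X x]
  ext n
  rw [map_add, linkedCorr, linkedCorr, PowerSeries.coeff_mk, PowerSeries.coeff_mk,
    wickSum_eq_add hD, mul_add, map_sum, Finset.mul_sum]
  refine congrArg (fun r : ℝ => (-1 : ℝ) ^ n / (n ! : ℝ) *
    wickSum (Fin n) g x x (weight E Sum.inl X) + r) (Finset.sum_congr rfl fun A _ => ?_)
  by_cases h : IsUnion g A ∧ Sum.inl x ∈ A ∧ Sum.inl y ∉ A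
  swap
  · rw [dif_neg h, if_neg h, mul_zero, map_zero]
  rw [dif_pos h, if_pos h, corrOn_eq_linkedCorr hD E g X h.1 h.2.1,
    corrOn_eq_linkedCorr hD E g X (isUnion_compl h.1) h.2.2, PowerSeries.coeff_mul]
  simp only [linkedCorr, PowerSeries.coeff_mk]
  set F : ℕ → ℝ := fun m => wickSum (Fin m) (restrict g A h.1) ⟨x, h.2.1⟩ ⟨x, h.2.1⟩
    (weight E Sum.inl fun w => X w.1)
  set G : ℕ → ℝ := fun m => wickSum (Fin m) (restrict g Aᶜ (isUnion_compl h.1))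
    ⟨y, h.2.2⟩ ⟨y, h.2.2⟩ (weight E Sum.inl fun w => X w.1)
  change (-1 : ℝ) ^ n / (n ! : ℝ) * ∑ K : Finset (Fin n), F K.card *
    G (Fintype.card (Fin n) - K.card) = ∑ p ∈ Finset.HasAntidiagonal.antidiagonal n,
      (-1 : ℝ) ^ p.1 / (p.1 ! : ℝ) * F p.1 * ((-1 : ℝ) ^ p.2 / (p.2 ! : ℝ) * G p.2)
  -- The number of sets `K` of size `m` is a binomial coefficient. It turns `1/n!` into `1/(m!
  -- (n-m)!)`, and the sum becomes the coefficient of a product of power series.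
  have h1 : ∑ K : Finset (Fin n), F K.card * G (Fintype.card (Fin n) - K.card) =
      ∑ m ∈ Finset.range (n + 1), n.choose m • (F m * G (n - m)) := by
    have := Finset.sum_powerset_apply_card (fun m => F m * G (n - m))
      (x := (Finset.univ : Finset (Fin n)))
    rw [Finset.powerset_univ, Finset.card_univ, Fintype.card_fin] at this
    rw [Fintype.card_fin, ← this]
  rw [h1, Finset.Nat.sum_antidiagonal_eq_sum_range_succ
    (fun i j => (-1 : ℝ) ^ i / (i ! : ℝ) * F i * ((-1 : ℝ) ^ j / (j ! : ℝ) * G j)),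
    Finset.mul_sum]
  refine Finset.sum_congr rfl fun m hm => ?_
  have hm' : m ≤ n := Nat.lt_succ_iff.1 (Finset.mem_range.1 hm)
  have hc : ((n.choose m : ℕ) : ℝ) * (m ! : ℝ) * ((n - m)! : ℝ) = (n ! : ℝ) := by
    exact_mod_cast Nat.choose_mul_factorial_mul_factorial hm'
  have hp : (-1 : ℝ) ^ n = (-1) ^ m * (-1) ^ (n - m) := by rw [← pow_add, Nat.add_sub_cancel' hm']
  have f1 : (m ! : ℝ) ≠ 0 := by exact_mod_cast m.factorial_ne_zero
  have f2 : ((n - m)! : ℝ) ≠ 0 := by exact_mod_cast (n - m).factorial_ne_zero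
  have f3 : (n ! : ℝ) ≠ 0 := by exact_mod_cast n.factorial_ne_zero
  rw [nsmul_eq_mul, hp]
  field_simp
  rw [← hc]
  ring

end TwoComponents

/-! ### Automorphisms and splittings -/

section Glue

variable {V : Type*} {p r p' r' : V → Prop}

open Classical in
/-- Two bijections between disjoint subtypes, extended by the identity. -/
noncomputable def glueFun (p r p' r' : V → Prop) (σ₁ : {v // p v} → {v // p' v})
    (σ₂ : {v // r v} → {v // r' v}) (v : V) : V :=
  if h : p v then σ₁ ⟨v, h⟩ else if h : r v then σ₂ ⟨v, h⟩ else v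

theorem glueFun_left {σ₁ : {v // p v} → {v // p' v}} {σ₂ : {v // r v} → {v // r' v}} {v : V}
    (h : p v) : glueFun p r p' r' σ₁ σ₂ v = σ₁ ⟨v, h⟩ := dif_pos h

theorem glueFun_right {σ₁ : {v // p v} → {v // p' v}} {σ₂ : {v // r v} → {v // r' v}} {v : V}
    (hp : ¬ p v) (h : r v) : glueFun p r p' r' σ₁ σ₂ v = σ₂ ⟨v, h⟩ := by
  rw [glueFun, dif_neg hp, dif_pos h]

theorem glueFun_of_not {σ₁ : {v // p v} → {v // p' v}} {σ₂ : {v // r v} → {v // r' v}} {v : V}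
    (hp : ¬ p v) (h : ¬ r v) : glueFun p r p' r' σ₁ σ₂ v = v := by
  rw [glueFun, dif_neg hp, dif_neg h]

theorem glueFun_glueFun (hd' : ∀ v, r' v → ¬ p' v)
    (hu : ∀ v, p v ∨ r v ↔ p' v ∨ r' v) (σ₁ : {v // p v} ≃ {v // p' v})
    (σ₂ : {v // r v} ≃ {v // r' v}) (v : V) :
    glueFun p' r' p r σ₁.symm σ₂.symm (glueFun p r p' r' σ₁ σ₂ v) = v := by
  by_cases hp : p v
  · rw [glueFun_left hp, glueFun_left (σ₁ ⟨v, hp⟩).2, Subtype.coe_eta, Equiv.symm_apply_apply]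
  by_cases hr : r v
  · rw [glueFun_right hp hr, glueFun_right (hd' _ (σ₂ ⟨v, hr⟩).2) (σ₂ ⟨v, hr⟩).2,
      Subtype.coe_eta, Equiv.symm_apply_apply]
  · have h := not_or.1 (mt (hu v).2 (not_or.2 ⟨hp, hr⟩))
    rw [glueFun_of_not hp hr, glueFun_of_not h.1 h.2]

/-- Two bijections between disjoint subtypes, extended by the identity to a permutation. -/
noncomputable def glue (hd : ∀ v, r v → ¬ p v) (hd' : ∀ v, r' v → ¬ p' v)
    (hu : ∀ v, p v ∨ r v ↔ p' v ∨ r' v) (σ₁ : {v // p v} ≃ {v // p' v})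
    (σ₂ : {v // r v} ≃ {v // r' v}) : Perm V where
  toFun := glueFun p r p' r' σ₁ σ₂
  invFun := glueFun p' r' p r σ₁.symm σ₂.symm
  left_inv := glueFun_glueFun hd' hu σ₁ σ₂
  right_inv := glueFun_glueFun hd (fun v => (hu v).symm) σ₁.symm σ₂.symm

end Glue

/-! ### Counting the automorphisms that carry one splitting to another. -/

section Orbits

variable {D : ℕ} {W W' B B' : Type*}

/-- The isomorphisms from `g` to `g'`. -/
def Isos (g : ColouredGraph D W B) (g' : ColouredGraph D W' B') :=
  {t : (W ≃ W') × (B ≃ B') // ∀ c w, g' c (t.1 w) = t.2 (g c w)}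

/-- Composition with one fixed isomorphism identifies the isomorphisms with the automorphisms. -/
theorem card_isos {g : ColouredGraph D W B} {g' : ColouredGraph D W' B'} (h : Iso g g') :
    Nat.card (Isos g g') = Nat.card (Aut g') := by
  obtain ⟨σ, π, h⟩ := h
  have h' : ∀ c w, π.symm (g' c w) = g c (σ.symm w) := by
    intro c w
    rw [Equiv.symm_apply_eq, ← h, Equiv.apply_symm_apply]
  refine Nat.card_congr ⟨fun t => ⟨(σ.symm.trans t.1.1, π.symm.trans t.1.2), fun c w => ?_⟩,
    fun t => ⟨(σ.trans t.1.1, π.trans t.1.2), fun c w => ?_⟩, fun t => ?_, fun t => ?_⟩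
  · change g' c (t.1.1 (σ.symm w)) = t.1.2 (π.symm (g' c w))
    rw [h', t.2]
  · change g' c (t.1.1 (σ w)) = t.1.2 (π (g c w))
    rw [← h]
    exact t.2 c (σ w)
  · refine Subtype.ext (Prod.ext (Equiv.ext fun _ => ?_) (Equiv.ext fun _ => ?_)) <;> simp
  · refine Subtype.ext (Prod.ext (Equiv.ext fun _ => ?_) (Equiv.ext fun _ => ?_)) <;> simp

theorem isEmpty_isos {g : ColouredGraph D W B} {g' : ColouredGraph D W' B'} (h : ¬ Iso g g') :
    IsEmpty (Isos g g') := ⟨fun t => h ⟨t.1.1, t.1.2, t.2⟩⟩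

variable {g : ColouredGraph D W B} {Q : Set (W ⊕ B)}

/-- The preimage of a set of vertices under an automorphism. -/
def pullback (Ω : Perm W × Perm B) (S : Set (W ⊕ B)) : Set (W ⊕ B) :=
  {u | Sum.map Ω.1 Ω.2 u ∈ S}

theorem pullback_eq_self {Ω : Perm W × Perm B} {S : Set (W ⊕ B)} (h : Ω ∈ AutOn g S) :
    pullback Ω S = S := by
  ext (w | b)
  · change Sum.inl (Ω.1 w) ∈ S ↔ _
    by_cases hw : Sum.inl w ∈ S
    · refine iff_of_true ?_ hw
      by_contra h'
      exact h' (by rwa [Ω.1.injective (h.2.1 _ h')])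
    · rw [h.2.1 w hw]
  · change Sum.inr (Ω.2 b) ∈ S ↔ _
    by_cases hb : Sum.inr b ∈ S
    · refine iff_of_true ?_ hb
      by_contra h'
      exact h' (by rwa [Ω.2.injective (h.2.2 _ h')])
    · rw [h.2.2 b hb]

theorem pullback_of_disjoint {Ω : Perm W × Perm B} {S T : Set (W ⊕ B)} (h : Ω ∈ AutOn g S)
    (hd : Disjoint T S) : pullback Ω T = T := by
  have h0 : ∀ u, u ∉ S → Sum.map Ω.1 Ω.2 u = u := by
    rintro (w | b) hu
    · exact congrArg Sum.inl (h.2.1 w hu)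
    · exact congrArg Sum.inr (h.2.2 b hu)
  ext u
  change Sum.map Ω.1 Ω.2 u ∈ T ↔ _
  by_cases hu : u ∈ S
  · have h1 : Sum.map Ω.1 Ω.2 u ∈ S := by
      have := pullback_eq_self h
      rw [← this] at hu
      exact hu
    exact iff_of_false (fun h => hd.notMem_of_mem_left h h1) fun h => hd.notMem_of_mem_left h hu
  · rw [h0 u hu]

theorem pullback_union (Ω : Perm W × Perm B) (S T : Set (W ⊕ B)) :
    pullback Ω (S ∪ T) = pullback Ω S ∪ pullback Ω T := rfl

theorem isUnion_pullback {Ω : Perm W × Perm B} (h : Ω ∈ Aut g) {S : Set (W ⊕ B)}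
    (hS : IsUnion g S) : IsUnion g (pullback Ω S) := fun c w => by
  change Sum.inl (Ω.1 w) ∈ S ↔ Sum.inr (Ω.2 (g c w)) ∈ S
  rw [hS c, h c w]

/-- The action of automorphisms on splittings. -/
def Splitting.pullback (P : Splitting g Q) (Ω : AutOn g Q) : Splitting g Q where
  left := TFT.pullback Ω P.left
  right := TFT.pullback Ω P.right
  isUnion_left := isUnion_pullback Ω.2.1 P.isUnion_left
  isUnion_right := isUnion_pullback Ω.2.1 P.isUnion_right
  disjoint := Disjoint.preimage _ P.disjoint
  union_eq := by rw [← pullback_union, P.union_eq, pullback_eq_self Ω.2]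

theorem Splitting.ext_left_right {P P' : Splitting g Q} (h : P.left = P'.left)
    (h' : P.right = P'.right) : P = P' := by
  cases P; cases P'; cases h; cases h'; rfl

/-- The automorphisms that map one splitting to another are pairs of isomorphisms. -/
noncomputable def glueIsos (P P' : Splitting g Q)
    (t : Isos (restrict g P.left P.isUnion_left) (restrict g P'.left P'.isUnion_left) ×
      Isos (restrict g P.right P.isUnion_right) (restrict g P'.right P'.isUnion_right)) :
    Perm W × Perm B :=
  (glue (fun _ h h' => P.disjoint.notMem_of_mem_left h' h)
    (fun _ h h' => P'.disjoint.notMem_of_mem_left h' h)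
    (fun _ => Set.ext_iff.1 (P.union_eq.trans P'.union_eq.symm) _)
    t.1.1.1 t.2.1.1,
   glue (fun _ h h' => P.disjoint.notMem_of_mem_left h' h)
    (fun _ h h' => P'.disjoint.notMem_of_mem_left h' h)
    (fun _ => Set.ext_iff.1 (P.union_eq.trans P'.union_eq.symm) _)
    t.1.1.2 t.2.1.2)

section GlueIsos

variable {P P' : Splitting g Q}
    {t : Isos (restrict g P.left P.isUnion_left) (restrict g P'.left P'.isUnion_left) ×
      Isos (restrict g P.right P.isUnion_right) (restrict g P'.right P'.isUnion_right)}

theorem glueIsos_fst_left {w : W} (h : Sum.inl w ∈ P.left) :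
    (glueIsos P P' t).1 w = t.1.1.1 ⟨w, h⟩ :=
  glueFun_left (p := fun w => Sum.inl w ∈ P.left) (r := fun w => Sum.inl w ∈ P.right) h

theorem glueIsos_snd_left {b : B} (h : Sum.inr b ∈ P.left) :
    (glueIsos P P' t).2 b = t.1.1.2 ⟨b, h⟩ :=
  glueFun_left (p := fun b => Sum.inr b ∈ P.left) (r := fun b => Sum.inr b ∈ P.right) h

theorem glueIsos_fst_right {w : W} (h : Sum.inl w ∈ P.right) :
    (glueIsos P P' t).1 w = t.2.1.1 ⟨w, h⟩ :=
  glueFun_right (p := fun w => Sum.inl w ∈ P.left) (r := fun w => Sum.inl w ∈ P.right) (fun h' => P.disjoint.notMem_of_mem_left h' h) h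

theorem glueIsos_snd_right {b : B} (h : Sum.inr b ∈ P.right) :
    (glueIsos P P' t).2 b = t.2.1.2 ⟨b, h⟩ :=
  glueFun_right (p := fun b => Sum.inr b ∈ P.left) (r := fun b => Sum.inr b ∈ P.right) (fun h' => P.disjoint.notMem_of_mem_left h' h) h

theorem glueIsos_fst_of_not {w : W} (h : Sum.inl w ∉ Q) : (glueIsos P P' t).1 w = w := by
  rw [← P.union_eq, Set.mem_union, not_or] at h
  exact glueFun_of_not (p := fun w => Sum.inl w ∈ P.left) (r := fun w => Sum.inl w ∈ P.right) h.1 h.2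

theorem glueIsos_snd_of_not {b : B} (h : Sum.inr b ∉ Q) : (glueIsos P P' t).2 b = b := by
  rw [← P.union_eq, Set.mem_union, not_or] at h
  exact glueFun_of_not (p := fun b => Sum.inr b ∈ P.left) (r := fun b => Sum.inr b ∈ P.right) h.1 h.2

theorem glueIsos_mem_left {u : W ⊕ B} (h : u ∈ P.left) :
    Sum.map (glueIsos P P' t).1 (glueIsos P P' t).2 u ∈ P'.left := by
  rcases u with w | b
  · rw [Sum.map_inl, glueIsos_fst_left h]; exact (t.1.1.1 ⟨w, h⟩).2
  · rw [Sum.map_inr, glueIsos_snd_left h]; exact (t.1.1.2 ⟨b, h⟩).2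

theorem glueIsos_mem_right {u : W ⊕ B} (h : u ∈ P.right) :
    Sum.map (glueIsos P P' t).1 (glueIsos P P' t).2 u ∈ P'.right := by
  rcases u with w | b
  · rw [Sum.map_inl, glueIsos_fst_right h]; exact (t.2.1.1 ⟨w, h⟩).2
  · rw [Sum.map_inr, glueIsos_snd_right h]; exact (t.2.1.2 ⟨b, h⟩).2

theorem glueIsos_of_not {u : W ⊕ B} (h : u ∉ Q) :
    Sum.map (glueIsos P P' t).1 (glueIsos P P' t).2 u = u := by
  rcases u with w | b
  · rw [Sum.map_inl, glueIsos_fst_of_not h]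
  · rw [Sum.map_inr, glueIsos_snd_of_not h]

theorem Splitting.mem_cases (P : Splitting g Q) (u : W ⊕ B) :
    u ∈ P.left ∨ u ∈ P.right ∨ u ∉ Q := by
  rw [← or_assoc, ← Set.mem_union, P.union_eq]
  exact em _

theorem glueIsos_mem_autOn : glueIsos P P' t ∈ AutOn g Q := by
  refine ⟨fun c w => ?_, fun w h => glueIsos_fst_of_not h, fun b h => glueIsos_snd_of_not h⟩
  rcases P.mem_cases (Sum.inl w) with h | h | h
  · have h' := (P.isUnion_left c w).1 h
    rw [glueIsos_fst_left h, glueIsos_snd_left h']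
    exact congrArg Subtype.val (t.1.2 c ⟨w, h⟩)
  · have h' := (P.isUnion_right c w).1 h
    rw [glueIsos_fst_right h, glueIsos_snd_right h']
    exact congrArg Subtype.val (t.2.2 c ⟨w, h⟩)
  · have h' : Sum.inr (g c w) ∉ Q := by
      rw [← P.union_eq, Set.mem_union, not_or] at h ⊢
      exact ⟨mt (P.isUnion_left c w).2 h.1, mt (P.isUnion_right c w).2 h.2⟩
    rw [glueIsos_fst_of_not h, glueIsos_snd_of_not h']

theorem pullback_glueIsos :
    P'.pullback ⟨glueIsos P P' t, glueIsos_mem_autOn⟩ = P := by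
  refine Splitting.ext_left_right (Set.ext fun u => ?_) (Set.ext fun u => ?_)
  · change Sum.map (glueIsos P P' t).1 (glueIsos P P' t).2 u ∈ P'.left ↔ _
    refine ⟨fun h => ?_, glueIsos_mem_left⟩
    rcases P.mem_cases u with hu | hu | hu
    · exact hu
    · exact absurd (glueIsos_mem_right hu) (P'.disjoint.notMem_of_mem_left h)
    · rw [glueIsos_of_not hu] at h
      exact absurd (P'.union_eq ▸ Or.inl h) hu
  · change Sum.map (glueIsos P P' t).1 (glueIsos P P' t).2 u ∈ P'.right ↔ _
    refine ⟨fun h => ?_, glueIsos_mem_right⟩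
    rcases P.mem_cases u with hu | hu | hu
    · exact absurd h (P'.disjoint.notMem_of_mem_left (glueIsos_mem_left hu))
    · exact hu
    · rw [glueIsos_of_not hu] at h
      exact absurd (P'.union_eq ▸ Or.inr h) hu

end GlueIsos

/-- An automorphism of `Q` that carries `P` to `P'` restricts to isomorphisms of both parts;
conversely any two such isomorphisms, extended by the identity outside `Q`, glue to an automorphism.
-/
theorem card_pullback_eq (P P' : Splitting g Q) :
    Nat.card {Ω : AutOn g Q // P'.pullback Ω = P} =
      Nat.card (Isos (restrict g P.left P.isUnion_left) (restrict g P'.left P'.isUnion_left)) *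
      Nat.card (Isos (restrict g P.right P.isUnion_right)
        (restrict g P'.right P'.isUnion_right)) := by
  rw [← Nat.card_prod]
  symm
  refine Nat.card_eq_of_bijective
    (fun t => ⟨⟨glueIsos P P' t, glueIsos_mem_autOn⟩, pullback_glueIsos⟩) ⟨?_, ?_⟩
  · intro t t' h
    have h' : glueIsos P P' t = glueIsos P P' t' := congrArg (fun Ω => Ω.1.1) h
    have h1 := fun w => congrArg (fun Ω : Perm W × Perm B => Ω.1 w) h'
    have h2 := fun b => congrArg (fun Ω : Perm W × Perm B => Ω.2 b) h'
    refine Prod.ext (Subtype.ext (Prod.ext (Equiv.ext ?_) (Equiv.ext ?_)))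
      (Subtype.ext (Prod.ext (Equiv.ext ?_) (Equiv.ext ?_)))
    · rintro ⟨w, hw⟩
      have := h1 w
      simp only [glueIsos_fst_left hw] at this
      exact Subtype.ext this
    · rintro ⟨b, hb⟩
      have := h2 b
      simp only [glueIsos_snd_left hb] at this
      exact Subtype.ext this
    · rintro ⟨w, hw⟩
      have := h1 w
      simp only [glueIsos_fst_right hw] at this
      exact Subtype.ext this
    · rintro ⟨b, hb⟩
      have := h2 b
      simp only [glueIsos_snd_right hb] at this
      exact Subtype.ext this
  · rintro ⟨⟨Ω, hΩ⟩, rfl⟩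
    refine ⟨(⟨(Ω.1.subtypeEquiv fun _ => Iff.rfl, Ω.2.subtypeEquiv fun _ => Iff.rfl),
      fun c w => Subtype.ext (hΩ.1 c w.1)⟩,
      ⟨(Ω.1.subtypeEquiv fun _ => Iff.rfl, Ω.2.subtypeEquiv fun _ => Iff.rfl),
      fun c w => Subtype.ext (hΩ.1 c w.1)⟩), Subtype.ext (Subtype.ext (Prod.ext ?_ ?_))⟩
    · refine Equiv.ext fun w => ?_
      rcases (P'.pullback ⟨Ω, hΩ⟩).mem_cases (Sum.inl w) with h | h | h
      · exact glueIsos_fst_left h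
      · exact glueIsos_fst_right h
      · exact (glueIsos_fst_of_not h).trans (hΩ.2.1 w h).symm
    · refine Equiv.ext fun b => ?_
      rcases (P'.pullback ⟨Ω, hΩ⟩).mem_cases (Sum.inr b) with h | h | h
      · exact glueIsos_snd_left h
      · exact glueIsos_snd_right h
      · exact (glueIsos_snd_of_not h).trans (hΩ.2.2 b h).symm

theorem card_aut_restrict {S : Set (W ⊕ B)} (hS : IsUnion g S) :
    Nat.card (Aut (restrict g S hS)) = Nat.card (AutOn g S) := by
  -- For the splitting with empty second part the count contains all of `AutOn g S` on one side and
  -- the automorphisms of the restricted graph on the other.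
  let P : Splitting g S := ⟨S, ∅, hS, fun _ _ => Iff.rfl, by simp, by simp⟩
  have h := card_pullback_eq P P
  have h1 : Nat.card (Isos (restrict g P.right P.isUnion_right)
      (restrict g P.right P.isUnion_right)) = 1 := by
    have e1 : IsEmpty {w : W // Sum.inl w ∈ P.right} := ⟨fun w => w.2⟩
    have e2 : IsEmpty {b : B // Sum.inr b ∈ P.right} := ⟨fun b => b.2⟩
    rw [Nat.card_eq_one_iff_unique]
    exact ⟨⟨fun t t' => Subtype.ext (Subsingleton.elim _ _)⟩, ⟨⟨(1, 1), fun _ _ => rfl⟩⟩⟩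
  rw [h1, mul_one, card_isos (Iso.refl _)] at h
  refine h.symm.trans (Nat.card_congr (Equiv.subtypeUnivEquiv fun Ω => ?_))
  refine Splitting.ext_left_right (pullback_eq_self Ω.2) rfl

theorem autOn_univ (g : ColouredGraph D W B) : AutOn g Set.univ = Aut g := by
  ext Ω
  simp [AutOn]

theorem finite_splitting [Finite W] [Finite B] : Finite (Splitting g Q) :=
  Finite.of_injective (fun P : Splitting g Q => (P.left, P.right)) fun _ _ h =>
    Splitting.ext_left_right (congrArg Prod.fst h) (congrArg Prod.snd h)

/-- The pair of graphs of a splitting. -/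
def Splitting.factors (P : Splitting g Q) : FactorPairs g Q := Quotient.mk _ P

theorem FactorPairs.equiv_place {P : Splitting g Q} {q : FactorPairs g Q} :
    (splittingSetoid g Q).r P q.place ↔ P.factors = q :=
  Quotient.mk_eq_iff_out.symm

open Classical in
/-- The sum over the pairs of graphs `(C, 𝓑)` and over automorphisms is a sum over all splittings. -/
theorem sum_factorPairs [Fintype W] [Fintype B] {R : Type*} [AddCommGroup R] [Module ℝ R]
    (Φ : Splitting g Q → R) [Fintype (Splitting g Q)] :
    ∑ q : FactorPairs g Q, ∑ Ω : AutOn g Q,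
      (1 / ((Nat.card (AutOn g q.place.left) : ℝ) * (Nat.card (AutOn g q.place.right) : ℝ))) •
        Φ (q.place.pullback Ω) = ∑ P, Φ P := by
  have h1 : ∀ q : FactorPairs g Q, ∑ Ω : AutOn g Q,
      (1 / ((Nat.card (AutOn g q.place.left) : ℝ) * (Nat.card (AutOn g q.place.right) : ℝ))) •
        Φ (q.place.pullback Ω) = ∑ P, if P.factors = q then Φ P
        else 0 := by
    intro q
    rw [← Finset.smul_sum, ← Finset.sum_fiberwise' Finset.univ (fun Ω => q.place.pullback Ω) Φ,
      Finset.smul_sum]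
    refine Finset.sum_congr rfl fun P _ => ?_
    rw [Finset.sum_const]
    have hc : (Finset.univ.filter fun Ω : AutOn g Q => q.place.pullback Ω = P).card =
        Nat.card {Ω : AutOn g Q // q.place.pullback Ω = P} := by
      rw [Nat.card_eq_fintype_card, Fintype.card_subtype]
    rw [hc, card_pullback_eq]
    -- If `P` has the isomorphism type `q`, the number of automorphisms cancels the prefactor and
    -- `P` is counted once; otherwise no automorphism leads to `P`.
    by_cases hP : P.factors = q
    · have h := FactorPairs.equiv_place.2 hP
      rw [if_pos hP, card_isos h.1, card_isos h.2, card_aut_restrict, card_aut_restrict,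
        ← Nat.cast_smul_eq_nsmul ℝ, smul_smul, Nat.cast_mul, one_div, inv_mul_cancel₀, one_smul]
      exact_mod_cast mul_ne_zero Nat.card_pos.ne' Nat.card_pos.ne'
    · rw [if_neg hP]
      have h := mt FactorPairs.equiv_place.1 hP
      have h0 : Nat.card (Isos (restrict g P.left P.isUnion_left)
          (restrict g q.place.left q.place.isUnion_left)) *
          Nat.card (Isos (restrict g P.right P.isUnion_right)
          (restrict g q.place.right q.place.isUnion_right)) = 0 := by
        by_cases h' : Iso (restrict g P.left P.isUnion_left)
          (restrict g q.place.left q.place.isUnion_left)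
        · have := isEmpty_isos fun h'' => h ⟨h', h''⟩
          rw [Nat.card_of_isEmpty (α := Isos (restrict g P.right _) _), mul_zero]
        · have := isEmpty_isos h'
          rw [Nat.card_of_isEmpty, zero_mul]
      rw [h0, zero_smul, smul_zero]
  simp only [h1]
  rw [Finset.sum_comm]
  refine Finset.sum_congr rfl fun P _ => ?_
  rw [Finset.sum_ite_eq]
  simp

end Orbits

/-! ### Symmetry of the correlation functions -/

section Symmetry

variable {D : ℕ} {W W' B B' M : Type*}

theorem corrOn_congr (hD : 2 ≤ D) [Fintype W] [Fintype W'] [Fintype B] [Fintype B'] [Fintype M]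
    {E : (Fin D → M) → ℝ} {g : ColouredGraph D W B} {g' : ColouredGraph D W' B'} (e : W ≃ W')
    (f : B ≃ B') (h : ∀ c w, g' c (e w) = f (g c w)) {S : Set (W' ⊕ B')} {X : W → Fin D → M}
    {X' : W' → Fin D → M} (hX : ∀ w, X' (e w) = X w) :
    corrOn E g' S X' = corrOn E g {u | Sum.map e f u ∈ S} X := by
  classical
  have hS : IsUnion g' S ↔ IsUnion g {u | Sum.map e f u ∈ S} := by
    refine forall_congr' fun c => ?_
    rw [← e.forall_congr_right]
    refine forall_congr' fun w => ?_
    rw [h]; rfl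
  by_cases hS' : IsUnion g' S
  · rw [corrOn, corrOn, dif_pos hS', dif_pos (hS.1 hS')]
    exact corr_congr hD (e.subtypeEquiv fun _ => Iff.rfl) (f.subtypeEquiv fun _ => Iff.rfl)
      (fun c w => Subtype.ext (h c w.1)) fun w => hX w.1
  · rw [corrOn, corrOn, dif_neg hS', dif_neg (mt hS.2 hS')]

theorem corrOn_act (hD : 2 ≤ D) [Fintype W] [Fintype B] [Fintype M] {E : (Fin D → M) → ℝ}
    {g : ColouredGraph D W B} {Ω : Perm W × Perm B} (hΩ : Ω ∈ Aut g) (S : Set (W ⊕ B))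
    (X : W → Fin D → M) :
    corrOn E g S (fun w => X (Ω.1⁻¹ w)) = corrOn E g (pullback Ω S) X :=
  corrOn_congr hD Ω.1 Ω.2 hΩ fun w => congrArg X (Equiv.symm_apply_apply Ω.1 w)

/-- An invariant function is reproduced by the sum over the group, since the coefficient contains
the inverse order. -/
theorem graphDeriv_eq_of_act [Fintype W] [Fintype B] {N R : Type*} [AddCommGroup R] [Module ℝ R]
    (g : ColouredGraph D W B) (F : (W → N) → R) (X : W → N)
    (hF : ∀ Ω ∈ Aut g, F (fun w => X (Ω.1⁻¹ w)) = F X) :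
    graphDeriv g (fun X => (1 / (Nat.card (Aut g) : ℝ)) • F X) X = F X := by
  classical
  have h : ∀ Ω : AutOn g Set.univ, act (Ω : Perm W × Perm B)
      (fun X => (1 / (Nat.card (Aut g) : ℝ)) • F X) X = (1 / (Nat.card (Aut g) : ℝ)) • F X :=
    fun Ω => congrArg _ (hF Ω.1 Ω.2.1)
  rw [graphDeriv, autSum, Finset.sum_congr rfl fun Ω _ => h Ω, Finset.sum_const,
    Finset.card_univ, ← Nat.card_eq_fintype_card, autOn_univ, ← Nat.cast_smul_eq_nsmul ℝ,
    smul_smul, one_div, mul_inv_cancel₀, one_smul]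
  exact_mod_cast Nat.card_pos.ne'

theorem graphDeriv_freeEnergyCoeff (hD : 2 ≤ D) [Fintype W] [Fintype B] [Fintype M]
    (E : (Fin D → M) → ℝ) (g : ColouredGraph D W B) (X : W → Fin D → M) :
    graphDeriv g (freeEnergyCoeff E g) X = corr E g X :=
  graphDeriv_eq_of_act g (corr E g) X fun Ω hΩ =>
    corr_congr hD (X := X) (X' := fun w => X (Ω.1⁻¹ w)) Ω.1 Ω.2 hΩ fun w => congrArg X (Equiv.symm_apply_apply Ω.1 w)

open Classical in
/-- The sum of the correlation functions of all graphs obtained by the insertion of an edge of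
colour `c`. -/
noncomputable def insertionSum [Fintype W] [Fintype B] [Fintype M] (E : (Fin D → M) → ℝ)
    (g : ColouredGraph D W B) (c : Fin D) (s : M) (X : W → Fin D → M) : PowerSeries ℝ :=
  ∑ ι : Fin D → Option W, if ι c = none then
    ∑ z : Fin D → M, if z c = s ∧ ∀ d w, ι d = some w → z d = X w d then
      corr E (insertEdge g ι) (fun w => w.elim z X) else 0
  else 0

theorem insertEdge_congr {g : ColouredGraph D W B} {g' : ColouredGraph D W' B'} (e : W ≃ W')
    (f : B ≃ B') (h : ∀ c w, g' c (e w) = f (g c w)) (ι : Fin D → Option W) (c : Fin D)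
    (w : Option W) :
    insertEdge g' (fun d => (ι d).map e) c (Equiv.optionCongr e w) =
      Equiv.optionCongr f (insertEdge g ι c w) := by
  classical
  rcases hc : ι c with _ | v
  · rw [insertEdge_of_none hc, insertEdge_of_none (by simp [hc])]
    rcases w with _ | w
    · rfl
    · exact congrArg some (h c w)
  · rw [insertEdge_of_some hc, insertEdge_of_some (w := e v) (by simp [hc]), Equiv.trans_apply,
      Equiv.trans_apply, h]
    have h1 : Equiv.optionCongr (g' c) (Equiv.optionCongr e w) =
        Equiv.optionCongr f (Equiv.optionCongr (g c) w) := by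
      rcases w with _ | w
      · rfl
      · exact congrArg some (h c w)
    rw [h1]
    have h2 := (Equiv.optionCongr f).injective.map_swap (x := none) (y := some (g c v))
      (z := Equiv.optionCongr (g c) w)
    exact h2.symm

theorem insertionSum_congr (hD : 2 ≤ D) {_ : Fintype W} {_ : Fintype W'} {_ : Fintype B}
    {_ : Fintype B'} [Fintype M] {E : (Fin D → M) → ℝ} {g : ColouredGraph D W B}
    {g' : ColouredGraph D W' B'} (e : W ≃ W')
    (f : B ≃ B') (h : ∀ c w, g' c (e w) = f (g c w)) {X : W → Fin D → M}
    {X' : W' → Fin D → M} (hX : ∀ w, X' (e w) = X w) (c : Fin D) (s : M) :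
    insertionSum E g' c s X' = insertionSum E g c s X := by
  classical
  unfold insertionSum
  rw [← ((Equiv.refl (Fin D)).arrowCongr (Equiv.optionCongr e)).sum_comp]
  refine Finset.sum_congr (by ext; simp) fun ι _ => ?_
  change (if (ι c).map e = none then _ else _) = _
  refine if_congr Option.map_eq_none_iff (Finset.sum_congr (by ext; simp) fun z _ => ?_) rfl
  refine if_congr (and_congr_right' (forall_congr' fun d => ?_)) ?_ rfl
  · rw [← e.forall_congr_right]
    refine forall_congr' fun w => ?_
    rw [hX]
    refine imp_congr_left ?_
    change (ι d).map e = some (e w) ↔ _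
    rw [Option.map_eq_some_iff]
    simp
  · refine corr_congr hD (Equiv.optionCongr e) (Equiv.optionCongr f) (insertEdge_congr e f h ι) ?_
    rintro (_ | w)
    · rfl
    · exact hX w

theorem graphDeriv_yCoeff (hD : 2 ≤ D) [Fintype W] [Fintype B] [Fintype M]
    (E : (Fin D → M) → ℝ) (g : ColouredGraph D W B) (c : Fin D) (s : M) (X : W → Fin D → M) :
    graphDeriv g (yCoeff E g c s) X = insertionSum E g c s X :=
  graphDeriv_eq_of_act g (insertionSum E g c s) X fun Ω hΩ =>
    insertionSum_congr hD (X := X) (X' := fun w => X (Ω.1⁻¹ w)) Ω.1 Ω.2 hΩ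
      (fun w => congrArg X (Equiv.symm_apply_apply Ω.1 w)) c s

open Classical in
/-- The sum over the insertions of an edge into the components in `S`. -/
noncomputable def insertionSumOn [Fintype W] [Fintype B] [Fintype M] (E : (Fin D → M) → ℝ)
    (g : ColouredGraph D W B) (S : Set (W ⊕ B)) (c : Fin D) (s : M) (X : W → Fin D → M) :
    PowerSeries ℝ :=
  if h : IsUnion g S then insertionSum E (restrict g S h) c s (fun w => X w.1) else 0

theorem yCoeffOn_eq [Fintype W] [Fintype B] [Fintype M] (E : (Fin D → M) → ℝ)
    (g : ColouredGraph D W B) (S : Set (W ⊕ B)) (c : Fin D) (s : M) (X : W → Fin D → M) :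
    yCoeffOn E g S c s X =
      (1 / (Nat.card (AutOn g S) : ℝ)) • insertionSumOn E g S c s X := by
  by_cases h : IsUnion g S
  · rw [yCoeffOn, insertionSumOn, dif_pos h, dif_pos h, ← card_aut_restrict h]
    rfl
  · rw [yCoeffOn, insertionSumOn, dif_neg h, dif_neg h, smul_zero]

theorem insertionSumOn_act (hD : 2 ≤ D) [Fintype W] [Fintype B] [Fintype M]
    {E : (Fin D → M) → ℝ} {g : ColouredGraph D W B} {Ω : Perm W × Perm B} (hΩ : Ω ∈ Aut g)
    (S : Set (W ⊕ B)) (c : Fin D) (s : M) (X : W → Fin D → M) :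
    insertionSumOn E g S c s (fun w => X (Ω.1⁻¹ w)) =
      insertionSumOn E g (pullback Ω S) c s X := by
  by_cases h : IsUnion g S
  · rw [insertionSumOn, insertionSumOn, dif_pos h, dif_pos (isUnion_pullback hΩ h)]
    exact insertionSum_congr hD (Ω.1.subtypeEquiv fun _ => Iff.rfl)
      (Ω.2.subtypeEquiv fun _ => Iff.rfl) (fun c w => Subtype.ext (hΩ c w.1))
      (fun w => congrArg X (Equiv.symm_apply_apply Ω.1 w.1)) c s
  · rw [insertionSumOn, insertionSumOn, dif_neg h, dif_neg]
    intro h'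
    refine h ?_
    have h1 := isUnion_pullback (inv_mem hΩ) h'
    have h2 : pullback Ω⁻¹ (pullback Ω S) = S := by
      ext (w | b)
      · change Sum.inl (Ω.1 (Ω.1⁻¹ w)) ∈ S ↔ _
        rw [show Ω.1 (Ω.1⁻¹ w) = w from Equiv.apply_symm_apply _ _]
      · change Sum.inr (Ω.2 (Ω.2⁻¹ b)) ∈ S ↔ _
        rw [show Ω.2 (Ω.2⁻¹ b) = b from Equiv.apply_symm_apply _ _]
    rwa [h2] at h1

open Classical in
theorem sum_splitting [Fintype W] [Fintype B] {R : Type*} [AddCommMonoid R]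
    {g : ColouredGraph D W B} {Q : Set (W ⊕ B)} (hQ : IsUnion g Q)
    (F : Set (W ⊕ B) → Set (W ⊕ B) → R) [Fintype (Splitting g Q)] :
    ∑ P : Splitting g Q, F P.left P.right =
      ∑ L : Set (W ⊕ B), if IsUnion g L ∧ L ⊆ Q then F L (Q \ L) else 0 := by
  rw [← Finset.sum_filter]
  have hright : ∀ P : Splitting g Q, P.right = Q \ P.left := by
    intro P
    refine Eq.trans ?_ (congrArg (· \ P.left) P.union_eq)
    rw [Set.union_sdiff_left, P.disjoint.symm.sdiff_eq_left]
  refine Finset.sum_bij (fun P _ => P.left) ?_ ?_ ?_ ?_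
  · intro P _
    simp only [Finset.mem_filter, Finset.mem_univ, true_and]
    exact ⟨P.isUnion_left, fun u hu => P.union_eq ▸ Or.inl hu⟩
  · intro P _ P' _ h
    exact Splitting.ext_left_right h (by rw [hright, hright, h])
  · intro L hL
    simp only [Finset.mem_filter, Finset.mem_univ, true_and] at hL
    refine ⟨⟨L, Q \ L, hL.1, fun c w => and_congr (hQ c w) (not_congr (hL.1 c w)),
      Set.disjoint_sdiff_right, Set.union_sdiff_cancel hL.2⟩, Finset.mem_univ _, rfl⟩
  · intro P _
    rw [← hright]

theorem edgeSwap_mem_aut {g : ColouredGraph D W B} {c : Fin D} {β τ : B}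
    {Ω : Perm W × Perm B} (hΩ : Ω ∈ Aut g) (hβ : Ω.2 β = β) (hτ : Ω.2 τ = τ) :
    Ω ∈ Aut (edgeSwap g c β τ) := by
  classical
  intro d w
  by_cases hd : d = c
  · subst hd
    rw [edgeSwap_same, Equiv.trans_apply, Equiv.trans_apply, hΩ d w]
    have := Ω.2.injective.map_swap (x := β) (y := τ) (z := g d w)
    rw [hβ, hτ] at this
    exact this.symm
  · rw [edgeSwap_of_ne g hd]
    exact hΩ d w

open Classical in
-- The automorphisms of `Q` fix `β` and `τ`, hence are automorphisms of the swapped graph, and leave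
-- `R'` and `R''` in place. They only move the splitting of `Q`, so every distribution of the
-- components of `Q` is counted once.
theorem sum_autSum_bridgeH (hD : 2 ≤ D) [Fintype W] [Fintype B] [Fintype M]
    (E : (Fin D → M) → ℝ) (g : ColouredGraph D W B) (β : B) (c : Fin D) (τ : B)
    {Q : Set (W ⊕ B)} (hQ : IsUnion g Q) (hβ : Sum.inr β ∉ Q) (hτ : Sum.inr τ ∉ Q)
    (hβ' : Disjoint (component (edgeSwap g c β τ) β) Q)
    (hτ' : Disjoint (component (edgeSwap g c β τ) τ) Q) (X : W → Fin D → M) :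
    ∑ q : FactorPairs g Q, autSum g Q (bridgeH E g β c τ q) X =
      ∑ L : Set (W ⊕ B), if IsUnion g L ∧ L ⊆ Q then
        corrOn E (edgeSwap g c β τ) (component (edgeSwap g c β τ) β ∪ L) X *
        corrOn E (edgeSwap g c β τ) (component (edgeSwap g c β τ) τ ∪ (Q \ L)) X else 0 := by
  have : Finite (Splitting g Q) := finite_splitting
  have : Fintype (Splitting g Q) := Fintype.ofFinite _
  rw [← sum_splitting hQ (fun L R =>
    corrOn E (edgeSwap g c β τ) (component (edgeSwap g c β τ) β ∪ L) X *
    corrOn E (edgeSwap g c β τ) (component (edgeSwap g c β τ) τ ∪ R) X),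
    ← sum_factorPairs]
  refine Finset.sum_congr rfl fun q _ => ?_
  unfold autSum
  refine Finset.sum_congr rfl fun Ω _ => ?_
  have hΩ := edgeSwap_mem_aut (c := c) Ω.2.1 (Ω.2.2.2 β hβ) (Ω.2.2.2 τ hτ)
  rw [act, bridgeH, corrOn_act hD hΩ, corrOn_act hD hΩ, pullback_union, pullback_union,
    pullback_of_disjoint Ω.2 hβ', pullback_of_disjoint Ω.2 hτ']
  rfl

open Classical in
-- The factor `1/|Aut_c(C)|` that is missing in `insertionI` is contained in `𝔣`; with it the same
-- count applies.
theorem sum_autSum_insertionI (hD : 2 ≤ D) [Fintype W] [Fintype B] [Fintype M]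
    (E : (Fin D → M) → ℝ) (g : ColouredGraph D W B) (β : B) (c : Fin D) (s : M)
    {Q : Set (W ⊕ B)} (hQ : IsUnion g Q) (hβ : Disjoint (component g β) Q)
    (X : W → Fin D → M) :
    ∑ q : FactorPairs g Q, autSum g Q (insertionI E g β c s q) X =
      ∑ L : Set (W ⊕ B), if IsUnion g L ∧ L ⊆ Q then
        insertionSumOn E g L c s X * corrOn E g (component g β ∪ (Q \ L)) X else 0 := by
  have : Finite (Splitting g Q) := finite_splitting
  have : Fintype (Splitting g Q) := Fintype.ofFinite _
  rw [← sum_splitting hQ (fun L R =>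
    insertionSumOn E g L c s X * corrOn E g (component g β ∪ R) X), ← sum_factorPairs]
  refine Finset.sum_congr rfl fun q _ => ?_
  unfold autSum
  refine Finset.sum_congr rfl fun Ω _ => ?_
  rw [act, insertionI, yCoeffOn_eq, insertionSumOn_act hD Ω.2.1, corrOn_act hD Ω.2.1,
    pullback_union, pullback_of_disjoint Ω.2 hβ, smul_mul_assoc, smul_smul, one_div_mul_one_div,
    mul_comm (Nat.card (AutOn g q.place.right) : ℝ)]
  rfl

end Symmetry

/-! ### Components -/

section Components

variable {D : ℕ} {W B M : Type*} {g : ColouredGraph D W B}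

theorem IsUnion.mem_iff_of_reachable {S : Set (W ⊕ B)} (hS : IsUnion g S) {u v : W ⊕ B}
    (h : (toSimpleGraph g).Reachable u v) : u ∈ S ↔ v ∈ S := by
  have hadj : ∀ u v, (toSimpleGraph g).Adj u v → (u ∈ S ↔ v ∈ S) := by
    intro u v h
    rw [toSimpleGraph, SimpleGraph.fromRel_adj] at h
    rcases h.2 with ⟨c, w, rfl, rfl⟩ | ⟨c, w, rfl, rfl⟩
    · exact hS c w
    · exact (hS c w).symm
  obtain ⟨p⟩ := h
  induction p with
  | nil => rfl
  | cons h _ ih => exact (hadj _ _ h).trans ih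

theorem component_subset {S : Set (W ⊕ B)} (hS : IsUnion g S) {β : B} (h : Sum.inr β ∈ S) :
    component g β ⊆ S := fun _ hu => (hS.mem_iff_of_reachable hu).1 h

theorem isConnected_iff {β : B} : IsConnected g ↔ ∀ u, u ∈ component g β := by
  rw [IsConnected, SimpleGraph.connected_iff_exists_forall_reachable]
  constructor
  · rintro ⟨v, hv⟩ u
    exact (hv _).symm.trans (hv u)
  · exact fun h => ⟨_, h⟩

theorem IsUnion.union {S T : Set (W ⊕ B)} (hS : IsUnion g S) (hT : IsUnion g T) :
    IsUnion g (S ∪ T) := fun c w => or_congr (hS c w) (hT c w)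

theorem IsUnion.inter {S T : Set (W ⊕ B)} (hS : IsUnion g S) (hT : IsUnion g T) :
    IsUnion g (S ∩ T) := fun c w => and_congr (hS c w) (hT c w)

theorem component_restrict {S : Set (W ⊕ B)} (hS : IsUnion g S) {β : B} (hβ : Sum.inr β ∈ S)
    (u : {w : W // Sum.inl w ∈ S} ⊕ {b : B // Sum.inr b ∈ S}) :
    u ∈ component (restrict g S hS) ⟨β, hβ⟩ ↔
      Sum.map Subtype.val Subtype.val u ∈ component g β := by
  constructor
  · intro hu
    exact component_subset (g := restrict g S hS) (β := ⟨β, hβ⟩) (S := {u | Sum.map Subtype.val Subtype.val u ∈ component g β})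
      (fun c w => isUnion_component g β c w.1) (mem_component g β) hu
  · intro hu
    let T : Set (W ⊕ B) := Sum.elim
      (fun w => ∃ h, Sum.inl ⟨w, h⟩ ∈ component (restrict g S hS) ⟨β, hβ⟩)
      (fun b => ∃ h, Sum.inr ⟨b, h⟩ ∈ component (restrict g S hS) ⟨β, hβ⟩)
    have hT : IsUnion g T := by
      intro c w
      constructor
      · rintro ⟨h, h'⟩
        exact ⟨(hS c w).1 h, (isUnion_component (restrict g S hS) ⟨β, hβ⟩ c ⟨w, h⟩).1 h'⟩
      · rintro ⟨h, h'⟩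
        exact ⟨(hS c w).2 h,
          (isUnion_component (restrict g S hS) ⟨β, hβ⟩ c ⟨w, (hS c w).2 h⟩).2 h'⟩
    have h := component_subset hT (β := β) ⟨hβ, mem_component _ _⟩ hu
    rcases u with w | b
    · exact h.2
    · exact h.2

/-- Swapping two black ends inside a union of components. -/
theorem isUnion_edgeSwap_iff {c : Fin D} {β ρ : B} {S : Set (W ⊕ B)}
    (h : Sum.inr β ∈ S ↔ Sum.inr ρ ∈ S) : IsUnion (edgeSwap g c β ρ) S ↔ IsUnion g S := by
  classical
  refine forall_congr' fun d => forall_congr' fun w => iff_congr Iff.rfl ?_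
  by_cases hd : d = c
  · subst hd
    rw [edgeSwap_same, Equiv.trans_apply]
    by_cases h1 : g d w = β
    · rw [h1, Equiv.swap_apply_left, h]
    by_cases h2 : g d w = ρ
    · rw [h2, Equiv.swap_apply_right, h]
    rw [Equiv.swap_apply_of_ne_of_ne h1 h2]
  · rw [edgeSwap_of_ne g hd]

theorem edgeSwap_restrict {c : Fin D} {β ρ : B} {S : Set (W ⊕ B)} (hS : IsUnion g S)
    (hβ : Sum.inr β ∈ S) (hρ : Sum.inr ρ ∈ S) :
    edgeSwap (restrict g S hS) c ⟨β, hβ⟩ ⟨ρ, hρ⟩ =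
      restrict (edgeSwap g c β ρ) S ((isUnion_edgeSwap_iff (iff_of_true hβ hρ)).2 hS) := by
  classical
  funext d
  refine Equiv.ext fun w => Subtype.ext ?_
  change _ = edgeSwap g c β ρ d w.1
  by_cases hd : d = c
  · subst hd
    rw [edgeSwap_same, edgeSwap_same, Equiv.trans_apply, Equiv.trans_apply]
    exact (Subtype.val_injective.map_swap _ _ _)
  · rw [edgeSwap_of_ne _ hd, edgeSwap_of_ne _ hd]
    rfl

/-- A swap of two black ends inside a set does not affect whether the set is a union of components.
So each side is a union of components for the other graph and contains the generating vertices. -/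
theorem component_edgeSwap_union {c : Fin D} {β ρ : B} (hρ : Sum.inr ρ ∈ component g β) :
    component (edgeSwap g c β ρ) β ∪ component (edgeSwap g c β ρ) ρ = component g β := by
  have hR : IsUnion (edgeSwap g c β ρ) (component g β) :=
    (isUnion_edgeSwap_iff (iff_of_true (mem_component g β) hρ)).2 (isUnion_component g β)
  refine Set.Subset.antisymm (Set.union_subset (component_subset hR (mem_component g β))
    (component_subset hR hρ)) (component_subset ?_ (Or.inl (mem_component _ β)))
  exact (isUnion_edgeSwap_iff (iff_of_true (Or.inl (mem_component _ β))
    (Or.inr (mem_component _ ρ)))).1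
    ((isUnion_component _ β).union (isUnion_component _ ρ))

theorem component_eq_of_mem {β ρ : B} (h : Sum.inr ρ ∈ component g β) :
    component g ρ = component g β := by
  ext u
  exact ⟨fun hu => SimpleGraph.Reachable.trans h hu,
    fun hu => SimpleGraph.Reachable.trans (SimpleGraph.Reachable.symm h) hu⟩

/-- After the swap the component of `β` consists of at most the new components of `β` and `ρ`. It is
disconnected precisely when these differ. -/
theorem mem_bridges_iff [Fintype B] {c : Fin D} {β ρ : B} :
    ρ ∈ bridges g β c ↔ Sum.inr ρ ∈ component g β ∧
      Sum.inr ρ ∉ component (edgeSwap g c β ρ) β := by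
  classical
  rw [bridges, Finset.mem_filter, and_iff_right (Finset.mem_univ _)]
  have key : ∀ hρ : Sum.inr ρ ∈ component g β,
      IsConnected (edgeSwap (restrict g (component g β) (isUnion_component g β)) c
        ⟨β, mem_component g β⟩ ⟨ρ, hρ⟩) ↔ Sum.inr ρ ∈ component (edgeSwap g c β ρ) β := by
    intro hρ
    rw [edgeSwap_restrict _ (mem_component g β) hρ, isConnected_iff (β := ⟨β, mem_component g β⟩)]
    simp only [component_restrict]
    constructor
    · exact fun h => h (Sum.inr ⟨ρ, hρ⟩)
    · intro h
      have hcomp : component (edgeSwap g c β ρ) β = component g β := by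
        rw [← component_edgeSwap_union (c := c) hρ, component_eq_of_mem h, Set.union_self]
      rw [hcomp]
      rintro (w | b)
      · exact w.2
      · exact b.2
  constructor
  · rintro ⟨h, h'⟩
    exact ⟨h, mt (key h).2 h'⟩
  · rintro ⟨h, h'⟩
    exact ⟨h, mt (key h).1 h'⟩

/-- If the swap of the black ends of two edges disconnects them, then these edges belong to the
same component. -/
theorem mem_component_of_isUnion_edgeSwap [Finite W] (hD : 2 ≤ D) {c : Fin D} {β ρ : B}
    {A : Set (W ⊕ B)} (hA : IsUnion (edgeSwap g c β ρ) A) (hρ : Sum.inr ρ ∈ A)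
    (hβ : Sum.inr β ∉ A) : Sum.inr ρ ∈ component g β := by
  classical
  by_contra hρR
  obtain ⟨d, hd⟩ := exists_ne_colour hD c
  have hR := isUnion_component g β
  have : Finite B := Finite.of_equiv W (g c)
  let w₀ := (g c).symm β
  have hw₀ : g c w₀ = β := Equiv.apply_symm_apply _ _
  -- The edges of a colour `d ≠ c` match the white with the black vertices of `U`. The `c`-edges
  -- match all its white vertices except `w₀`, whose edge in `g` ends at `β` outside `A`, with the
  -- same black vertices; this contradicts finiteness.
  let U : Set (W ⊕ B) := A ∩ component g β
  have h1 : ∀ w, Sum.inl w ∈ U ↔ Sum.inr (g d w) ∈ U := by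
    intro w
    have h := hA d w
    rw [edgeSwap_of_ne g hd] at h
    exact and_congr h (hR d w)
  have h2 : ∀ w, Sum.inl w ∈ U ∧ w ≠ w₀ ↔ Sum.inr (g c w) ∈ U := by
    intro w
    by_cases hw : w = w₀
    · subst hw
      rw [hw₀]
      exact iff_of_false (fun h => h.2 rfl) fun h => hβ h.1
    · rw [and_iff_left hw]
      have hne : g c w ≠ β := fun h => hw ((g c).injective (h.trans hw₀.symm))
      by_cases hwρ : g c w = ρ
      · rw [hwρ]
        refine iff_of_false (fun h => hρR ?_) fun h => hρR h.2
        rw [← hwρ]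
        exact (hR c w).1 h.2
      · have h := hA c w
        rw [edgeSwap_same, Equiv.trans_apply, Equiv.swap_apply_of_ne_of_ne hne hwρ] at h
        exact and_congr h (hR c w)
  have h3 : Sum.inl w₀ ∈ U := by
    refine ⟨(hA c w₀).2 ?_, (hR c w₀).2 (by rw [hw₀]; exact mem_component g β)⟩
    rw [edgeSwap_same, Equiv.trans_apply, hw₀, Equiv.swap_apply_left]
    exact hρ
  have e1 : Nat.card {w // Sum.inl w ∈ U} = Nat.card {b // Sum.inr b ∈ U} :=
    Nat.card_congr ((g d).subtypeEquiv h1)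
  have e2 : Nat.card {w // Sum.inl w ∈ U ∧ w ≠ w₀} = Nat.card {b // Sum.inr b ∈ U} :=
    Nat.card_congr ((g c).subtypeEquiv h2)
  rw [← e1] at e2
  let f : {w // Sum.inl w ∈ U ∧ w ≠ w₀} → {w // Sum.inl w ∈ U} := fun w => ⟨w.1, w.2.1⟩
  have hf : Function.Injective f := fun a b h => Subtype.ext (congrArg (fun w => w.1) h)
  obtain ⟨w, hw⟩ := (hf.bijective_of_nat_card_le e2.ge).2 ⟨w₀, h3⟩
  exact w.2.2 (congrArg Subtype.val hw)

open Classical in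
-- A union of components of the swapped graph that separates `ρ` from `β` exists only at a bridge.
-- It contains the whole component of `ρ` and nothing of that of `β`, and the components outside
-- `R`, untouched by the swap, go to either side.
theorem sum_isUnion_edgeSwap [Fintype W] [Fintype B] (hD : 2 ≤ D) {R : Type*} [AddCommMonoid R]
    (g : ColouredGraph D W B) (c : Fin D) (β ρ : B)
    (F : Set (W ⊕ B) → Set (W ⊕ B) → R) :
    (∑ A : Set (W ⊕ B), if IsUnion (edgeSwap g c β ρ) A ∧ Sum.inr ρ ∈ A ∧ Sum.inr β ∉ A then
      F Aᶜ A else 0) =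
    if ρ ∈ bridges g β c then
      ∑ L : Set (W ⊕ B), if IsUnion g L ∧ L ⊆ (component g β)ᶜ then
        F (component (edgeSwap g c β ρ) β ∪ L)
          (component (edgeSwap g c β ρ) ρ ∪ ((component g β)ᶜ \ L)) else 0
    else 0 := by
  set h := edgeSwap g c β ρ with hh
  set R := component g β with hRdef
  have hmain : ∀ A, IsUnion h A → Sum.inr ρ ∈ A → Sum.inr β ∉ A → ρ ∈ bridges g β c := by
    intro A hA hρ hβ
    have hρR := mem_component_of_isUnion_edgeSwap hD hA hρ hβ
    exact mem_bridges_iff.2 ⟨hρR, fun h' => component_subset (isUnion_compl hA) hβ h' hρ⟩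
  by_cases hb : ρ ∈ bridges g β c
  swap
  · rw [if_neg hb]
    exact Finset.sum_eq_zero fun A _ => if_neg fun h => hb (hmain A h.1 h.2.1 h.2.2)
  rw [if_pos hb, ← Finset.sum_filter, ← Finset.sum_filter]
  obtain ⟨hρR, hρ'⟩ := mem_bridges_iff.1 hb
  rw [← hh] at hρ'
  have hcup : component h β ∪ component h ρ = R := component_edgeSwap_union hρR
  have hβR : Sum.inr β ∈ R := mem_component g β
  have hdisj : Disjoint (component h β) (component h ρ) := by
    rw [Set.disjoint_left]
    intro u hu hu'
    exact hρ' (SimpleGraph.Reachable.trans hu (SimpleGraph.Reachable.symm hu'))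
  have hunion : ∀ S : Set (W ⊕ B), S ⊆ Rᶜ → (IsUnion h S ↔ IsUnion g S) := fun S hS =>
    isUnion_edgeSwap_iff (iff_of_false (fun h => hS h hβR) fun h => hS h hρR)
  have hRh : IsUnion h R := (isUnion_edgeSwap_iff (iff_of_true hβR hρR)).2 (isUnion_component g β)
  symm
  have hcompl : ∀ L, L ⊆ Rᶜ → (component h β ∪ L)ᶜ = component h ρ ∪ (Rᶜ \ L) := by
    intro L hL
    ext u
    have h1 : u ∈ R ↔ u ∈ component h β ∨ u ∈ component h ρ := by rw [← hcup]; rfl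
    have h2 : u ∈ component h β → u ∉ component h ρ := fun a b =>
      Set.disjoint_left.1 hdisj a b
    have h3 : u ∈ L → u ∉ R := fun a => hL a
    simp only [Set.mem_compl_iff, Set.mem_union, Set.mem_sdiff]
    tauto
  refine Finset.sum_bij (fun L _ => (component h β ∪ L)ᶜ) ?_ ?_ ?_ ?_
  · intro L hL
    simp only [Finset.mem_filter, Finset.mem_univ, true_and] at hL ⊢
    refine ⟨isUnion_compl ((isUnion_component h β).union ((hunion L hL.2).2 hL.1)), ?_, ?_⟩
    · rintro (h' | h')
      · exact hρ' h'
      · exact hL.2 h' hρR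
    · exact fun h' => h' (Or.inl (mem_component h β))
  · intro L hL L' hL' heq
    simp only [Finset.mem_filter, Finset.mem_univ, true_and] at hL hL'
    have heq := compl_injective heq
    have hsub : component h β ⊆ R := hcup ▸ Set.subset_union_left
    have key : ∀ L, L ⊆ Rᶜ → L = (component h β ∪ L) ∩ Rᶜ := by
      intro L hL
      rw [Set.union_inter_distrib_right, Set.inter_eq_self_of_subset_left hL,
        (Set.disjoint_compl_right_iff_subset.2 hsub).inter_eq, Set.empty_union]
    rw [key L hL.2, heq, ← key L' hL'.2]
  · intro A hA
    simp only [Finset.mem_filter, Finset.mem_univ, true_and] at hA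
    obtain ⟨hA, hρ, hβ⟩ := hA
    refine ⟨Aᶜ ∩ Rᶜ, ?_, ?_⟩
    · simp only [Finset.mem_filter, Finset.mem_univ, true_and]
      exact ⟨(hunion _ Set.inter_subset_right).1 ((isUnion_compl hA).inter (isUnion_compl hRh)),
        Set.inter_subset_right⟩
    · have h1 := component_subset (isUnion_compl hA) hβ
      have h2 := component_subset hA hρ
      ext u
      have h3 : u ∈ R ↔ u ∈ component h β ∨ u ∈ component h ρ := by rw [← hcup]; rfl
      have h4 : u ∈ component h β → u ∉ A := fun a => h1 a
      have h5 : u ∈ component h ρ → u ∈ A := fun a => h2 a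
      simp only [Set.mem_compl_iff, Set.mem_union, Set.mem_inter_iff]
      tauto
  · intro L hL
    simp only [Finset.mem_filter, Finset.mem_univ, true_and] at hL
    rw [compl_compl, hcompl L hL.2]

end Components

/-! ### Components of a graph with an inserted edge -/

section Insertion

variable {D : ℕ} {W B M : Type*} {g : ColouredGraph D W B} {ι : Fin D → Option W}

/-- The vertices in `L` together with the ends of the inserted edge. -/
def withEdge (L : Set (W ⊕ B)) : Set (Option W ⊕ Option B) :=
  Sum.elim (fun o => o.elim True fun w => Sum.inl w ∈ L)
    fun o => o.elim True fun b => Sum.inr b ∈ L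

theorem withEdge_injective : Function.Injective (withEdge : Set (W ⊕ B) → _) := by
  intro L L' h
  ext (w | b)
  · exact iff_of_eq (congrArg (fun A => Sum.inl (some w) ∈ A) h)
  · exact iff_of_eq (congrArg (fun A => Sum.inr (some b) ∈ A) h)

theorem insertEdge_some_of_ne {d : Fin D} {w : W} (h : ι d ≠ some w) :
    insertEdge g ι d (some w) = some (g d w) := by
  classical
  rcases hd : ι d with _ | v
  · rw [insertEdge_of_none hd]; rfl
  · rw [insertEdge_of_some hd, Equiv.trans_apply]
    refine Equiv.swap_apply_of_ne_of_ne (by simp) fun h' => h ?_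
    rw [hd, (g d).injective (Option.some_injective _ h')]

theorem insertEdge_some_of_eq {d : Fin D} {w : W} (h : ι d = some w) :
    insertEdge g ι d (some w) = none := by
  classical
  rw [insertEdge_of_some h, Equiv.trans_apply]
  exact Equiv.swap_apply_right _ _

theorem insertEdge_none_of_eq {d : Fin D} {w : W} (h : ι d = some w) :
    insertEdge g ι d none = some (g d w) := by
  classical
  rw [insertEdge_of_some h, Equiv.trans_apply]
  exact Equiv.swap_apply_left _ _

theorem insertEdge_none_of_none {d : Fin D} (h : ι d = none) :
    insertEdge g ι d none = none := by
  rw [insertEdge_of_none h]; rfl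

theorem isUnion_withEdge_iff {L : Set (W ⊕ B)} :
    IsUnion (insertEdge g ι) (withEdge L) ↔
      IsUnion g L ∧ ∀ d w, ι d = some w → Sum.inl w ∈ L := by
  constructor
  · intro h
    have h1 : ∀ d w, ι d = some w → Sum.inl w ∈ L := by
      intro d w hd
      have := h d (some w)
      rw [insertEdge_some_of_eq hd] at this
      exact this.2 trivial
    refine ⟨fun d w => ?_, h1⟩
    by_cases hd : ι d = some w
    · refine iff_of_true (h1 d w hd) ?_
      have := h d none
      rw [insertEdge_none_of_eq hd] at this
      exact this.1 trivial
    · have := h d (some w)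
      rw [insertEdge_some_of_ne hd] at this
      exact this
  · rintro ⟨h, h1⟩ d (_ | w)
    · rcases hd : ι d with _ | v
      · rw [insertEdge_none_of_none hd]
        exact Iff.rfl
      · rw [insertEdge_none_of_eq hd]
        exact iff_of_true trivial ((h d v).1 (h1 d v hd))
    · by_cases hd : ι d = some w
      · rw [insertEdge_some_of_eq hd]
        exact iff_of_true (h1 d w hd) trivial
      · rw [insertEdge_some_of_ne hd]
        exact h d w

/-- The two new vertices are joined by an edge of colour `c`, so a union of components that contains
one contains both. -/
theorem eq_withEdge {c : Fin D} (hc : ι c = none) {A : Set (Option W ⊕ Option B)}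
    (hA : IsUnion (insertEdge g ι) A) (h : Sum.inl none ∈ A) :
    withEdge {u | Sum.map some some u ∈ A} = A := by
  have h' := (hA c none).1 h
  rw [insertEdge_none_of_none hc] at h'
  ext ((_ | w) | (_ | b))
  · exact iff_of_true trivial h
  · rfl
  · exact iff_of_true trivial h'
  · rfl

theorem corrOn_compl_withEdge (hD : 2 ≤ D) [Fintype W] [Fintype B] [Fintype M]
    (E : (Fin D → M) → ℝ) {L : Set (W ⊕ B)}
    (hL : IsUnion g L) (hι : ∀ d w, ι d = some w → Sum.inl w ∈ L) (z : Fin D → M)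
    (X : W → Fin D → M) :
    corrOn E (insertEdge g ι) (withEdge L)ᶜ (fun o => o.elim z X) = corrOn E g Lᶜ X := by
  have h := isUnion_compl (isUnion_withEdge_iff.2 ⟨hL, hι⟩)
  rw [corrOn, corrOn, dif_pos h, dif_pos (isUnion_compl hL)]
  let e : {w : W // Sum.inl w ∈ Lᶜ} ≃ {o : Option W // Sum.inl o ∈ (withEdge L)ᶜ} :=
    { toFun := fun w => ⟨some w.1, w.2⟩
      invFun := fun o => match o with
        | ⟨none, h⟩ => (h trivial).elim
        | ⟨some w, h⟩ => ⟨w, h⟩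
      left_inv := fun _ => rfl
      right_inv := by
        rintro ⟨_ | w, h⟩
        · exact (h trivial).elim
        · rfl }
  let f : {b : B // Sum.inr b ∈ Lᶜ} ≃ {o : Option B // Sum.inr o ∈ (withEdge L)ᶜ} :=
    { toFun := fun w => ⟨some w.1, w.2⟩
      invFun := fun o => match o with
        | ⟨none, h⟩ => (h trivial).elim
        | ⟨some w, h⟩ => ⟨w, h⟩
      left_inv := fun _ => rfl
      right_inv := by
        rintro ⟨_ | w, h⟩
        · exact (h trivial).elim
        · rfl }
  refine corr_congr hD e f (fun d w => Subtype.ext ?_) fun _ => rfl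
  exact insertEdge_some_of_ne fun h => w.2 (hι d w.1 h)

theorem corrOn_withEdge (hD : 2 ≤ D) [Fintype W] [Fintype B] [Fintype M]
    (E : (Fin D → M) → ℝ) {L : Set (W ⊕ B)} (hL : IsUnion g L)
    {_ : Fintype {w : W // Sum.inl w ∈ L}} {_ : Fintype {b : B // Sum.inr b ∈ L}}
    (κ : Fin D → Option {w : W // Sum.inl w ∈ L}) (z : Fin D → M) (X : W → Fin D → M) :
    corrOn E (insertEdge g fun d => (κ d).map Subtype.val) (withEdge L) (fun o => o.elim z X) =
      corr E (insertEdge (restrict g L hL) κ) (fun o => o.elim z fun w => X w.1) := by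
  have hι : ∀ d w, (κ d).map Subtype.val = some w → Sum.inl w ∈ L := by
    intro d w hd
    obtain ⟨v, -, rfl⟩ := Option.map_eq_some_iff.1 hd
    exact v.2
  have h := isUnion_withEdge_iff.2 ⟨hL, hι⟩
  rw [corrOn, dif_pos h]
  let e : Option {w : W // Sum.inl w ∈ L} ≃ {o : Option W // Sum.inl o ∈ withEdge L} :=
    { toFun := fun o => match o with
        | none => ⟨none, trivial⟩
        | some w => ⟨some w.1, w.2⟩
      invFun := fun o => match o with
        | ⟨none, _⟩ => none
        | ⟨some w, h⟩ => some ⟨w, h⟩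
      left_inv := by rintro (_ | w) <;> rfl
      right_inv := by rintro ⟨_ | w, h⟩ <;> rfl }
  let f : Option {b : B // Sum.inr b ∈ L} ≃ {o : Option B // Sum.inr o ∈ withEdge L} :=
    { toFun := fun o => match o with
        | none => ⟨none, trivial⟩
        | some w => ⟨some w.1, w.2⟩
      invFun := fun o => match o with
        | ⟨none, _⟩ => none
        | ⟨some w, h⟩ => some ⟨w, h⟩
      left_inv := by rintro (_ | w) <;> rfl
      right_inv := by rintro ⟨_ | w, h⟩ <;> rfl }
  refine corr_congr hD e f (fun d o => Subtype.ext ?_) ?_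
  · change insertEdge g (fun d => (κ d).map Subtype.val) d (e o).1 = (f _).1
    rcases o with _ | w
    · rcases hd : κ d with _ | v
      · rw [insertEdge_none_of_none hd]
        exact insertEdge_none_of_none (by simp [hd])
      · rw [insertEdge_none_of_eq hd]
        exact insertEdge_none_of_eq (by simp [hd])
    · by_cases hd : κ d = some w
      · rw [insertEdge_some_of_eq hd]
        exact insertEdge_some_of_eq (by simp [hd])
      · rw [insertEdge_some_of_ne hd]
        refine insertEdge_some_of_ne fun h => hd ?_
        obtain ⟨v, hv, hv'⟩ := Option.map_eq_some_iff.1 h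
        rw [hv, Subtype.ext hv']
  · rintro (_ | w) <;> rfl

open Classical in
/-- The products of correlation functions in which the inserted edge belongs to the first factor,
and a given vertex `x` of the graph to the second one. -/
theorem sum_corrOn_insertEdge (hD : 2 ≤ D) [Fintype W] [Fintype B] [Fintype M]
    (E : (Fin D → M) → ℝ) (g : ColouredGraph D W B) (c : Fin D) (s : M) (X : W → Fin D → M)
    (x : W) :
    (∑ ι : Fin D → Option W, if ι c = none then ∑ z : Fin D → M,
      if z c = s ∧ ∀ d w, ι d = some w → z d = X w d then
        ∑ A : Set (Option W ⊕ Option B),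
          if IsUnion (insertEdge g ι) A ∧ Sum.inl none ∈ A ∧ Sum.inl (some x) ∉ A then
            corrOn E (insertEdge g ι) A (fun o => o.elim z X) *
            corrOn E (insertEdge g ι) Aᶜ (fun o => o.elim z X) else 0
      else 0 else 0) =
    ∑ L : Set (W ⊕ B), if IsUnion g L ∧ Sum.inl x ∉ L then
      insertionSumOn E g L c s X * corrOn E g Lᶜ X else 0 := by
  -- A union of components with the new edge is `withEdge L`, where `L` contains all edges into
  -- which the new vertices are inserted. Its complement is a part of `g` itself.
  have h1 : ∀ (ι : Fin D → Option W), ι c = none → ∀ z : Fin D → M,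
      (∑ A : Set (Option W ⊕ Option B),
        if IsUnion (insertEdge g ι) A ∧ Sum.inl none ∈ A ∧ Sum.inl (some x) ∉ A then
          corrOn E (insertEdge g ι) A (fun o => o.elim z X) *
          corrOn E (insertEdge g ι) Aᶜ (fun o => o.elim z X) else 0) =
      ∑ L : Set (W ⊕ B), if (IsUnion g L ∧ Sum.inl x ∉ L) ∧ ∀ d w, ι d = some w → Sum.inl w ∈ L then
        corrOn E (insertEdge g ι) (withEdge L) (fun o => o.elim z X) * corrOn E g Lᶜ X else 0 := by
    intro ι hc z
    symm
    refine Finset.sum_of_injOn withEdge withEdge_injective.injOn (fun _ _ => by simp) ?_ ?_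
    · intro A _ hA
      refine if_neg fun h => hA ?_
      exact ⟨_, by simp, eq_withEdge hc h.1 h.2.1⟩
    · intro L _
      by_cases hL : (IsUnion g L ∧ Sum.inl x ∉ L) ∧ ∀ d w, ι d = some w → Sum.inl w ∈ L
      · rw [if_pos hL, if_pos ⟨isUnion_withEdge_iff.2 ⟨hL.1.1, hL.2⟩, trivial, hL.1.2⟩,
          corrOn_compl_withEdge hD E hL.1.1 hL.2]
      · rw [if_neg hL, if_neg]
        rintro ⟨h, -, h'⟩
        have := isUnion_withEdge_iff.1 h
        exact hL ⟨⟨this.1, h'⟩, this.2⟩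
  have h2 : (∑ ι : Fin D → Option W, if ι c = none then ∑ z : Fin D → M,
      if z c = s ∧ ∀ d w, ι d = some w → z d = X w d then
        ∑ A : Set (Option W ⊕ Option B),
          if IsUnion (insertEdge g ι) A ∧ Sum.inl none ∈ A ∧ Sum.inl (some x) ∉ A then
            corrOn E (insertEdge g ι) A (fun o => o.elim z X) *
            corrOn E (insertEdge g ι) Aᶜ (fun o => o.elim z X) else 0
      else 0 else 0) =
      ∑ ι : Fin D → Option W, ∑ z : Fin D → M, ∑ L : Set (W ⊕ B),
        if (IsUnion g L ∧ Sum.inl x ∉ L) ∧ (∀ d w, ι d = some w → Sum.inl w ∈ L) ∧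
          ι c = none ∧ z c = s ∧ ∀ d w, ι d = some w → z d = X w d then
        corrOn E (insertEdge g ι) (withEdge L) (fun o => o.elim z X) * corrOn E g Lᶜ X
        else 0 := by
    refine Finset.sum_congr rfl fun ι _ => ?_
    by_cases hc : ι c = none
    swap
    · rw [if_neg hc]
      symm
      exact Finset.sum_eq_zero fun z _ => Finset.sum_eq_zero fun L _ =>
        if_neg fun h => hc h.2.2.1
    rw [if_pos hc]
    refine Finset.sum_congr rfl fun z _ => ?_
    by_cases hz : z c = s ∧ ∀ d w, ι d = some w → z d = X w d
    swap
    · rw [if_neg hz]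
      symm
      exact Finset.sum_eq_zero fun L _ => if_neg fun h => hz h.2.2.2
    rw [if_pos hz, h1 ι hc z]
    exact Finset.sum_congr rfl fun L _ => if_congr
      ⟨fun h => ⟨h.1, h.2, hc, hz⟩, fun h => ⟨h.1, h.2.1⟩⟩ rfl rfl
  have h3 : ∀ ι : Fin D → Option W, (∑ z : Fin D → M, ∑ L : Set (W ⊕ B),
        if (IsUnion g L ∧ Sum.inl x ∉ L) ∧ (∀ d w, ι d = some w → Sum.inl w ∈ L) ∧
          ι c = none ∧ z c = s ∧ ∀ d w, ι d = some w → z d = X w d then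
        corrOn E (insertEdge g ι) (withEdge L) (fun o => o.elim z X) * corrOn E g Lᶜ X
        else 0) = ∑ L : Set (W ⊕ B), ∑ z : Fin D → M,
        if (IsUnion g L ∧ Sum.inl x ∉ L) ∧ (∀ d w, ι d = some w → Sum.inl w ∈ L) ∧
          ι c = none ∧ z c = s ∧ ∀ d w, ι d = some w → z d = X w d then
        corrOn E (insertEdge g ι) (withEdge L) (fun o => o.elim z X) * corrOn E g Lᶜ X
        else 0 := fun ι => Finset.sum_comm
  rw [h2]
  simp only [h3]
  rw [Finset.sum_comm]
  refine Finset.sum_congr rfl fun L _ => ?_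
  by_cases hL : IsUnion g L ∧ Sum.inl x ∉ L
  swap
  · rw [if_neg hL]
    exact Finset.sum_eq_zero fun ι _ => Finset.sum_eq_zero fun z _ => if_neg fun h => hL h.1
  rw [if_pos hL, insertionSumOn, dif_pos hL.1, insertionSum, Finset.sum_mul]
  symm
  -- The insertions with all their white vertices in `L` are the insertions `κ` into the graph
  -- formed by `L`.
  refine Finset.sum_of_injOn (fun κ d => (κ d).map Subtype.val)
    (Function.Injective.injOn fun κ κ' h => funext fun d =>
      Option.map_injective Subtype.val_injective (congrFun h d)) (fun _ _ => by simp) ?_ ?_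
  · intro ι _ hι
    refine Finset.sum_eq_zero fun z _ => if_neg fun h => hι ?_
    refine ⟨fun d => (ι d).pmap (fun w hw => ⟨w, hw⟩) (h.2.1 d), by simp, funext fun d => ?_⟩
    simp [Option.map_pmap]
  · intro κ _
    have hκ : ∀ d w, (κ d).map Subtype.val = some w → Sum.inl w ∈ L := by
      intro d w hd
      obtain ⟨v, -, rfl⟩ := Option.map_eq_some_iff.1 hd
      exact v.2
    by_cases hc : κ c = none
    swap
    · rw [if_neg hc, zero_mul]
      symm
      exact Finset.sum_eq_zero fun z _ => if_neg fun h => hc (Option.map_eq_none_iff.1 h.2.2.1)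
    rw [if_pos hc, Finset.sum_mul]
    refine Finset.sum_congr rfl fun z _ => ?_
    have hz : (z c = s ∧ ∀ d w, κ d = some w → z d = X w.1 d) ↔
        (IsUnion g L ∧ Sum.inl x ∉ L) ∧ (∀ d w, (κ d).map Subtype.val = some w → Sum.inl w ∈ L) ∧
          (κ c).map Subtype.val = none ∧ z c = s ∧
          ∀ d w, (κ d).map Subtype.val = some w → z d = X w d := by
      constructor
      · rintro ⟨h, h'⟩
        refine ⟨hL, hκ, Option.map_eq_none_iff.2 hc, h, fun d w hd => ?_⟩
        obtain ⟨v, hv, rfl⟩ := Option.map_eq_some_iff.1 hd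
        exact h' d v hv
      · rintro ⟨-, -, -, h, h'⟩
        exact ⟨h, fun d w hd => h' d w.1 (by simp [hd])⟩
    by_cases hz' : z c = s ∧ ∀ d w, κ d = some w → z d = X w.1 d
    · rw [if_pos hz', if_pos (hz.1 hz'), ← corrOn_withEdge hD E hL.1]
    · rw [if_neg hz', if_neg (mt hz.2 hz'), zero_mul]

end Insertion

/-! ### The Schwinger-Dyson equation -/

section SchwingerDyson

variable {D : ℕ} {W B I M : Type*}

theorem wickSum_congr_of_separates [Fintype W] [Fintype B] [Fintype I] {g : ColouredGraph D W B}
    {x y : W} {ω ω' : (Fin D → Perm (W ⊕ (I × Bool))) → ℝ}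
    (h : ∀ σ, (∀ c, Separates Sum.inl (σ c)) → ω σ = ω' σ) :
    wickSum I g x y ω = wickSum I g x y ω' := by
  classical
  unfold wickSum
  refine Finset.sum_congr rfl fun a _ => Finset.sum_congr rfl fun τ _ => ?_
  by_cases hs : (∀ c, Separates Sum.inl (closing g a τ c)) ∧
      Linked (closing g a τ) (Sum.inl x) (Sum.inl y)
  · rw [if_pos hs, if_pos hs, h _ hs.1]
  · rw [if_neg hs, if_neg hs]

theorem wickSum_mul_sub [Fintype W] [Fintype B] [Fintype I] (g : ColouredGraph D W B)
    (x y : W) (k : ℝ) (ω ω' : (Fin D → Perm (W ⊕ (I × Bool))) → ℝ) :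
    wickSum I g x y (fun σ => k * (ω σ - ω' σ)) = k * (wickSum I g x y ω - wickSum I g x y ω') := by
  classical
  unfold wickSum
  rw [← Finset.sum_sub_distrib, Finset.mul_sum]
  refine Finset.sum_congr rfl fun a _ => ?_
  rw [← Finset.sum_sub_distrib, Finset.mul_sum]
  refine Finset.sum_congr rfl fun τ _ => ?_
  by_cases hs : (∀ c, Separates Sum.inl (closing g a τ c)) ∧
      Linked (closing g a τ) (Sum.inl x) (Sum.inl y)
  · rw [if_pos hs, if_pos hs, if_pos hs]
  · rw [if_neg hs, if_neg hs, if_neg hs, sub_zero, mul_zero]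

theorem kineticDiff_neg (E : (Fin D → M) → ℝ) (p : Fin D → M) (c : Fin D) (t s : M) :
    kineticDiff E p c t s = -kineticDiff E p c s t := (neg_sub _ _).symm

variable [Fintype W] [Fintype B] [Fintype M]

/-- The generating function of the Wick sums in which a point of the strand of colour `c` that
starts at `w` is marked, the momentum beyond the mark being `t`. -/
noncomputable def cutSeries (E : (Fin D → M) → ℝ) (g : ColouredGraph D W B) (x y : W)
    (X : W → Fin D → M) (w : W) (c : Fin D) (t : M) : PowerSeries ℝ :=
  PowerSeries.mk fun n => (-1 : ℝ) ^ n / (n ! : ℝ) *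
    wickSum (Fin n) g x y (cutStrandWeight E Sum.inl X w c t)

open Classical in
theorem cutSeries_of_ne {E : (Fin D → M) → ℝ} (hE : ∀ x, 0 < E x)
    (hkin : ∀ (c : Fin D) (t s : M) (p p' : Fin D → M),
      kineticDiff E p c t s = kineticDiff E p' c t s)
    (hinj : ∀ (c : Fin D) (t s : M) (p : Fin D → M), t ≠ s → kineticDiff E p c t s ≠ 0)
    (g : ColouredGraph D W B) (x y : W) (X : W → Fin D → M) (w : W) (c : Fin D) {t : M}
    (ht : t ≠ X w c) (p : Fin D → M) :
    cutSeries E g x y X w c t = (1 / kineticDiff E p c t (X w c)) •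
      (linkedCorr E g x y X -
        linkedCorr E g x y (Function.update X w (Function.update (X w) c t))) := by
  ext n
  rw [PowerSeries.coeff_smul, map_sub]
  simp only [cutSeries, linkedCorr, PowerSeries.coeff_mk]
  rw [wickSum_congr_of_separates (ω := cutStrandWeight E Sum.inl X w c t) (ω' := fun σ => 1 / kineticDiff E p c t (X w c) *
    (weight E Sum.inl X σ -
      weight E Sum.inl (Function.update X w (Function.update (X w) c t)) σ))
    (fun σ hσ => sum_cutWeight_of_ne hE hkin hinj (hσ c) ht p), wickSum_mul_sub, smul_eq_mul]
  ring

theorem cutSeries_self (hD : 2 ≤ D) {E : (Fin D → M) → ℝ} (hE : ∀ x, 0 < E x)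
    [DecidableEq W] (g : ColouredGraph D W B) (x : W) (X : W → Fin D → M) (w : W) (c : Fin D) :
    cutSeries E g x x X w c (X w c) =
      -PowerSeries.mk fun n => deriv (fun t : ℝ => PowerSeries.coeff n
        (corrShift E g X (Pi.single w (Pi.single c t)))) 0 := by
  ext n
  rw [map_neg]
  simp only [cutSeries, PowerSeries.coeff_mk]
  rw [deriv_coeff_corrShift hD E hE g X w c x n, mul_neg, neg_neg,
    wickSum_congr_of_separates (ω := cutStrandWeight E Sum.inl X w c (X w c))
      (ω' := strandWeight E Sum.inl X w c) (fun σ hσ => sum_cutWeight_self (hσ c))]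

open Classical in
-- The sign comes from `E(t, s) = -E(s, t)` for `t ≠ s`, and for `t = s` from the fact that doubling
-- a propagator is minus a derivative.
theorem cutSeries_eq_neg_diffQuotient (hD : 2 ≤ D) {E : (Fin D → M) → ℝ} (hE : ∀ x, 0 < E x)
    (hkin : ∀ (c : Fin D) (t s : M) (p p' : Fin D → M),
      kineticDiff E p c t s = kineticDiff E p' c t s)
    (hinj : ∀ (c : Fin D) (t s : M) (p : Fin D → M), t ≠ s → kineticDiff E p c t s ≠ 0)
    (g : ColouredGraph D W B) (X : W → Fin D → M) (β : B) (c : Fin D) (t : M) :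
    cutSeries E g ((g c).symm β) ((g c).symm β) X ((g c).symm β) c t =
      -diffQuotient E g X β c t := by
  by_cases ht : t = X ((g c).symm β) c
  · subst ht
    rw [cutSeries_self hD hE, diffQuotient,
      if_pos (show X ((g c).symm β) c = outMomenta g X β c from rfl)]
  · rw [cutSeries_of_ne hE hkin hinj g _ _ X _ c ht (outMomenta g X β), diffQuotient,
      if_neg (show ¬ t = outMomenta g X β c from ht),
      ← coeff_corr hD, ← coeff_corr hD, kineticDiff_neg, div_neg, neg_smul]
    rfl

open Classical in
/-- The generating function of the peeled sums. -/
theorem peeledSeries_eq (E : (Fin D → M) → ℝ) (X : W → Fin D → M) (g : ColouredGraph D W B)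
    (c : Fin D) (β : B) :
    (PowerSeries.mk fun n => (-1 : ℝ) ^ n / (n ! : ℝ) *
      peeledSum (Fin n) g c β (weight E someInl X)) =
    (∑ ι : Fin D → Option W, if ι c = none then ∑ z : Fin D → M,
      if z c = X ((g c).symm β) c ∧ ∀ d w, ι d = some w → z d = X w d then
        linkedCorr E (insertEdge g ι) none (some ((g c).symm β)) (fun o => o.elim z X)
      else 0 else 0) +
    ∑ ρ, ∑ t, if ρ = β ∨ t = X ((g c).symm ρ) c then
      cutSeries E (edgeSwap g c β ρ) ((g c).symm β) ((g c).symm ρ) X ((g c).symm β) c t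
    else 0 := by
  ext n
  rw [PowerSeries.coeff_mk, peeledSum_eq, mul_add, map_add, map_sum, map_sum, Finset.mul_sum,
    Finset.mul_sum]
  congr 1
  · refine Finset.sum_congr (by ext; simp) fun ι _ => ?_
    by_cases hc : ι c = none
    · rw [if_pos hc, if_pos hc, map_sum, Finset.mul_sum]
      refine Finset.sum_congr (by ext; simp) fun z _ => ?_
      by_cases hz : z c = X ((g c).symm β) c ∧ ∀ d w, ι d = some w → z d = X w d
      · rw [if_pos hz, if_pos hz, linkedCorr, PowerSeries.coeff_mk]
      · rw [if_neg hz, if_neg hz, mul_zero, map_zero]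
    · rw [if_neg hc, if_neg hc, mul_zero, map_zero]
  · refine Finset.sum_congr rfl fun ρ _ => ?_
    rw [map_sum, Finset.mul_sum]
    refine Finset.sum_congr rfl fun t _ => ?_
    by_cases ht : ρ = β ∨ t = X ((g c).symm ρ) c
    · rw [if_pos ht, if_pos ht, cutSeries, PowerSeries.coeff_mk]
    · rw [if_neg ht, if_neg ht, mul_zero, map_zero]

/-- At order `m + 1` the factor `2 (m + 1)` of the choices turns `(-1)^(m+1)/(m+1)!` into `-2
(-1)^m/m!`. At order zero there is no pillow from which the propagator to `β` could start. -/
theorem corr_eq_peeledSeries (hD : 2 ≤ D) (E : (Fin D → M) → ℝ) {g : ColouredGraph D W B}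
    (hg : ¬ IsConnected g) (X : W → Fin D → M) (β : B) :
    corr E g X = PowerSeries.C (-2 / E (outMomenta g X β)) * PowerSeries.X *
      ∑ c, PowerSeries.mk fun n => (-1 : ℝ) ^ n / (n ! : ℝ) *
        peeledSum (Fin n) g c β (weight E someInl X) := by
  classical
  let c₀ : Fin D := ⟨0, by omega⟩
  rw [coeff_corr hD E g X ((g c₀).symm β)]
  ext n
  rw [mul_assoc, PowerSeries.coeff_C_mul]
  rcases n with _ | m
  · rw [PowerSeries.coeff_zero_X_mul, mul_zero, linkedCorr, PowerSeries.coeff_mk, wickSum,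
      Finset.sum_eq_zero, mul_zero]
    intro a _
    refine Finset.sum_eq_zero fun τ _ => if_neg fun h => ?_
    rcases hτ : τ.symm (Sum.inl β) with w | ⟨i, -⟩
    · exact not_linked_of_apply_eq_inl hD hg (by rw [← hτ, Equiv.apply_symm_apply]) h.1 _ h.2
    · exact i.elim0
  · rw [PowerSeries.coeff_succ_X_mul, map_sum, linkedCorr, PowerSeries.coeff_mk,
      wickSum_succ hD E hg X β]
    simp only [PowerSeries.coeff_mk]
    rw [← Finset.mul_sum]
    have h1 : ((m ! : ℕ) : ℝ) ≠ 0 := by exact_mod_cast m.factorial_ne_zero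
    have h2 : ((m : ℝ) + 1) ≠ 0 := by positivity
    change _ = -2 / E (fun c => X ((g c).symm β) c) * _
    rw [Nat.factorial_succ, pow_succ, Nat.cast_mul, Nat.cast_succ, div_eq_mul_inv (-2 : ℝ)]
    field_simp

open Classical in
-- The connected graphs give the derivative of the `Y`-term. In a product, one factor contains the
-- new edge together with the components `C`, and the other one contains the component of `β` and
-- the remaining components.
theorem insertion_part (hD : 2 ≤ D) (E : (Fin D → M) → ℝ) (g : ColouredGraph D W B)
    (X : W → Fin D → M) (β : B) (c : Fin D) :
    (∑ ι : Fin D → Option W, if ι c = none then ∑ z : Fin D → M,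
      if z c = X ((g c).symm β) c ∧ ∀ d w, ι d = some w → z d = X w d then
        linkedCorr E (insertEdge g ι) none (some ((g c).symm β)) (fun o => o.elim z X)
      else 0 else 0) =
    graphDeriv g (yCoeff E g c (outMomenta g X β c)) X +
      ∑ q : FactorPairs g (component g β)ᶜ,
        autSum g (component g β)ᶜ (insertionI E g β c (outMomenta g X β c) q) X := by
  have hQ := isUnion_compl (isUnion_component g β)
  rw [graphDeriv_yCoeff hD, sum_autSum_insertionI hD E g β c _ hQ disjoint_compl_right X]
  have h1 : (∑ ι : Fin D → Option W, if ι c = none then ∑ z : Fin D → M,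
      if z c = X ((g c).symm β) c ∧ ∀ d w, ι d = some w → z d = X w d then
        linkedCorr E (insertEdge g ι) none (some ((g c).symm β)) (fun o => o.elim z X)
      else 0 else 0) = insertionSum E g c (outMomenta g X β c) X +
      ∑ ι : Fin D → Option W, if ι c = none then ∑ z : Fin D → M,
      if z c = X ((g c).symm β) c ∧ ∀ d w, ι d = some w → z d = X w d then
        ∑ A : Set (Option W ⊕ Option B),
          if IsUnion (insertEdge g ι) A ∧ Sum.inl none ∈ A ∧
            Sum.inl (some ((g c).symm β)) ∉ A then
            corrOn E (insertEdge g ι) A (fun o => o.elim z X) *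
            corrOn E (insertEdge g ι) Aᶜ (fun o => o.elim z X) else 0
      else 0 else 0 := by
    rw [insertionSum, ← Finset.sum_add_distrib]
    refine Finset.sum_congr (by ext; simp) fun ι _ => ?_
    by_cases hc : ι c = none
    · rw [if_pos hc, if_pos hc, if_pos hc, ← Finset.sum_add_distrib]
      refine Finset.sum_congr (by ext; simp) fun z _ => ?_
      by_cases hz : z c = X ((g c).symm β) c ∧ ∀ d w, ι d = some w → z d = X w d
      · rw [if_pos hz, if_pos hz, if_pos (show z c = outMomenta g X β c ∧ _ from hz),
          linkedCorr_eq_add hD]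
      · rw [if_neg hz, if_neg hz, if_neg (show ¬ (z c = outMomenta g X β c ∧ _) from hz),
          add_zero]
    · rw [if_neg hc, if_neg hc, if_neg hc, add_zero]
  rw [h1, sum_corrOn_insertEdge hD]
  congr 1
  refine Finset.sum_congr rfl fun L _ => ?_
  by_cases hL : IsUnion g L
  swap
  · rw [if_neg fun h => hL h.1, if_neg fun h => hL h.1]
  have hmem : Sum.inl ((g c).symm β) ∈ L ↔ Sum.inr β ∈ L := by
    rw [hL c, Equiv.apply_symm_apply]
  -- A union of components that avoids `β` avoids its whole component.
  have hsub : L ⊆ (component g β)ᶜ ↔ Sum.inl ((g c).symm β) ∉ L := by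
    rw [hmem]
    constructor
    · exact fun h h' => h h' (mem_component g β)
    · exact fun h u hu hu' => component_subset (isUnion_compl hL) h hu' hu
  by_cases hx : Sum.inl ((g c).symm β) ∈ L
  · rw [if_neg fun h => h.2 hx, if_neg fun h => hsub.1 h.2 hx]
  · rw [if_pos ⟨hL, hx⟩, if_pos ⟨hL, hsub.2 hx⟩]
    have hcompl : component g β ∪ ((component g β)ᶜ \ L) = Lᶜ := by
      have h2 := hsub.2 hx
      ext u
      have h3 : u ∈ L → u ∉ component g β := fun h => h2 h
      simp only [Set.mem_union, Set.mem_sdiff, Set.mem_compl_iff]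
      tauto
    rw [hcompl]
    rfl

open Classical in
-- After the swap the white vertex of `β` is joined to `ρ` and conversely, so the two base points
-- lie in different factors exactly when `β` and `ρ` do.
theorem linkedCorr_edgeSwap (hD : 2 ≤ D) (E : (Fin D → M) → ℝ) (g : ColouredGraph D W B)
    (X : W → Fin D → M) (β ρ : B) (c : Fin D) :
    linkedCorr E (edgeSwap g c β ρ) ((g c).symm β) ((g c).symm ρ) X =
      graphDeriv (edgeSwap g c β ρ) (freeEnergyCoeff E (edgeSwap g c β ρ)) X +
      if ρ ∈ bridges g β c then ∑ q : FactorPairs g (component g β)ᶜ,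
        autSum g (component g β)ᶜ (bridgeH E g β c ρ q) X else 0 := by
  rw [linkedCorr_eq_add hD, graphDeriv_freeEnergyCoeff hD]
  congr 1
  have h1 := sum_isUnion_edgeSwap hD g c β ρ fun S T =>
    corrOn E (edgeSwap g c β ρ) S X * corrOn E (edgeSwap g c β ρ) T X
  refine Eq.trans (Finset.sum_congr (by ext; simp) fun A _ => ?_) (h1.trans ?_)
  · by_cases hA : IsUnion (edgeSwap g c β ρ) A
    · have e1 : Sum.inl ((g c).symm β) ∈ A ↔ Sum.inr ρ ∈ A := by
        rw [hA c, edgeSwap_same, Equiv.trans_apply, Equiv.apply_symm_apply, Equiv.swap_apply_left]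
      have e2 : Sum.inl ((g c).symm ρ) ∈ A ↔ Sum.inr β ∈ A := by
        rw [hA c, edgeSwap_same, Equiv.trans_apply, Equiv.apply_symm_apply,
          Equiv.swap_apply_right]
      exact if_congr (and_congr_right' (and_congr e1 (not_congr e2))) (mul_comm _ _) rfl
    · rw [if_neg fun h => hA h.1, if_neg fun h => hA h.1]
  · by_cases hb : ρ ∈ bridges g β c
    · rw [if_pos hb, if_pos hb]
      have hρ := (mem_bridges_iff.1 hb).1
      have hu := component_edgeSwap_union (c := c) hρ
      have hs : component (edgeSwap g c β ρ) β ⊆ component g β := hu ▸ Set.subset_union_left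
      have hs' : component (edgeSwap g c β ρ) ρ ⊆ component g β := hu ▸ Set.subset_union_right
      rw [sum_autSum_bridgeH hD E g β c ρ (isUnion_compl (isUnion_component g β))
        (fun h => h (mem_component g β)) (fun h => h hρ)
        (Set.disjoint_compl_right_iff_subset.2 hs) (Set.disjoint_compl_right_iff_subset.2 hs')]
    · rw [if_neg hb, if_neg hb]

open Classical in
-- For `ρ = β` the base points coincide, the graphs are connected, and the free momentum `t` gives
-- the sum over `b_c`. For `ρ ≠ β` only `t = y^ρ_c` occurs, and the Ward identity is applied to
-- linked sums, which are then decomposed into connected ones and products.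
theorem edgeSwap_part (hD : 2 ≤ D) {E : (Fin D → M) → ℝ} (hE : ∀ x, 0 < E x)
    (hkin : ∀ (c : Fin D) (t s : M) (p p' : Fin D → M),
      kineticDiff E p c t s = kineticDiff E p' c t s)
    (hinj : ∀ (c : Fin D) (t s : M) (p : Fin D → M), t ≠ s → kineticDiff E p c t s ≠ 0)
    (g : ColouredGraph D W B) {X : W → Fin D → M} (hX : OffDiagonal X) (β : B) (c : Fin D) :
    (∑ ρ, ∑ t, if ρ = β ∨ t = X ((g c).symm ρ) c then
      cutSeries E (edgeSwap g c β ρ) ((g c).symm β) ((g c).symm ρ) X ((g c).symm β) c t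
    else 0) = -(∑ b : M, diffQuotient E g X β c b) +
    (∑ ρ ∈ Finset.univ.erase β, (1 / kineticDiff E (outMomenta g X β) c (outMomenta g X ρ c)
        (outMomenta g X β c)) •
      (graphDeriv (edgeSwap g c β ρ) (freeEnergyCoeff E (edgeSwap g c β ρ)) X
        - graphDeriv (edgeSwap g c β ρ) (freeEnergyCoeff E (edgeSwap g c β ρ))
          (substMomentum g X β c (outMomenta g X ρ c)))) +
    ∑ τ ∈ bridges g β c, ∑ q : FactorPairs g (component g β)ᶜ,
      (1 / kineticDiff E (outMomenta g X β) c (outMomenta g X τ c) (outMomenta g X β c)) •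
        (autSum g (component g β)ᶜ (bridgeH E g β c τ q) X
          - autSum g (component g β)ᶜ (bridgeH E g β c τ q)
            (substMomentum g X β c (outMomenta g X τ c))) := by
  rw [← Finset.add_sum_erase _ _ (Finset.mem_univ β), add_assoc]
  congr 1
  · rw [← Finset.sum_neg_distrib]
    refine Finset.sum_congr rfl fun t _ => ?_
    rw [if_pos (Or.inl rfl), edgeSwap_self, cutSeries_eq_neg_diffQuotient hD hE hkin hinj]
  · have hb : bridges g β c ⊆ Finset.univ.erase β := by
      intro τ hτ
      refine Finset.mem_erase.2 ⟨?_, Finset.mem_univ _⟩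
      rintro rfl
      exact (mem_bridges_iff.1 hτ).2 (mem_component _ _)
    rw [← Finset.inter_eq_right.2 hb, ← Finset.filter_mem_eq_inter, Finset.sum_filter,
      ← Finset.sum_add_distrib]
    refine Finset.sum_congr rfl fun ρ hρ => ?_
    have hne : ρ ≠ β := Finset.ne_of_mem_erase hρ
    -- Only here are the momenta required to be off the coloured diagonals: the denominator
    -- `E(y^ρ_c, s_c)` must not vanish.
    have hXne : X ((g c).symm ρ) c ≠ X ((g c).symm β) c :=
      hX c _ _ fun h => hne ((g c).symm.injective h)
    rw [Finset.sum_eq_single (X ((g c).symm ρ) c) (fun t _ ht => if_neg fun h =>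
      h.elim hne ht) (by simp), if_pos (Or.inr rfl),
      cutSeries_of_ne hE hkin hinj _ _ _ X _ c hXne (outMomenta g X β)]
    have hsub : Function.update X ((g c).symm β) (Function.update (X ((g c).symm β)) c
        (X ((g c).symm ρ) c)) = substMomentum g X β c (outMomenta g X ρ c) := rfl
    -- The decomposition is also needed at the substituted momenta, which lie on a diagonal; it
    -- holds for all momenta.
    rw [hsub, linkedCorr_edgeSwap hD, linkedCorr_edgeSwap hD]
    by_cases hb' : ρ ∈ bridges g β c
    · rw [if_pos hb', if_pos hb', if_pos hb', ← Finset.smul_sum, Finset.sum_sub_distrib,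
        add_sub_add_comm, smul_add]
      rfl
    · rw [if_neg hb', if_neg hb', if_neg hb', add_zero, add_zero, add_zero]
      rfl

end SchwingerDyson

end TFT

theorem theorem4p1 {D : ℕ} (hD : 2 ≤ D) {M : Type*} [Fintype M]
    (E : (Fin D → M) → ℝ) (hE : ∀ x, 0 < E x)
    (hkin : ∀ (c : Fin D) (t s : M) (p p' : Fin D → M),
      kineticDiff E p c t s = kineticDiff E p' c t s)
    (hinj : ∀ (c : Fin D) (t s : M) (p : Fin D → M), t ≠ s → kineticDiff E p c t s ≠ 0)
    {W B : Type*} [Fintype W] [Fintype B] [DecidableEq B]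
    (g : ColouredGraph D W B) (hg : ¬ IsConnected g)
    (X : W → Fin D → M) (hX : OffDiagonal X)
    (β : B) (y : B → Fin D → M) (hy : y = outMomenta g X)
    (s : Fin D → M) (hs : s = y β)
    (Q : Set (W ⊕ B)) (hQ : Q = (component g β)ᶜ) :
    corr E g X =
      PowerSeries.C (-2 / E s) * PowerSeries.X * ∑ c : Fin D,
        (graphDeriv g (yCoeff E g c (s c)) X
        + ∑ ρ ∈ Finset.univ.erase β, (1 / kineticDiff E s c (y ρ c) (s c)) •
            (graphDeriv (edgeSwap g c β ρ) (freeEnergyCoeff E (edgeSwap g c β ρ)) X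
             - graphDeriv (edgeSwap g c β ρ) (freeEnergyCoeff E (edgeSwap g c β ρ))
                (substMomentum g X β c (y ρ c)))
        - ∑ b : M, diffQuotient E g X β c b
        + ∑ τ ∈ bridges g β c, ∑ q : FactorPairs g Q,
            (1 / kineticDiff E s c (y τ c) (s c)) •
              (autSum g Q (bridgeH E g β c τ q) X
               - autSum g Q (bridgeH E g β c τ q) (substMomentum g X β c (y τ c)))
        + ∑ q : FactorPairs g Q, autSum g Q (insertionI E g β c (s c) q) X) := by
  -- The statement has its own decidability instance; it is identified with the classical one used
  -- in the lemmas.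
  obtain rfl : ‹DecidableEq B› = fun _ _ => Classical.propDecidable _ := Subsingleton.elim _ _
  subst hs hy hQ
  rw [TFT.corr_eq_peeledSeries hD E hg X β]
  congr 1
  refine Finset.sum_congr rfl fun c _ => ?_
  rw [TFT.peeledSeries_eq, TFT.insertion_part hD, TFT.edgeSwap_part hD hE hkin hinj g hX β c]
  abel
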